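/- Let $n\ge 1$, $0\le k\le n$, and let $\Omega\subset\mathbb{R}^n$ be a bounded open Lipschitz set with piecewise $C^2$ boundary. This means that $\partial\Omega=\bigcup_{s=1}^N\overline{\Gamma_s}$, where the $\Gamma_s$ are pairwise disjoint $C^2$ hypersurfaces that are relatively open in $\partial\Omega$, and $\partial\Omega\setminus\bigcup_{s=1}^N\Gamma_s$ has zero surface measure. Let $\nu$ be the outward unit normal, which is defined almost everywhere on $\partial\Omega$ and everywhere on $\bigcup_s\Gamma_s$. Let $E_1,\dots,E_{n-1}$ be an orthonormal frame field of principal directions of $\bigcup_s\Gamma_s$ with associated principal curvatures $\gamma_1,\dots,\gamma_{n-1}$; that is, at every point of $\bigcup_s\Gamma_s$ the vectors $\nu,E_1,\dots,E_{n-1}$ are orthonormal and the tangential derivative of $\nu$ in the direction $E_l$ satisfies $\partial\nu/\partial E_l=\gamma_l E_l$ for every $l$. A $k$-form $\omega=\sum_{i_1<\cdots<i_k}\omega^{i_1\cdots i_k}\,dx^{i_1}\wedge\cdots\wedge dx^{i_k}$ has norm $|\omega|^2=\sum_{i_1<\cdots<i_k}(\omega^{i_1\cdots i_k})^2$. Vectors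 are identified with $1$-forms, $v\lrcorner\,\omega$ is the interior product, $(v\lrcorner\,\omega)^{i_1\cdots i_{k-1}}=\sum_j v^j\omega^{j i_1\cdots i_{k-1}}$ (zero if $k=0$), $d$ is the exterior derivative, $\delta$ is the codifferential $(\delta\omega)^{i_1\cdots i_{k-1}}=\sum_j\partial\omega^{j i_1\cdots i_{k-1}}/\partial x_j$ (zero if $k=0$), $|\nabla\omega|^2=\sum_j|\partial\omega/\partial x_j|^2$, and $\|\cdot\|$ is the norm of $L^2(\Omega)$. We write $\omega\in C^1(\overline\Omega;\Lambda^k)$ if $\omega$ is $C^1$ in $\Omega$ and $\omega$ and its first derivatives extend continuously to $\overline\Omega$. (i) If $\omega\in C^1(\overline\Omega;\Lambda^k)$ satisfies $\nu\wedge\omega=0$ almost everywhere on $\partial\Omega$, then $\sum_{l=1}^{n-1}\gamma_l|E_l\wedge\omega|^2$ is integrable on each $\Gamma_s$ for the surface measure and $$\|d\omega\|^2+\|\delta\omega\|^2-\|\nabla\omega\|^2=\sum_{s=1}^N\int_{\Gamma_s}\Big(\sum_{l=1}^{n-1}\gamma_l\,|E_l\wedge\omega|^2\Big).$$ (ii)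 If $\omega\in C^1(\overline\Omega;\Lambda^k)$ satisfies $\nu\lrcorner\,\omega=0$ almost everywhere on $\partial\Omega$, then $\sum_{l=1}^{n-1}\gamma_l|E_l\lrcorner\,\omega|^2$ is integrable on each $\Gamma_s$ for the surface measure and $$\|d\omega\|^2+\|\delta\omega\|^2-\|\nabla\omega\|^2=\sum_{s=1}^N\int_{\Gamma_s}\Big(\sum_{l=1}^{n-1}\gamma_l\,|E_l\lrcorner\,\omega|^2\Big).$$ -/

import Mathlib

open MeasureTheory Topology Set
open scoped RealInnerProductSpace

noncomputable section

/-- Euclidean space `ℝⁿ`. -/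
abbrev Rn (n : ℕ) : Type := EuclideanSpace ℝ (Fin n)

/-- The space `Λᵏ(ℝⁿ)` of exterior `k`-forms on `ℝⁿ`, as alternating `k`-linear maps. -/
abbrev KForm (n k : ℕ) : Type := (Rn n) [⋀^Fin k]→L[ℝ] ℝ

namespace KForm

variable {n : ℕ}

/-- The `j`-th vector of the standard basis of `ℝⁿ`. -/
def stdVec (j : Fin n) : Rn n := EuclideanSpace.single j 1

/-- The component `ω^{i₁ ⋯ iₖ} = ω(e_{i₁}, …, e_{iₖ})` of a `k`-form. -/
def comp {k : ℕ} (ω : KForm n k) (I : Fin k → Fin n) : ℝ := ω fun a => stdVec (I a)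

open scoped Classical in
/-- The squared Euclidean norm `|ω|² = ∑_{i₁ < ⋯ < iₖ} (ω^{i₁ ⋯ iₖ})²` of a `k`-form. -/
def normSq {k : ℕ} (ω : KForm n k) : ℝ :=
  ∑ I : Fin k → Fin n with StrictMono I, comp ω I ^ 2

/-- The exterior product `v ∧ ω`, where the vector `v` is identified with the `1`-form `⟪v, ·⟫`:
`(v ∧ ω)(u₀, …, uₖ) = ∑ᵢ (-1)ⁱ ⟪v, uᵢ⟫ ω(u₀, …, ûᵢ, …, uₖ)`. -/
def wedge {k : ℕ} (v : Rn n) (ω : KForm n k) : KForm n (k + 1) :=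
  ContinuousAlternatingMap.alternatizeUncurryFin ((innerSL ℝ v).smulRight ω)

/-- The interior product `v ⌟ ω = ω(v, ·, …, ·)`; it is zero on `0`-forms. -/
def interior : {k : ℕ} → Rn n → KForm n k → KForm n (k - 1)
  | 0, _, _ => 0
  | _ + 1, v, ω => ω.curryLeft v

/-- The codifferential `δω = ∑ⱼ eⱼ ⌟ ∂ω/∂xⱼ`, i.e.
`(δω)^{i₁ ⋯ iₖ₋₁} = ∑ⱼ ∂ω^{j i₁ ⋯ iₖ₋₁}/∂xⱼ`; it is zero on `0`-forms. -/
def codiff {k : ℕ} (ω : Rn n → KForm n k) (x : Rn n) : KForm n (k - 1) :=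
  ∑ j : Fin n, interior (stdVec j) (fderiv ℝ ω x (stdVec j))

/-- `|∇ω|² = ∑ⱼ ∑_I (∂ω^I/∂xⱼ)²`. -/
def gradNormSq {k : ℕ} (ω : Rn n → KForm n k) (x : Rn n) : ℝ :=
  ∑ j : Fin n, normSq (fderiv ℝ ω x (stdVec j))

end KForm

variable {n : ℕ}

/-- Open sets with Lipschitz boundary: near every boundary point, in suitable orthonormal
coordinates with last axis directed by the unit vector `e`, the set lies strictly below the graph of
a Lipschitz function of the other `n - 1` coordinates, i.e. of the orthogonal projection of the
point on `e^⊥`. -/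
def IsLipschitzOpenSet (Ω : Set (Rn n)) : Prop :=
  IsOpen Ω ∧ ∀ x ∈ frontier Ω, ∃ (e : Rn n) (U : Set (Rn n)) (K : NNReal) (φ : (ℝ ∙ e)ᗮ → ℝ),
    ‖e‖ = 1 ∧ IsOpen U ∧ x ∈ U ∧ LipschitzWith K φ ∧
      ∀ y ∈ U, y ∈ Ω ↔ ⟪e, y⟫ < φ ((ℝ ∙ e)ᗮ.orthogonalProjectionOnto y)

/-- Embedded hypersurfaces of class `C²`: locally, the zero set of a `C²` function with
nonvanishing gradient. -/
def IsC2Hypersurface (S : Set (Rn n)) : Prop :=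
  ∀ x ∈ S, ∃ (U : Set (Rn n)) (ρ : Rn n → ℝ), IsOpen U ∧ x ∈ U ∧ ContDiffOn ℝ 2 ρ U ∧
    fderiv ℝ ρ x ≠ 0 ∧ ∀ y ∈ U, y ∈ S ↔ ρ y = 0

/-- `v` is the outward unit normal to `Ω` at `x`: to first order at `x`, the set `Ω` agrees with
the half-space `{y | ⟪v, y - x⟫ < 0}`. -/
def IsOutwardUnitNormal (Ω : Set (Rn n)) (x v : Rn n) : Prop :=
  ‖v‖ = 1 ∧ ∀ ε > 0, ∀ᶠ y in 𝓝 x,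
    (y ∈ Ω → ⟪v, y - x⟫ ≤ ε * ‖y - x‖) ∧ (y ∉ Ω → -(ε * ‖y - x‖) ≤ ⟪v, y - x⟫)

theorem IsOutwardUnitNormal.half {Ω : Set (Rn n)} {x v v' w : Rn n}
    (h : IsOutwardUnitNormal Ω x v) (h' : IsOutwardUnitNormal Ω x v') (hw : ⟪v, w⟫ < 0) :
    ⟪v', w⟫ ≤ 0 := by
  have hw0 : 0 < ‖w‖ := by
    rw [norm_pos_iff]; rintro rfl; simp at hw
  have tend : Filter.Tendsto (fun t : ℝ => x + t • w) (𝓝[>] 0) (𝓝 x) := by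
    have : Continuous (fun t : ℝ => x + t • w) := by fun_prop
    have := this.tendsto 0
    simp only [zero_smul, add_zero] at this
    exact this.mono_left nhdsWithin_le_nhds
  refine le_of_forall_pos_le_add fun δ hδ => ?_
  have e1 := tend.eventually (h.2 (-⟪v, w⟫ / (2 * ‖w‖)) (by apply div_pos <;> linarith))
  have e2 := tend.eventually (h'.2 (δ / ‖w‖) (by positivity))
  obtain ⟨t, ⟨h1, h2⟩, ht⟩ := ((e1.and e2).and self_mem_nhdsWithin).exists
  have ht : 0 < t := ht
  simp only [add_sub_cancel_left, inner_smul_right, norm_smul, Real.norm_eq_abs, abs_of_pos ht] at h1 h2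
  have a1 : -⟪v, w⟫ / (2 * ‖w‖) * (t * ‖w‖) = t * (-⟪v, w⟫ / 2) := by field_simp
  have a2 : δ / ‖w‖ * (t * ‖w‖) = t * δ := by field_simp
  rw [a1] at h1
  rw [a2] at h2
  have hin : x + t • w ∈ Ω := by
    by_contra hn
    have := h1.2 hn
    nlinarith
  have := h2.1 hin
  have := le_of_mul_le_mul_left this ht
  linarith

/-- The outward unit normal is unique where it exists. -/
theorem IsOutwardUnitNormal.unique {Ω : Set (Rn n)} {x v v' : Rn n}
    (h : IsOutwardUnitNormal Ω x v) (h' : IsOutwardUnitNormal Ω x v') : v = v' := by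
  by_contra hne
  have h1 : ⟪v, v'⟫ < 1 := by
    exact (inner_lt_one_iff_real_of_norm_eq_one h.1 h'.1).2 hne
  have vv : ⟪v, v⟫ = (1:ℝ) := by rw [real_inner_self_eq_norm_sq, h.1]; norm_num
  have vv' : ⟪v', v'⟫ = (1:ℝ) := by rw [real_inner_self_eq_norm_sq, h'.1]; norm_num
  have := h.half h' (w := v' - v) (by rw [inner_sub_right, vv]; linarith)
  rw [inner_sub_right, vv', real_inner_comm] at this
  linarith

open scoped Classical in
/-- The outward unit normal field `ν` of `Ω`, extended by `0` to the points without a normal. -/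
def outwardUnitNormal (Ω : Set (Rn n)) (x : Rn n) : Rn n :=
  if h : ∃ v, IsOutwardUnitNormal Ω x v then h.choose else 0

theorem IsOutwardUnitNormal.eq {Ω : Set (Rn n)} {x v : Rn n}
    (h : IsOutwardUnitNormal Ω x v) : outwardUnitNormal Ω x = v := by
  have hex : ∃ v, IsOutwardUnitNormal Ω x v := ⟨v, h⟩
  rw [outwardUnitNormal, dif_pos hex]
  exact hex.choose_spec.unique h

/-- The surface measure: the `(n - 1)`-dimensional Hausdorff measure, normalized so as to agree
with Lebesgue measure on `(n - 1)`-dimensional Euclidean space. -/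
def surfaceMeasure (n : ℕ) : Measure (Rn n) := μHE[n - 1]

/-- The bounded open Lipschitz set `Ω` has piecewise `C²` boundary with smooth pieces `Γ s`: these
are pairwise disjoint `C²` hypersurfaces, relatively open in `∂Ω`, whose closures cover `∂Ω` and
whose union is `∂Ω` up to a set of zero surface measure. -/
structure HasPiecewiseC2Boundary (Ω : Set (Rn n)) {N : ℕ} (Γ : Fin N → Set (Rn n)) : Prop where
  frontier_eq : frontier Ω = ⋃ s, closure (Γ s)
  relOpen : ∀ s, ∃ U : Set (Rn n), IsOpen U ∧ Γ s = U ∩ frontier Ω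
  smooth : ∀ s, IsC2Hypersurface (Γ s)
  disjoint : Pairwise fun s t => Disjoint (Γ s) (Γ t)
  null : surfaceMeasure n (frontier Ω \ ⋃ s, Γ s) = 0

/-- `E₁, …, Eₙ₋₁` is an orthonormal frame field of principal directions of the part `S` of `∂Ω`,
with principal curvatures `γ₁, …, γₙ₋₁`: at every point of `S`, the vectors `ν, E₁, …, Eₙ₋₁` are
orthonormal and the derivative of `ν` along `S` in direction `E_l` equals `γ_l E_l`. -/
def IsPrincipalFrame (Ω S : Set (Rn n)) (E : Fin (n - 1) → Rn n → Rn n)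
    (γ : Fin (n - 1) → Rn n → ℝ) : Prop :=
  ∀ x ∈ S, Orthonormal ℝ (fun l => E l x) ∧ (∀ l, ⟪outwardUnitNormal Ω x, E l x⟫ = 0) ∧
    ∃ L : Rn n →L[ℝ] Rn n, HasFDerivWithinAt (outwardUnitNormal Ω) L S x ∧
      ∀ l, L (E l x) = γ l x • E l x

/-- `ω ∈ C¹(Ω̄; Λᵏ)`: `ω` is `C¹` in the open set `Ω`, and `ω` and its first derivatives extend
continuously to `Ω̄` (the values of `ω` on `∂Ω` being those of the extension). -/
structure IsC1UpToBoundary {k : ℕ} (Ω : Set (Rn n)) (ω : Rn n → KForm n k) : Prop where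
  contDiffOn : ContDiffOn ℝ 1 ω Ω
  continuousOn : ContinuousOn ω (closure Ω)
  fderiv_extends : ∃ D : Rn n → Rn n →L[ℝ] KForm n k,
    ContinuousOn D (closure Ω) ∧ ∀ x ∈ Ω, fderiv ℝ ω x = D x

/-- `ω ∈ C¹_T(Ω̄; Λᵏ)`: moreover `ν ∧ ω = 0` almost everywhere on `∂Ω`. -/
def IsC1T {k : ℕ} (Ω : Set (Rn n)) (ω : Rn n → KForm n k) : Prop :=
  IsC1UpToBoundary Ω ω ∧ ∀ᵐ x ∂(surfaceMeasure n).restrict (frontier Ω),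
    KForm.wedge (outwardUnitNormal Ω x) (ω x) = 0

/-- `ω ∈ C¹_N(Ω̄; Λᵏ)`: moreover `ν ⌟ ω = 0` almost everywhere on `∂Ω`. -/
def IsC1N {k : ℕ} (Ω : Set (Rn n)) (ω : Rn n → KForm n k) : Prop :=
  IsC1UpToBoundary Ω ω ∧ ∀ᵐ x ∂(surfaceMeasure n).restrict (frontier Ω),
    KForm.interior (outwardUnitNormal Ω x) (ω x) = 0

/-- `‖dω‖² + ‖δω‖² - ‖∇ω‖²`, with the norms of `L²(Ω)`. -/
def gaffneyDefect {k : ℕ} (Ω : Set (Rn n)) (ω : Rn n → KForm n k) : ℝ :=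
  (∫ x in Ω, KForm.normSq (extDeriv ω x)) + (∫ x in Ω, KForm.normSq (KForm.codiff ω x)) -
    ∫ x in Ω, KForm.gradNormSq ω x

end

noncomputable section

/-! ### Algebra of exterior forms and the pointwise Gaffney density. -/

namespace KForm

variable {n k : ℕ}

/-! Expand |dω|² using that v∧ and v⌟ are adjoint (`inn_wedge_left`) and that v⌟(w∧α) = ⟨v,w⟩α −
w∧(v⌟α) (`contr_wedge`). The term |∇ω|² cancels, and `gaffney_density` leaves a sum of scalar
expressions ∂ᵢf ∂ⱼg − ∂ⱼf ∂ᵢg, where f and g are components of eᵢ⌟ω and eⱼ⌟ω. Each is a null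
Lagrangian, that is, a divergence. Its integral over Ω is therefore a boundary integral with only
first derivatives of g (`IsLipschitzOpenSet.integral_null_lagrangian`), and the defect becomes the
integral of `gaffneyBoundary` over ∂Ω.

That density is the trace ∑ⱼ (⟨ν⌟ω, eⱼ⌟∂ⱼω⟩ − ⟨eⱼ⌟ω, ν⌟∂ⱼω⟩), so it may be computed in the basis ν,
E₁, …, Eₙ₋₁. The ν term cancels and only tangential derivatives of ω remain. Differentiating ν∧ω = 0
or ν⌟ω = 0 along E_l expresses ν∧∂ω/∂E_l or ν⌟∂ω/∂E_l as −γ_l E_l∧ω or −γ_l E_l⌟ω, and the curvature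
terms appear (`gaffneyBoundary_of_wedge_eq_zero`, `gaffneyBoundary_of_contr_eq_zero`).

The analysis lies in the low regularity. The divergence theorem on a Lipschitz set rests on the area
formula for Lipschitz graphs (`comap_graphMap_euclideanHausdorffMeasure`) and a shear flattening the
graph (`setIntegral_fderiv_subgraph`). Since ω is only C¹ up to the boundary, the null Lagrangian
identity is proved for smooth g and carried over by mollification, by translation into Ω and by a
partition of unity. To differentiate the boundary condition, the continuous extension of ∇ω must be
a derivative relative to the closure (`IsLipschitzOpenSet.hasFDerivWithinAt_closure`), vectors
orthogonal to ν must be tangent to ∂Ω (`IsOutwardUnitNormal.mem_tangentConeAt`), and the almost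
everywhere condition must hold at every point of the smooth pieces
(`IsLipschitzOpenSet.eq_zero_of_ae`). -/

theorem sum_smul_stdVec (v : Rn n) : ∑ j, v j • (stdVec j : Rn n) = v := by
  ext i
  simp [stdVec, Pi.single_apply, Finset.sum_apply]

theorem inner_stdVec (v : Rn n) (j : Fin n) : ⟪v, stdVec j⟫ = v j := by
  simp [stdVec, EuclideanSpace.inner_single_right]

theorem comp_perm (α : KForm n k) (I : Fin k → Fin n) (σ : Equiv.Perm (Fin k)) :
    comp α (I ∘ σ) = (Equiv.Perm.sign σ : ℤ) • comp α I := by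
  have := α.toAlternatingMap.map_perm (fun a => (stdVec (I a) : Rn n)) σ
  simpa [comp, Function.comp_def, Units.smul_def] using this

theorem comp_eq_zero_of_not_injective (α : KForm n k) {I : Fin k → Fin n}
    (hI : ¬ Function.Injective I) : comp α I = 0 := by
  simp only [Function.Injective, not_forall] at hI
  obtain ⟨a, b, h, hab⟩ := hI
  exact α.map_eq_zero_of_eq _ (by simp [h]) hab

open scoped Classical in
-- An injective multi-index is, in exactly one way, an increasing one composed with a permutation.
-- This lets the algebra run over all multi-indices, where no ordering has to be tracked, while
-- `normSq` sums over increasing ones.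
theorem sum_eq_factorial_mul_sum_strictMono (q : (Fin k → Fin n) → ℝ)
    (hq : ∀ I (σ : Equiv.Perm (Fin k)), q (I ∘ σ) = q I)
    (h0 : ∀ I, ¬ Function.Injective I → q I = 0) :
    ∑ I, q I = (k.factorial : ℝ) * ∑ I : Fin k → Fin n with StrictMono I, q I := by
  have h1 : ∑ I, q I = ∑ I : Fin k → Fin n with Function.Injective I, q I := by
    rw [Finset.sum_filter]
    refine Finset.sum_congr rfl fun I _ => ?_
    split_ifs with h
    · rfl
    · exact h0 I h
  have h2 : ∑ p ∈ (Finset.univ.filter fun I : Fin k → Fin n => StrictMono I) ×ˢ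
      (Finset.univ : Finset (Equiv.Perm (Fin k))), q p.1 =
      ∑ I : Fin k → Fin n with Function.Injective I, q I := by
    refine Finset.sum_nbij (fun p => p.1 ∘ p.2) ?_ ?_ ?_ ?_
    · rintro ⟨I, σ⟩ h
      simp only [Finset.mem_product, Finset.mem_filter, Finset.mem_univ, true_and, and_true] at h ⊢
      exact h.injective.comp σ.injective
    · rintro ⟨I, σ⟩ h ⟨J, τ⟩ h' hIJ
      simp only [Finset.coe_product, Finset.coe_filter, Finset.mem_univ, true_and,
        Finset.coe_univ, Set.mem_prod, Set.mem_ofPred_eq, Set.mem_univ, and_true] at h h'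
      simp only at hIJ
      have hr : Set.range I = Set.range J := by
        rw [← σ.surjective.range_comp I, hIJ, τ.surjective.range_comp J]
      have hIJ' : I = J := (h.range_inj h').1 hr
      subst hIJ'
      have : σ = τ := by
        ext a
        exact congrArg Fin.val (h.injective (congrFun hIJ a))
      rw [this]
    · rintro J hJ
      simp only [Finset.coe_filter, Finset.mem_univ, true_and, Set.mem_ofPred_eq] at hJ
      refine ⟨⟨J ∘ Tuple.sort J, (Tuple.sort J)⁻¹⟩, ?_, ?_⟩
      · simp only [Finset.coe_product, Finset.coe_filter, Finset.mem_univ, true_and,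
          Finset.coe_univ, Set.mem_prod, Set.mem_ofPred_eq, Set.mem_univ, and_true]
        exact (Tuple.monotone_sort J).strictMono_of_injective
          (hJ.comp (Tuple.sort J).injective)
      · ext a; simp
    · rintro ⟨I, σ⟩ _
      exact (hq I σ).symm
  rw [h1, ← h2, Finset.sum_product]
  simp [Finset.card_univ, Fintype.card_perm, Finset.mul_sum]

/-- The Euclidean inner product of `k`-forms. -/
def inn : KForm n k →ₗ[ℝ] KForm n k →ₗ[ℝ] ℝ :=
  LinearMap.mk₂ ℝ (fun α β => (k.factorial : ℝ)⁻¹ * ∑ I, comp α I * comp β I)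
    (by intro a b c; simp [comp, add_mul, Finset.sum_add_distrib, mul_add])
    (by intro r a b; simp only [comp, ContinuousAlternatingMap.smul_apply, smul_eq_mul, mul_assoc,
          ← Finset.mul_sum]; ring)
    (by intro a b c; simp [comp, Finset.sum_add_distrib, mul_add])
    (by intro r a b; simp only [comp, ContinuousAlternatingMap.smul_apply, smul_eq_mul,
          mul_left_comm _ r, ← Finset.mul_sum])

theorem inn_apply (α β : KForm n k) :
    inn α β = (k.factorial : ℝ)⁻¹ * ∑ I, comp α I * comp β I := rfl

theorem inn_comm (α β : KForm n k) : inn α β = inn β α := by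
  simp [inn_apply, mul_comm]

theorem normSq_eq_inn (α : KForm n k) : normSq α = inn α α := by
  rw [inn_apply, sum_eq_factorial_mul_sum_strictMono (fun I => comp α I * comp α I), ← mul_assoc,
    inv_mul_cancel₀ (by positivity), one_mul, normSq]
  · simp [sq]
  · intro I σ
    simp only [comp_perm]
    rcases Int.units_eq_one_or (Equiv.Perm.sign σ) with h | h <;> simp [h]
  · intro I hI
    simp [comp_eq_zero_of_not_injective α hI]

theorem continuous_normSq : Continuous (normSq : KForm n k → ℝ) := by
  unfold normSq comp
  fun_prop

/-- The interior product `v ⌟ ω` of a form of positive degree. -/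
def contr (v : Rn n) (ω : KForm n (k + 1)) : KForm n k := ω.curryLeft v

theorem interior_succ (v : Rn n) (ω : KForm n (k + 1)) : interior v ω = contr v ω := rfl

theorem interior_zero_form (v : Rn n) (ω : KForm n 0) : interior v ω = 0 := rfl

/-- The interior product as a bilinear map. -/
def contrL : Rn n →ₗ[ℝ] KForm n (k + 1) →ₗ[ℝ] KForm n k :=
  LinearMap.mk₂ ℝ (fun v ω => contr v ω)
    (by intros; simp [contr]) (by intros; simp [contr])
    (by intros; ext; simp [contr]) (by intros; ext; simp [contr])

theorem contrL_apply (v : Rn n) (ω : KForm n (k + 1)) : contrL v ω = contr v ω := rfl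

/-- The exterior product as a bilinear map. -/
def wedgeL : Rn n →ₗ[ℝ] KForm n k →ₗ[ℝ] KForm n (k + 1) :=
  LinearMap.mk₂ ℝ wedge
    (by intros; ext; simp [wedge, ContinuousAlternatingMap.alternatizeUncurryFin_apply,
      add_mul, mul_add, Finset.sum_add_distrib, inner_add_left])
    (by intros; ext; simp [wedge, ContinuousAlternatingMap.alternatizeUncurryFin_apply,
      Finset.mul_sum, inner_smul_left, mul_assoc, mul_left_comm])
    (by intros; ext; simp [wedge, ContinuousAlternatingMap.alternatizeUncurryFin_apply,
      mul_add, Finset.sum_add_distrib])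
    (by intros; ext; simp [wedge, ContinuousAlternatingMap.alternatizeUncurryFin_apply,
      Finset.mul_sum, mul_left_comm])

theorem wedgeL_apply (v : Rn n) (ω : KForm n k) : wedgeL v ω = wedge v ω := rfl

theorem wedge_apply (v : Rn n) (ω : KForm n k) (u : Fin (k + 1) → Rn n) :
    wedge v ω u = ∑ i : Fin (k + 1), (-1) ^ (i : ℕ) * (⟪v, u i⟫ * ω (i.removeNth u)) := by
  simp [wedge, ContinuousAlternatingMap.alternatizeUncurryFin_apply]

theorem comp_contr (v : Rn n) (ω : KForm n (k + 1)) (I : Fin k → Fin n) :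
    comp (contr v ω) I = ∑ j, v j * comp ω (Fin.cons j I) := by
  conv_lhs => rw [← sum_smul_stdVec v, ← contrL_apply]
  simp only [map_sum, map_smul, LinearMap.sum_apply, LinearMap.smul_apply, comp,
    ContinuousAlternatingMap.sum_apply, ContinuousAlternatingMap.smul_apply, smul_eq_mul,
    contrL_apply, contr, ContinuousAlternatingMap.curryLeft_apply_apply]
  refine Finset.sum_congr rfl fun j _ => ?_
  congr 2
  ext a : 1
  refine Fin.cases ?_ (fun a => ?_) a <;> simp [Matrix.vecCons]

theorem comp_insertNth (ω : KForm n (k + 1)) (i : Fin (k + 1)) (j : Fin n) (I : Fin k → Fin n) :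
    comp ω (i.insertNth j I) = (-1) ^ (i : ℕ) * comp ω (Fin.cons j I) := by
  have := ω.map_insertNth i (stdVec j) (fun a => stdVec (I a))
  have e1 : (fun a => (stdVec ((i.insertNth j I : Fin (k + 1) → Fin n) a) : Rn n)) =
      i.insertNth (stdVec j) (fun a => stdVec (I a)) := by
    ext a : 1
    refine Fin.succAboveCases i ?_ (fun a => ?_) a <;> simp
  have e2 : (fun a => (stdVec ((Fin.cons j I : Fin (k + 1) → Fin n) a) : Rn n)) =
      Matrix.vecCons (stdVec j) (fun a => stdVec (I a)) := by
    ext a : 1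
    refine Fin.cases ?_ (fun a => ?_) a <;> simp [Matrix.vecCons]
  rw [comp, comp, e1, e2, this, zsmul_eq_mul]
  push_cast
  rfl

/-- The exterior and the interior product by `v` are adjoint. -/
theorem inn_wedge_left (v : Rn n) (α : KForm n k) (β : KForm n (k + 1)) :
    inn (wedge v α) β = inn α (contr v β) := by
  have key : ∑ J : Fin (k + 1) → Fin n, comp (wedge v α) J * comp β J =
      (k + 1 : ℝ) * ∑ I : Fin k → Fin n, comp α I * comp (contr v β) I := by
    have h1 : ∀ J : Fin (k + 1) → Fin n, comp (wedge v α) J * comp β J =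
        ∑ i : Fin (k + 1), (-1) ^ (i : ℕ) * (v (J i) * comp α (i.removeNth J)) * comp β J := by
      intro J
      rw [comp, wedge_apply, Finset.sum_mul]
      refine Finset.sum_congr rfl fun i _ => ?_
      rw [inner_stdVec]
      rfl
    simp_rw [h1]
    rw [Finset.sum_comm]
    -- Split J into its entry at position i and the rest. Moving that entry to the front costs the
    -- sign (-1)^i already present in the wedge, so each of the k + 1 positions contributes the same
    -- sum; the factor k + 1 is absorbed by the factorials.
    have h2 : ∀ i : Fin (k + 1), ∑ J : Fin (k + 1) → Fin n,
        (-1) ^ (i : ℕ) * (v (J i) * comp α (i.removeNth J)) * comp β J =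
        ∑ I : Fin k → Fin n, comp α I * comp (contr v β) I := by
      intro i
      rw [← (Fin.insertNthEquiv (fun _ => Fin n) i).sum_comp, Fintype.sum_prod_type,
        Finset.sum_comm]
      refine Finset.sum_congr rfl fun I _ => ?_
      rw [comp_contr, Finset.mul_sum]
      refine Finset.sum_congr rfl fun j _ => ?_
      have e : (Fin.insertNthEquiv (fun _ => Fin n) i) (j, I) = i.insertNth j I := rfl
      rw [e, comp_insertNth, Fin.insertNth_apply_same, Fin.removeNth_insertNth]
      have : ((-1 : ℝ) ^ (i : ℕ)) * (-1) ^ (i : ℕ) = 1 := by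
        rw [← mul_pow]; simp
      linear_combination (v j * comp α I * comp β (Fin.cons j I)) * this
    simp [h2]
  rw [inn_apply, inn_apply, key, Nat.factorial_succ, ← mul_assoc]
  congr 1
  push_cast
  field_simp

theorem contr_wedge_zero_form (v w : Rn n) (α : KForm n 0) :
    contr v (wedge w α) = ⟪v, w⟫ • α := by
  ext u
  rw [contr, ContinuousAlternatingMap.curryLeft_apply_apply, wedge_apply]
  simp [real_inner_comm]

/-- In the alternating sum defining w∧α, the 0-th term pairs w with v; in every other term v stays
in the first slot of α and the sign shifts by one. -/
theorem contr_wedge (v w : Rn n) (α : KForm n (k + 1)) :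
    contr v (wedge w α) = ⟪v, w⟫ • α - wedge w (contr v α) := by
  ext u
  rw [contr, ContinuousAlternatingMap.curryLeft_apply_apply, wedge_apply, Fin.sum_univ_succ]
  simp only [ContinuousAlternatingMap.sub_apply, ContinuousAlternatingMap.smul_apply, smul_eq_mul,
    wedge_apply, contr, ContinuousAlternatingMap.curryLeft_apply_apply]
  rw [sub_eq_add_neg, ← Finset.sum_neg_distrib]
  congr 1
  · simp [real_inner_comm]
  · refine Finset.sum_congr rfl fun i _ => ?_
    have : (i.succ.removeNth (Matrix.vecCons v u) : Fin (k + 1) → Rn n) =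
        Matrix.vecCons v (i.removeNth u) := by
      ext a : 1
      refine Fin.cases ?_ (fun a => ?_) a
      · simp [Fin.removeNth, Matrix.vecCons]
      · simp [Fin.removeNth, Matrix.vecCons]
    rw [this]
    simp [Matrix.vecCons, pow_succ]

theorem alternatizeUncurryFin_eq_sum (A : Rn n →L[ℝ] KForm n k) :
    ContinuousAlternatingMap.alternatizeUncurryFin A = ∑ j, wedge (stdVec j) (A (stdVec j)) := by
  ext u
  rw [ContinuousAlternatingMap.alternatizeUncurryFin_apply, ContinuousAlternatingMap.sum_apply]
  simp_rw [wedge_apply]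
  rw [Finset.sum_comm]
  refine Finset.sum_congr rfl fun i _ => ?_
  conv_lhs => rw [← sum_smul_stdVec (u i)]
  simp only [map_sum, map_smul, ContinuousAlternatingMap.sum_apply,
    ContinuousAlternatingMap.smul_apply, smul_eq_mul, zsmul_eq_mul, Finset.mul_sum]
  refine Finset.sum_congr rfl fun j _ => ?_
  rw [real_inner_comm, inner_stdVec]
  push_cast
  ring

theorem inner_stdVec_stdVec (i j : Fin n) :
    ⟪(stdVec i : Rn n), stdVec j⟫ = if i = j then (1 : ℝ) else 0 := by
  rw [inner_stdVec]
  simp [stdVec, PiLp.single_apply, eq_comm]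

/-- For `0`-forms, `|dω|² = |∇ω|²`. -/
theorem normSq_alternatize_zero_form (A : Rn n →L[ℝ] KForm n 0) :
    normSq (ContinuousAlternatingMap.alternatizeUncurryFin A) =
      ∑ j, normSq (A (stdVec j)) := by
  simp only [normSq_eq_inn, alternatizeUncurryFin_eq_sum, map_sum, LinearMap.sum_apply,
    inn_wedge_left, contr_wedge_zero_form, map_smul, inner_stdVec_stdVec]
  simp

/-- The pointwise Gaffney density:
`|dω|² + |δω|² - |∇ω|² = ∑ᵢⱼ (⟨eᵢ ⌟ ∂ᵢω, eⱼ ⌟ ∂ⱼω⟩ - ⟨eᵢ ⌟ ∂ⱼω, eⱼ ⌟ ∂ᵢω⟩)`. -/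
theorem gaffney_density (A : Rn n →L[ℝ] KForm n (k + 1)) :
    normSq (ContinuousAlternatingMap.alternatizeUncurryFin A) +
      normSq (∑ j, contr (stdVec j) (A (stdVec j))) - ∑ j, normSq (A (stdVec j)) =
    ∑ i, ∑ j, (inn (contr (stdVec i) (A (stdVec i))) (contr (stdVec j) (A (stdVec j))) -
      inn (contr (stdVec i) (A (stdVec j))) (contr (stdVec j) (A (stdVec i)))) := by
  -- Adjointness and `contr_wedge` give ⟨eᵢ∧∂ᵢω, eⱼ∧∂ⱼω⟩ = δᵢⱼ⟨∂ᵢω, ∂ⱼω⟩ − ⟨eⱼ⌟∂ᵢω, eᵢ⌟∂ⱼω⟩; the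
  -- diagonal part sums to |∇ω|².
  have h1 : normSq (ContinuousAlternatingMap.alternatizeUncurryFin A) =
      ∑ j, normSq (A (stdVec j)) - ∑ i, ∑ j,
        inn (contr (stdVec i) (A (stdVec j))) (contr (stdVec j) (A (stdVec i))) := by
    simp only [normSq_eq_inn, alternatizeUncurryFin_eq_sum, map_sum, LinearMap.sum_apply,
      inn_wedge_left, contr_wedge, map_smul, map_sub, inner_stdVec_stdVec,
      Finset.sum_sub_distrib]
    congr 1
    · simp
    · refine Finset.sum_congr rfl fun i _ => Finset.sum_congr rfl fun j _ => ?_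
      rw [inn_comm, inn_wedge_left, inn_comm]
  rw [h1]
  simp only [normSq_eq_inn, map_sum, LinearMap.sum_apply, Finset.sum_sub_distrib]
  rw [Finset.sum_comm (f := fun i j => inn (contr (stdVec i) (A (stdVec i)))
    (contr (stdVec j) (A (stdVec j))))]
  ring

end KForm

/-! ### Area formula for Lipschitz graphs. -/

section Graph

open Module Filter
open scoped ENNReal NNReal

/-- The hypothesis makes a x ↦ b x a well-defined K-Lipschitz map on `a '' t`. It is used to compare
two graphs over the same base set. -/
theorem euclideanHausdorffMeasure_image_le_of_dist_le {X Y Z : Type*} [MetricSpace Y]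
    [MeasurableSpace Y] [BorelSpace Y] [MetricSpace Z] [MeasurableSpace Z] [BorelSpace Z]
    (a : X → Y) (b : X → Z) (t : Set X) (K : ℝ≥0) (d : ℕ)
    (h : ∀ x ∈ t, ∀ y ∈ t, dist (b x) (b y) ≤ K * dist (a x) (a y)) :
    μHE[d] (b '' t) ≤ (K : ℝ≥0∞) ^ d * μHE[d] (a '' t) := by
  rcases t.eq_empty_or_nonempty with rfl | ⟨x₀, hx₀⟩
  · simp
  have : Nonempty X := ⟨x₀⟩
  set g : Y → Z := fun y => b (Function.invFunOn a t y)
  have hinv : ∀ x ∈ t, Function.invFunOn a t (a x) ∈ t ∧ a (Function.invFunOn a t (a x)) = a x :=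
    fun x hx => Function.invFunOn_pos ⟨x, hx, rfl⟩
  have hg : ∀ x ∈ t, g (a x) = b x := by
    intro x hx
    obtain ⟨h1, h2⟩ := hinv x hx
    have := h _ h1 x hx
    rw [h2, dist_self, mul_zero] at this
    exact dist_le_zero.1 this
  have hlip : LipschitzOnWith K g (a '' t) := by
    refine LipschitzOnWith.of_dist_le_mul ?_
    rintro _ ⟨x, hx, rfl⟩ _ ⟨y, hy, rfl⟩
    rw [hg x hx, hg y hy]
    exact h x hx y hy
  have himg : b '' t = g '' (a '' t) := by
    rw [image_image]
    exact image_congr fun x hx => (hg x hx).symm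
  have := hlip.hausdorffMeasure_image_le (d := d) (by positivity)
  rw [himg]
  simp only [Measure.euclideanHausdorffMeasure_def, Measure.smul_apply, ENNReal.smul_def, smul_eq_mul]
  rw [mul_left_comm]
  gcongr
  simpa using this

variable {W V : Type*} [NormedAddCommGroup W] [InnerProductSpace ℝ W]
  [NormedAddCommGroup V] [InnerProductSpace ℝ V] {J : W →ₗᵢ[ℝ] V} {e : V}

/-- The parametrization `w ↦ J w + φ(w) e` of the graph of `φ : W → ℝ`, where `J` embeds `W`
isometrically in the orthogonal complement of the unit vector `e`. -/
def graphMap (J : W →ₗᵢ[ℝ] V) (e : V) (φ : W → ℝ) (w : W) : V := J w + φ w • e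

theorem norm_add_smul_sq (hJ : ∀ w, ⟪e, J w⟫ = 0) (he : ‖e‖ = 1) (w : W) (s : ℝ) :
    ‖J w + s • e‖ ^ 2 = ‖w‖ ^ 2 + s ^ 2 := by
  rw [norm_add_sq_real, inner_smul_right, real_inner_comm, hJ]
  simp [norm_smul, he]

theorem norm_le_norm_add_smul (hJ : ∀ w, ⟪e, J w⟫ = 0) (he : ‖e‖ = 1) (w : W) (s : ℝ) :
    ‖w‖ ≤ ‖J w + s • e‖ := by
  have := norm_add_smul_sq hJ he w s
  exact le_of_sq_le_sq (by nlinarith [sq_nonneg s]) (norm_nonneg _)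

theorem graphMap_sub (J : W →ₗᵢ[ℝ] V) (e : V) (φ : W → ℝ) (w w' : W) :
    graphMap J e φ w - graphMap J e φ w' = J (w - w') + (φ w - φ w') • e := by
  simp only [graphMap, map_sub, sub_smul]
  abel

theorem dist_le_dist_graphMap (hJ : ∀ w, ⟪e, J w⟫ = 0) (he : ‖e‖ = 1) (φ : W → ℝ) (w w' : W) :
    dist w w' ≤ dist (graphMap J e φ w) (graphMap J e φ w') := by
  rw [dist_eq_norm, dist_eq_norm, graphMap_sub]
  exact norm_le_norm_add_smul hJ he _ _

theorem graphMap_injective (hJ : ∀ w, ⟪e, J w⟫ = 0) (he : ‖e‖ = 1) (φ : W → ℝ) :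
    Function.Injective (graphMap J e φ) := by
  intro w w' h
  have := dist_le_dist_graphMap hJ he φ w w'
  rw [h, dist_self] at this
  exact dist_le_zero.1 this

theorem inner_add_smul_self (hJ : ∀ w, ⟪e, J w⟫ = 0) (he : ‖e‖ = 1) (w : W) (s : ℝ) :
    ⟪e, J w + s • e⟫ = s := by
  rw [inner_add_right, hJ, inner_smul_right, real_inner_self_eq_norm_sq, he]
  simp

theorem LipschitzWith.graphMap (he : ‖e‖ = 1) {K : ℝ≥0} {φ : W → ℝ}
    (hφ : LipschitzWith K φ) : LipschitzWith (1 + K) (graphMap J e φ) := by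
  refine LipschitzWith.of_dist_le_mul fun w w' => ?_
  rw [dist_eq_norm, graphMap_sub]
  refine (norm_add_le _ _).trans ?_
  have h2 := hφ.dist_le_mul w w'
  rw [Real.dist_eq] at h2
  rw [norm_smul, he, mul_one, Real.norm_eq_abs, J.norm_map, ← dist_eq_norm]
  push_cast
  linarith

/-- The linear graph map `v ↦ J v + ℓ(v) e`. -/
def linGraph (J : W →ₗᵢ[ℝ] V) (e : V) (ℓ : W →L[ℝ] ℝ) : W →ₗ[ℝ] V :=
  J.toLinearMap + (ℓ : W →ₗ[ℝ] ℝ).smulRight e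

theorem linGraph_apply (J : W →ₗᵢ[ℝ] V) (e : V) (ℓ : W →L[ℝ] ℝ) (v : W) :
    linGraph J e ℓ v = J v + ℓ v • e := rfl

theorem linGraph_eq_graphMap (J : W →ₗᵢ[ℝ] V) (e : V) (ℓ : W →L[ℝ] ℝ) :
    ⇑(linGraph J e ℓ) = graphMap J e ℓ := rfl

variable [FiniteDimensional ℝ V] [FiniteDimensional ℝ W]

/-- The Gram matrix of the image of an orthonormal basis is the identity plus a rank-one matrix,
whose determinant is 1 + |ℓ|². -/
theorem normDet_linGraph (hJ : ∀ w, ⟪e, J w⟫ = 0) (he : ‖e‖ = 1) (ℓ : W →L[ℝ] ℝ) :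
    (linGraph J e ℓ).normDet = √(1 + ‖ℓ‖ ^ 2) := by
  have h := (linGraph J e ℓ).normDet_sq_eq_det_gram (stdOrthonormalBasis ℝ W)
  set b := stdOrthonormalBasis ℝ W
  have hg : Matrix.gram ℝ (fun i => linGraph J e ℓ (b i)) =
      1 + Matrix.vecMulVec (fun i => ℓ (b i)) (fun i => ℓ (b i)) := by
    ext i j
    rw [Matrix.gram_apply, linGraph_apply, linGraph_apply, inner_add_left, inner_smul_left,
      inner_add_smul_self hJ he, inner_add_right, inner_smul_right, real_inner_comm e,
      hJ, J.inner_map_map, orthonormal_iff_ite.1 b.orthonormal i j, Matrix.add_apply,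
      Matrix.vecMulVec_apply, Matrix.one_apply]
    simp
  have hn : ∑ i, ℓ (b i) * ℓ (b i) = ‖ℓ‖ ^ 2 := by
    set a := (InnerProductSpace.toDual ℝ W).symm ℓ
    have ha : ∀ v, ℓ v = ⟪a, v⟫ := fun v => (InnerProductSpace.toDual_symm_apply).symm
    have : ‖ℓ‖ = ‖a‖ := by simp [a]
    rw [this, ← b.sum_sq_norm_inner_right a]
    refine Finset.sum_congr rfl fun i _ => ?_
    rw [ha, Real.norm_eq_abs, sq_abs, sq, real_inner_comm]
  rw [hg, Matrix.vecMulVec_eq (Fin 1), Matrix.det_one_add_replicateCol_mul_replicateRow] at h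
  have h' : (linGraph J e ℓ).normDet ^ 2 = 1 + ‖ℓ‖ ^ 2 := by
    rw [← hn]
    simpa [dotProduct] using h
  rw [← h', Real.sqrt_sq (LinearMap.normDet_nonneg _)]

/-- The area density `√(1 + |φ'|²)` of the graph of `φ`. -/
def areaDensity {W : Type*} [NormedAddCommGroup W] [NormedSpace ℝ W] (φ : W → ℝ) (w : W) : ℝ≥0 :=
  Real.toNNReal (√(1 + ‖fderiv ℝ φ w‖ ^ 2))

/-- Area densities whose gradients differ by at most c agree up to the factor 1 + c. A
multiplicative bound is needed, so that it integrates over sets of any measure. -/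
theorem sqrt_one_add_sq_le {a b c : ℝ} (ha : 0 ≤ a) (hb : 0 ≤ b) (hc : 0 ≤ c) (h : a ≤ b + c) :
    √(1 + a ^ 2) ≤ (1 + c) * √(1 + b ^ 2) := by
  have h1 : (1 : ℝ) ≤ √(1 + b ^ 2) := Real.one_le_sqrt.2 (by nlinarith)
  have hs := Real.sq_sqrt (show (0 : ℝ) ≤ 1 + b ^ 2 by positivity)
  have hb' : b ≤ √(1 + b ^ 2) := Real.le_sqrt_of_sq_le (by linarith)
  refine Real.sqrt_le_iff.2 ⟨by positivity, ?_⟩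
  nlinarith [mul_nonneg hc hb, mul_nonneg hc hc, mul_le_mul_of_nonneg_left hb' hc]

variable [MeasurableSpace V] [BorelSpace V] [MeasurableSpace W] [BorelSpace W]

theorem measurable_areaDensity (φ : W → ℝ) :
    Measurable (areaDensity φ) := by
  unfold areaDensity
  have := measurable_fderiv ℝ φ
  fun_prop

theorem one_le_areaDensity {W : Type*} [NormedAddCommGroup W] [NormedSpace ℝ W]
    (φ : W → ℝ) (w : W) : 1 ≤ areaDensity φ w := by
  rw [areaDensity, Real.one_le_toNNReal]
  exact Real.one_le_sqrt.2 (by nlinarith [sq_nonneg ‖fderiv ℝ φ w‖])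

theorem measure_le_of_countable_cover {α : Type*} [MeasurableSpace α] {μ ν : Measure α} {C : ℝ≥0∞}
    {s : Set α} (hs : MeasurableSet s) (p : ℕ → Set α) (hp : ∀ i, MeasurableSet (p i))
    (hsp : s ⊆ ⋃ i, p i)
    (h : ∀ i t, MeasurableSet t → t ⊆ p i → μ t ≤ C * ν t) : μ s ≤ C * ν s := by
  have hd := disjoint_disjointed p
  have hm : ∀ i, MeasurableSet (s ∩ disjointed p i) := fun i =>
    hs.inter (MeasurableSet.disjointed hp i)
  have hd' : Pairwise (Function.onFun Disjoint fun i => s ∩ disjointed p i) :=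
    fun i j hij => (hd hij).mono inter_subset_right inter_subset_right
  have hU : s = ⋃ i, s ∩ disjointed p i := by
    rw [← inter_iUnion, iUnion_disjointed]
    exact (inter_eq_left.2 hsp).symm
  rw [hU, measure_iUnion hd' hm, measure_iUnion hd' hm, ← ENNReal.tsum_mul_left]
  exact ENNReal.tsum_le_tsum fun i =>
    h i _ (hm i) (inter_subset_right.trans (disjointed_subset p i))

theorem measurableEmbedding_graphMap (hJ : ∀ w, ⟪e, J w⟫ = 0) (he : ‖e‖ = 1) {K : ℝ≥0} {φ : W → ℝ}
    (hφ : LipschitzWith K φ) : MeasurableEmbedding (graphMap J e φ) :=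
  (hφ.graphMap (J := J) he).continuous.measurableEmbedding (graphMap_injective hJ he φ)

/-- Both quantities are compared with the graph of ℓ, for which the area formula is linear algebra.
Increments of the two graph maps differ by a vertical vector of length at most c times the base
increment, so the identification of the graphs is (1 + c)-Lipschitz both ways. This gives the power
d; the additional factor comes from comparing the densities. -/
theorem graph_measure_estimate (hJ : ∀ w, ⟪e, J w⟫ = 0) (he : ‖e‖ = 1) {φ : W → ℝ}
    {ℓ : W →L[ℝ] ℝ} {c : ℝ≥0} {t : Set W} (ht : MeasurableSet t)
    (h1 : ApproximatesLinearOn φ ℓ t c) (h2 : ∀ x ∈ t, ‖fderiv ℝ φ x - ℓ‖ ≤ c) :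
    μHE[finrank ℝ W] (graphMap J e φ '' t) ≤
      ((1 + c : ℝ≥0) : ℝ≥0∞) ^ (finrank ℝ W + 1) * ∫⁻ w in t, areaDensity φ w ∧
    ∫⁻ w in t, areaDensity φ w ≤ ((1 + c : ℝ≥0) : ℝ≥0∞) ^ (finrank ℝ W + 1) *
      μHE[finrank ℝ W] (graphMap J e φ '' t) := by
  set d := finrank ℝ W
  have hlin : μHE[d] (graphMap J e ℓ '' t) = ENNReal.ofReal (√(1 + ‖ℓ‖ ^ 2)) * volume t := by
    rw [← linGraph_eq_graphMap, LinearMap.euclideanHausdorffMeasure_image_eq_normDet_mul_volume,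
      normDet_linGraph hJ he]
  have happ : ∀ x ∈ t, ∀ y ∈ t, |φ x - φ y - (ℓ x - ℓ y)| ≤ c * dist x y := by
    intro x hx y hy
    have := h1 x hx y hy
    rwa [map_sub, Real.norm_eq_abs, ← dist_eq_norm] at this
  have hdiff : ∀ x y, dist (graphMap J e φ x - graphMap J e φ y) (graphMap J e ℓ x - graphMap J e ℓ y) =
      |φ x - φ y - (ℓ x - ℓ y)| := by
    intro x y
    rw [dist_eq_norm, graphMap_sub, graphMap_sub, add_sub_add_left_eq_sub, ← sub_smul, norm_smul,
      he, mul_one, Real.norm_eq_abs]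
  have hle1 : μHE[d] (graphMap J e φ '' t) ≤ ((1 + c : ℝ≥0) : ℝ≥0∞) ^ d *
      μHE[d] (graphMap J e ℓ '' t) := by
    refine euclideanHausdorffMeasure_image_le_of_dist_le _ _ _ _ _ fun x hx y hy => ?_
    have a1 := happ x hx y hy
    have a2 := dist_le_dist_graphMap hJ he ℓ x y
    have a3 := hdiff x y
    have a4 := dist_triangle (graphMap J e φ x - graphMap J e φ y)
      (graphMap J e ℓ x - graphMap J e ℓ y) 0
    rw [dist_zero_right, dist_zero_right, ← dist_eq_norm, ← dist_eq_norm] at a4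
    push_cast
    nlinarith [c.2, mul_le_mul_of_nonneg_left a2 c.2]
  have hle2 : μHE[d] (graphMap J e ℓ '' t) ≤ ((1 + c : ℝ≥0) : ℝ≥0∞) ^ d *
      μHE[d] (graphMap J e φ '' t) := by
    refine euclideanHausdorffMeasure_image_le_of_dist_le _ _ _ _ _ fun x hx y hy => ?_
    have a1 := happ x hx y hy
    have a2 := dist_le_dist_graphMap hJ he φ x y
    have a3 := hdiff x y
    have a4 := dist_triangle (graphMap J e ℓ x - graphMap J e ℓ y)
      (graphMap J e φ x - graphMap J e φ y) 0
    rw [dist_zero_right, dist_zero_right, ← dist_eq_norm, ← dist_eq_norm, dist_comm (_ - _), a3] at a4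
    push_cast
    nlinarith [c.2, mul_le_mul_of_nonneg_left a2 c.2]
  have hint1 : ENNReal.ofReal (√(1 + ‖ℓ‖ ^ 2)) * volume t ≤
      ((1 + c : ℝ≥0) : ℝ≥0∞) * ∫⁻ w in t, areaDensity φ w := by
    rw [← lintegral_const_mul' _ _ ENNReal.coe_ne_top, ← setLIntegral_const]
    refine setLIntegral_mono' ht fun x hx => ?_
    have := sqrt_one_add_sq_le (norm_nonneg ℓ) (norm_nonneg (fderiv ℝ φ x)) c.coe_nonneg
      (by have := norm_sub_norm_le ℓ (fderiv ℝ φ x)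
          rw [norm_sub_rev] at this
          linarith [h2 x hx])
    rw [← ENNReal.coe_mul, areaDensity, ENNReal.ofReal, ENNReal.coe_le_coe]
    rw [← NNReal.coe_le_coe]
    simpa [Real.coe_toNNReal] using this
  have hint2 : ∫⁻ w in t, areaDensity φ w ≤
      ((1 + c : ℝ≥0) : ℝ≥0∞) * (ENNReal.ofReal (√(1 + ‖ℓ‖ ^ 2)) * volume t) := by
    rw [← mul_assoc, ← setLIntegral_const]
    refine setLIntegral_mono' ht fun x hx => ?_
    have := sqrt_one_add_sq_le (norm_nonneg (fderiv ℝ φ x)) (norm_nonneg ℓ) c.coe_nonneg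
      (by have := norm_sub_norm_le (fderiv ℝ φ x) ℓ
          linarith [h2 x hx])
    rw [ENNReal.ofReal, ← ENNReal.coe_mul, areaDensity, ENNReal.coe_le_coe]
    rw [← NNReal.coe_le_coe]
    simpa [Real.coe_toNNReal] using this
  rw [hlin] at hle1 hle2
  constructor
  · refine hle1.trans ?_
    rw [pow_succ _ d, mul_assoc]
    gcongr
  · refine hint2.trans ?_
    rw [pow_succ' _ d, mul_assoc]
    gcongr

/-- The set is first cut into pieces where the derivative stays within c/2 of one member of a dense
sequence. The linear approximations on each piece are derivatives at points of that piece, so they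
lie within c of the derivative throughout. -/
theorem exists_cover_approximatesLinearOn {φ : W → ℝ} {s : Set W}
    (hs : MeasurableSet s) (hd : ∀ w ∈ s, DifferentiableAt ℝ φ w) {c : ℝ≥0} (hc : 0 < c) :
    ∃ (p : ℕ → Set W) (ℓ : ℕ → W →L[ℝ] ℝ), (∀ i, MeasurableSet (p i)) ∧
      s ⊆ (⋃ i, p i) ∧ (∀ i, ApproximatesLinearOn φ (ℓ i) (p i) c) ∧
      ∀ i, ∀ x ∈ p i, ‖fderiv ℝ φ x - ℓ i‖ ≤ c := by
  set q := TopologicalSpace.denseSeq (W →L[ℝ] ℝ)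
  set B : ℕ → Set W := fun k => s ∩ {x | ‖fderiv ℝ φ x - q k‖ < c / 2}
  have hB : ∀ k, MeasurableSet (B k) := fun k => by
    refine hs.inter (measurableSet_lt ?_ measurable_const)
    exact ((measurable_fderiv ℝ φ).sub_const _).norm
  have hpart := fun k => exists_partition_approximatesLinearOn_of_hasFDerivWithinAt φ (B k)
    (fderiv ℝ φ) (fun x hx => (hd x hx.1).hasFDerivAt.hasFDerivWithinAt) (fun _ => c)
    (fun _ => hc.ne')
  choose t A _ htm hcov happ hA using hpart
  refine ⟨fun i => B i.unpair.1 ∩ t i.unpair.1 i.unpair.2, fun i => A i.unpair.1 i.unpair.2,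
    fun i => (hB _).inter (htm _ _), ?_, fun i => happ _ _, ?_⟩
  · intro x hx
    obtain ⟨k, hk⟩ := (TopologicalSpace.denseRange_denseSeq
      (W →L[ℝ] ℝ)).exists_mem_open (s := Metric.ball (fderiv ℝ φ x) (c / 2))
        Metric.isOpen_ball ⟨_, Metric.mem_ball_self (by positivity)⟩
    have hxB : x ∈ B k := ⟨hx, by
      rw [Metric.mem_ball, dist_comm, dist_eq_norm] at hk
      exact hk⟩
    obtain ⟨i, hi⟩ := mem_iUnion.1 (hcov k hxB)
    refine mem_iUnion.2 ⟨Nat.pair k i, ?_⟩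
    simp only [Nat.unpair_pair]
    exact ⟨hxB, hi⟩
  · rintro i x ⟨hx, -⟩
    obtain ⟨y, hy, hAy⟩ := hA i.unpair.1 ⟨x, hx⟩ i.unpair.2
    have h1 := hx.2
    have h2 := hy.2
    simp only [Set.mem_ofPred_eq] at h1 h2
    simp only [hAy]
    calc ‖fderiv ℝ φ x - fderiv ℝ φ y‖
        = ‖(fderiv ℝ φ x - q i.unpair.1) - (fderiv ℝ φ y - q i.unpair.1)‖ := by congr 1; abel
      _ ≤ _ := norm_sub_le _ _
      _ ≤ c := by linarith

/-- **Area formula** for the graph of a Lipschitz function. -/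
theorem comap_graphMap_euclideanHausdorffMeasure (hJ : ∀ w, ⟪e, J w⟫ = 0) (he : ‖e‖ = 1) {K : ℝ≥0}
    {φ : W → ℝ} (hφ : LipschitzWith K φ) :
    (μHE[finrank ℝ W] : Measure V).comap (graphMap J e φ) =
      volume.withDensity fun w => (areaDensity φ w : ℝ≥0∞) := by
  set d := finrank ℝ W
  have hemb := measurableEmbedding_graphMap hJ he hφ
  set μ := (μHE[d] : Measure V).comap (graphMap J e φ)
  set ν : Measure W := volume.withDensity fun w => (areaDensity φ w : ℝ≥0∞)
  have hμ : ∀ s, μ s = μHE[d] (graphMap J e φ '' s) := fun s => hemb.comap_apply _ _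
  have hν : ∀ s, MeasurableSet s → ν s = ∫⁻ w in s, areaDensity φ w := fun s hs =>
    withDensity_apply _ hs
  set D := {w | DifferentiableAt ℝ φ w}
  have hD : MeasurableSet D := measurableSet_of_differentiableAt ℝ φ
  -- Rademacher's theorem; the graph over the exceptional set is also null, because the graph map is
  -- Lipschitz.
  have hDnull : volume Dᶜ = 0 := hφ.ae_differentiableAt
  have hμD : μ Dᶜ = 0 := by
    rw [hμ]
    refine le_antisymm ?_ zero_le
    have := euclideanHausdorffMeasure_image_le_of_dist_le id (graphMap J e φ) Dᶜ (1 + K) d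
      (fun x _ y _ => (hφ.graphMap (J := J) he).dist_le_mul x y)
    rwa [image_id, InnerProductSpace.euclideanHausdorffMeasure_eq_volume, hDnull, mul_zero] at this
  have hνD : ν Dᶜ = 0 := withDensity_absolutelyContinuous _ _ hDnull
  -- Over the points of differentiability the two measures agree up to the factor (1 + c)^(d + 1)
  -- for every c > 0; letting c tend to 0 gives equality.
  have key : ∀ c : ℝ≥0, 0 < c → ∀ s, MeasurableSet s → s ⊆ D →
      μ s ≤ ((1 + c : ℝ≥0) : ℝ≥0∞) ^ (d + 1) * ν s ∧
      ν s ≤ ((1 + c : ℝ≥0) : ℝ≥0∞) ^ (d + 1) * μ s := by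
    intro c hc s hs hsD
    obtain ⟨p, ℓ, hp, hcov, happ, hder⟩ := exists_cover_approximatesLinearOn hs hsD hc
    constructor
    · refine measure_le_of_countable_cover hs p hp hcov fun i t ht hti => ?_
      rw [hμ, hν t ht]
      exact (graph_measure_estimate hJ he ht ((happ i).mono_set hti)
        fun x hx => hder i x (hti hx)).1
    · refine measure_le_of_countable_cover hs p hp hcov fun i t ht hti => ?_
      rw [hμ, hν t ht]
      exact (graph_measure_estimate hJ he ht ((happ i).mono_set hti)
        fun x hx => hder i x (hti hx)).2
  have lim : ∀ a b : ℝ≥0∞, (∀ c : ℝ≥0, 0 < c → a ≤ ((1 + c : ℝ≥0) : ℝ≥0∞) ^ (d + 1) * b) →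
      a ≤ b := by
    intro a b h
    have ht : Tendsto (fun c : ℝ≥0 => ((1 + c : ℝ≥0) : ℝ≥0∞) ^ (d + 1) * b) (𝓝[>] 0)
        (𝓝 (1 * b)) := by
      refine ENNReal.Tendsto.mul_const ?_ (Or.inl one_ne_zero)
      have : Continuous fun c : ℝ≥0 => (((1 + c) ^ (d + 1) : ℝ≥0) : ℝ≥0∞) := by fun_prop
      have := this.tendsto 0
      simp only [add_zero, one_pow, ENNReal.coe_one] at this
      simpa using this.mono_left nhdsWithin_le_nhds
    rw [one_mul] at ht
    exact ge_of_tendsto ht (eventually_mem_nhdsWithin.mono fun c hc => h c hc)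
  refine Measure.ext fun s hs => ?_
  rw [← measure_inter_add_sdiff s hD, ← measure_inter_add_sdiff (μ := ν) s hD,
    measure_mono_null (sdiff_subset_compl s D) hμD, measure_mono_null (sdiff_subset_compl s D) hνD,
    add_zero, add_zero]
  have hk := fun c hc => key c hc (s ∩ D) (hs.inter hD) inter_subset_right
  exact le_antisymm (lim _ _ fun c hc => (hk c hc).1) (lim _ _ fun c hc => (hk c hc).2)

end Graph

/-! ### Divergence theorem below a Lipschitz graph. -/

section Subgraph

open Module Filter
open scoped ENNReal NNReal

variable {W V : Type*} [NormedAddCommGroup W] [InnerProductSpace ℝ W]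
  [NormedAddCommGroup V] [InnerProductSpace ℝ V] {J : W →ₗᵢ[ℝ] V} {e : V}

theorem isClosedEmbedding_graphMap [FiniteDimensional ℝ W] (hJ : ∀ w, ⟪e, J w⟫ = 0)
    (he : ‖e‖ = 1) {K : ℝ≥0} {φ : W → ℝ} (hφ : LipschitzWith K φ) :
    IsClosedEmbedding (graphMap J e φ) := by
  have : CompleteSpace W := FiniteDimensional.complete ℝ W
  have : AntilipschitzWith 1 (graphMap J e φ) :=
    AntilipschitzWith.of_le_mul_dist fun x y => by
      simpa using dist_le_dist_graphMap hJ he φ x y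
  exact this.isClosedEmbedding (hφ.graphMap he).uniformContinuous

theorem LipschitzWith.add_const_real {φ : W → ℝ} {K : ℝ≥0} (hφ : LipschitzWith K φ) (s : ℝ) :
    LipschitzWith K fun w => φ w + s := by
  refine LipschitzWith.of_dist_le_mul fun x y => ?_
  simpa using hφ.dist_le_mul x y

variable [FiniteDimensional ℝ V] [FiniteDimensional ℝ W]
  [MeasurableSpace V] [BorelSpace V] [MeasurableSpace W] [BorelSpace W]

theorem measurable_fderiv_apply_real (φ : W → ℝ) (τ : W) :
    Measurable fun w => fderiv ℝ φ w τ := measurable_fderiv_apply_const ℝ φ τ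

/-- Along the graph, F is Lipschitz with compact support, so the integral of its derivative in
direction τ vanishes. By the chain rule this derivative is almost everywhere that of F along Jτ +
φ'(τ)e, which trades horizontal derivatives of F for the vertical one. -/
theorem integral_fderiv_graph_slice (hJ : ∀ w, ⟪e, J w⟫ = 0) (he : ‖e‖ = 1) {K : ℝ≥0}
    {φ : W → ℝ} (hφ : LipschitzWith K φ) {F : V → ℝ} (hF : ContDiff ℝ 1 F)
    (hFc : HasCompactSupport F) (τ : W) (a : ℝ) :
    ∫ w, fderiv ℝ F (graphMap J e φ w) (J τ + a • e) =
      ∫ w, (a - fderiv ℝ φ w τ) * fderiv ℝ F (graphMap J e φ w) e := by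
  have hcl := isClosedEmbedding_graphMap hJ he hφ
  obtain ⟨C, hC⟩ := hF.lipschitzWith_of_hasCompactSupport hFc one_ne_zero
  have hh : LipschitzWith (C * (1 + K)) (F ∘ graphMap J e φ) := hC.comp (hφ.graphMap he)
  have hhc : HasCompactSupport (F ∘ graphMap J e φ) := hFc.comp_isClosedEmbedding hcl
  have hint : ∀ v, Integrable fun w => fderiv ℝ F (graphMap J e φ w) v := by
    intro v
    have h1 : Continuous fun y => fderiv ℝ F y v :=
      (hF.continuous_fderiv one_ne_zero).clm_apply continuous_const
    have h2 : HasCompactSupport fun y => fderiv ℝ F y v := hFc.fderiv_apply ℝ v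
    exact (h1.comp hcl.continuous).integrable_of_hasCompactSupport
      (h2.comp_isClosedEmbedding hcl)
  have hint2 : Integrable fun w => (a - fderiv ℝ φ w τ) * fderiv ℝ F (graphMap J e φ w) e := by
    refine (hint e).bdd_mul (c := |a| + K * ‖τ‖)
      (measurable_const.sub (measurable_fderiv_apply_real φ τ)).aestronglyMeasurable
      (Eventually.of_forall fun w => ?_)
    refine (norm_sub_le _ _).trans (add_le_add le_rfl ?_)
    exact (ContinuousLinearMap.le_opNorm _ _).trans
      (mul_le_mul_of_nonneg_right (norm_fderiv_le_of_lipschitz ℝ hφ) (norm_nonneg _))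
  have hae : ∀ᵐ w, lineDeriv ℝ (F ∘ graphMap J e φ) w τ =
      fderiv ℝ F (graphMap J e φ w) (J τ + a • e) -
        (a - fderiv ℝ φ w τ) * fderiv ℝ F (graphMap J e φ w) e := by
    filter_upwards [hφ.ae_differentiableAt] with w hw
    have hG : HasFDerivAt (graphMap J e φ)
        (J.toContinuousLinearMap + (fderiv ℝ φ w).smulRight e) w :=
      J.toContinuousLinearMap.hasFDerivAt.add (hw.hasFDerivAt.smul_const e)
    have := ((hF.differentiable one_ne_zero _).hasFDerivAt.comp w hG).hasLineDerivAt τ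
    rw [this.lineDeriv]
    simp
    ring
  have h0 : ∫ w, lineDeriv ℝ (F ∘ graphMap J e φ) w τ = 0 := by
    -- Integration by parts against the constant 1; the direction is −τ because the formula reverses
    -- the direction for the other factor.
    have := (LipschitzWith.const (1 : ℝ)).integral_lineDeriv_mul_eq (μ := (volume : Measure W))
      hh hhc (-τ)
    simpa [lineDeriv] using this.symm
  rw [integral_congr_ae hae, integral_sub (hint _) hint2, sub_eq_zero] at h0
  exact h0

theorem measurePreserving_shear {φ : W → ℝ} (hφ : Measurable φ)
    (hMP : MeasurePreserving fun p : W × ℝ => J p.1 + p.2 • e) :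
    MeasurePreserving fun p : W × ℝ => J p.1 + (φ p.1 + p.2) • e := by
  have h : MeasurePreserving (fun p : W × ℝ => (p.1, φ p.1 + p.2)) := by
    refine (MeasurePreserving.id volume).skew_product (g := fun w s => φ w + s) ?_ ?_
    · exact (hφ.comp measurable_fst).add measurable_snd
    · exact Eventually.of_forall fun w => (measurePreserving_add_left volume (φ w)).map_eq
  exact hMP.comp h

/-- The divergence theorem in the region below the graph of a Lipschitz function, in the
parametrization of the graph. -/
theorem setIntegral_fderiv_subgraph (hJ : ∀ w, ⟪e, J w⟫ = 0) (he : ‖e‖ = 1) {K : ℝ≥0}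
    {φ : W → ℝ} (hφ : LipschitzWith K φ)
    (hMP : MeasurePreserving fun p : W × ℝ => J p.1 + p.2 • e)
    {H : Set V} (hH : ∀ w s, J w + s • e ∈ H ↔ s < φ w)
    {F : V → ℝ} (hF : ContDiff ℝ 1 F) (hFc : HasCompactSupport F) (τ : W) (a : ℝ) :
    ∫ y in H, fderiv ℝ F y (J τ + a • e) =
      ∫ w, (a - fderiv ℝ φ w τ) * F (graphMap J e φ w) := by
  set Θ : W × ℝ → V := fun p => J p.1 + (φ p.1 + p.2) • e
  have hΘ : MeasurePreserving Θ := measurePreserving_shear hφ.continuous.measurable hMP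
  have hΘc : Continuous Θ := by
    have := hφ.continuous
    have := J.continuous
    fun_prop
  have hΘi : Function.Injective Θ := by
    rintro ⟨w, s⟩ ⟨w', s'⟩ h
    have h1 := congrArg (fun y => ⟪e, y⟫) h
    simp only [Θ, inner_add_smul_self hJ he] at h1
    simp only [Θ, h1, add_left_inj] at h
    have h2 : w = w' := J.injective h
    subst h2
    simpa using h1
  have hΘe : MeasurableEmbedding Θ := hΘc.measurableEmbedding hΘi
  have hpre : Θ ⁻¹' H = univ ×ˢ Iio 0 := by
    ext ⟨w, s⟩
    simp [Θ, hH]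
  have hint : ∀ v, Integrable fun p => fderiv ℝ F (Θ p) v := by
    intro v
    have h1 : Continuous fun y => fderiv ℝ F y v :=
      (hF.continuous_fderiv one_ne_zero).clm_apply continuous_const
    have h2 : HasCompactSupport fun y => fderiv ℝ F y v := hFc.fderiv_apply ℝ v
    exact (hΘ.integrable_comp_emb hΘe).2 (h1.integrable_of_hasCompactSupport h2)
  have hrestr : (volume : Measure (W × ℝ)).restrict (univ ×ˢ Iio 0) =
      volume.prod (volume.restrict (Iio (0 : ℝ))) := by
    rw [Measure.volume_eq_prod, ← Measure.prod_restrict, Measure.restrict_univ]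
  have hint2 : Integrable (fun p : W × ℝ => (a - fderiv ℝ φ p.1 τ) * fderiv ℝ F (Θ p) e) := by
    refine (hint e).bdd_mul (c := |a| + K * ‖τ‖)
      (measurable_const.sub ((measurable_fderiv_apply_real φ τ).comp
        measurable_fst)).aestronglyMeasurable
      (Eventually.of_forall fun w => ?_)
    refine (norm_sub_le _ _).trans (add_le_add le_rfl ?_)
    exact (ContinuousLinearMap.le_opNorm _ _).trans
      (mul_le_mul_of_nonneg_right (norm_fderiv_le_of_lipschitz ℝ hφ) (norm_nonneg _))
  -- On each translate φ + s of the graph the derivative along Jτ + ae is replaced by a multiple of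
  -- the derivative along e whose weight does not depend on s. Integrating in s first then leaves
  -- the boundary value of F.
  have hslice : ∀ s, ∫ w, fderiv ℝ F (Θ (w, s)) (J τ + a • e) =
      ∫ w, (a - fderiv ℝ φ w τ) * fderiv ℝ F (Θ (w, s)) e := by
    intro s
    have := integral_fderiv_graph_slice hJ he (hφ.add_const_real s) hF hFc τ a
    simpa [graphMap, fderiv_add_const] using this
  have hline : ∀ w, ∫ s in Iio (0 : ℝ), fderiv ℝ F (Θ (w, s)) e = F (graphMap J e φ w) := by
    intro w
    have hiso : Isometry fun s : ℝ => Θ (w, s) := by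
      refine Isometry.of_dist_eq fun s s' => ?_
      simp [Θ, dist_eq_norm, ← sub_smul, norm_smul, he]
    have hc : HasCompactSupport fun s : ℝ => F (Θ (w, s)) :=
      hFc.comp_isClosedEmbedding hiso.isClosedEmbedding
    have hd : ContDiff ℝ 1 fun s : ℝ => F (Θ (w, s)) := by
      simp only [Θ]
      fun_prop
    have h := HasCompactSupport.integral_Iic_deriv_eq hd hc 0
    rw [integral_Iic_eq_integral_Iio] at h
    have hder : ∀ s, deriv (fun s : ℝ => F (Θ (w, s))) s = fderiv ℝ F (Θ (w, s)) e := by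
      intro s
      have h1 : HasDerivAt (fun s : ℝ => Θ (w, s)) e s := by
        have := (((hasDerivAt_id s).const_add (φ w)).smul_const e).const_add (J w)
        rwa [one_smul] at this
      exact ((hF.differentiable one_ne_zero _).hasFDerivAt.comp_hasDerivAt s h1).deriv
    simp only [hder] at h
    rw [h]
    simp [Θ, graphMap]
  rw [← hΘ.setIntegral_preimage_emb hΘe, hpre, hrestr, integral_prod_symm]
  · simp_rw [hslice]
    rw [← integral_prod_symm (f := fun p : W × ℝ => (a - fderiv ℝ φ p.1 τ) * fderiv ℝ F (Θ p) e),
      integral_prod]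
    · refine integral_congr_ae (Eventually.of_forall fun w => ?_)
      simp only [integral_const_mul, hline]
    · rw [← hrestr]; exact hint2.integrableOn
    · rw [← hrestr]; exact hint2.integrableOn
  · rw [← hrestr]; exact (hint _).integrableOn

end Subgraph

/-! ### Boundary charts, the normal and the surface measure of a Lipschitz set. -/

section Chart

open Module Filter
open scoped ENNReal NNReal

variable {n : ℕ}

/-- A chart of the boundary of `Ω` in the open set `U`: in the orthonormal coordinates
`(w, s) ↦ J w + s e`, the set `Ω ∩ U` lies strictly below the graph of `φ`. -/
structure GraphChart (Ω U : Set (Rn n)) (J : Rn (n - 1) →ₗᵢ[ℝ] Rn n) (e : Rn n) (K : ℝ≥0)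
    (φ : Rn (n - 1) → ℝ) : Prop where
  isOpen : IsOpen U
  norm_eq : ‖e‖ = 1
  inner_eq : ∀ w, ⟪e, J w⟫ = 0
  decomp : ∀ y, ∃ w, y = J w + ⟪e, y⟫ • e
  lipschitz : LipschitzWith K φ
  mem_iff : ∀ w s, J w + s • e ∈ U → (J w + s • e ∈ Ω ↔ s < φ w)

theorem IsLipschitzOpenSet.exists_graphChart {Ω : Set (Rn n)} (h : IsLipschitzOpenSet Ω)
    {x : Rn n} (hx : x ∈ frontier Ω) :
    ∃ (U : Set (Rn n)) (J : Rn (n - 1) →ₗᵢ[ℝ] Rn n) (e : Rn n) (K : ℝ≥0) (φ : Rn (n - 1) → ℝ),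
      x ∈ U ∧ GraphChart Ω U J e K φ := by
  obtain ⟨e, U, K, φ, he, hU, hxU, hφ, hmem⟩ := h.2 x hx
  have he0 : e ≠ 0 := by rintro rfl; simp at he
  -- A unit vector exists, so n ≥ 1 and the truncated n - 1 is the dimension of the hyperplane
  -- orthogonal to e.
  have hn : n ≠ 0 := by
    rintro rfl
    exact he0 (Subsingleton.elim _ _)
  have : Fact (finrank ℝ (Rn n) = n - 1 + 1) := ⟨by
    rw [finrank_euclideanSpace_fin]; omega⟩
  let ι := (OrthonormalBasis.fromOrthogonalSpanSingleton (𝕜 := ℝ) (n - 1) he0).repr.symm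
  refine ⟨U, (ℝ ∙ e)ᗮ.subtypeₗᵢ.comp ι.toLinearIsometry, e, K, φ ∘ ι, hxU, ⟨hU, he, ?_, ?_, ?_, ?_⟩⟩
  · intro w
    exact Submodule.mem_orthogonal_singleton_iff_inner_right.1 (ι w).2
  · intro y
    have h := (ℝ ∙ e).starProjection_add_starProjection_orthogonal y
    rw [Submodule.starProjection_unit_singleton ℝ he, Submodule.starProjection_apply] at h
    refine ⟨ι.symm ((ℝ ∙ e)ᗮ.orthogonalProjectionOnto y), ?_⟩
    conv_lhs => rw [← h, add_comm]
    simp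
  · have := hφ.comp ι.lipschitz
    rwa [mul_one] at this
  · intro w s hws
    rw [hmem _ hws]
    have h1 : ⟪e, (ℝ ∙ e)ᗮ.subtypeₗᵢ.comp ι.toLinearIsometry w + s • e⟫ = s := by
      refine inner_add_smul_self (fun w => ?_) he w s
      exact Submodule.mem_orthogonal_singleton_iff_inner_right.1 (ι w).2
    have h2 : (ℝ ∙ e)ᗮ.orthogonalProjectionOnto
        ((ℝ ∙ e)ᗮ.subtypeₗᵢ.comp ι.toLinearIsometry w + s • e) = ι w := by
      rw [map_add, map_smul]
      have : (ℝ ∙ e)ᗮ.orthogonalProjectionOnto e = 0 := by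
        rw [Submodule.orthogonalProjectionOnto_eq_zero_iff]
        exact Submodule.le_orthogonal_orthogonal _ (Submodule.mem_span_singleton_self e)
      simp [this]
    rw [h1, h2]
    rfl

theorem norm_outwardUnitNormal_le (Ω : Set (Rn n)) (x : Rn n) : ‖outwardUnitNormal Ω x‖ ≤ 1 := by
  by_cases h : ∃ v, IsOutwardUnitNormal Ω x v
  · obtain ⟨v, hv⟩ := h
    rw [hv.eq, hv.1]
  · rw [outwardUnitNormal, dif_neg h, norm_zero]
    exact zero_le_one

namespace GraphChart

variable {Ω U : Set (Rn n)} {J : Rn (n - 1) →ₗᵢ[ℝ] Rn n} {e : Rn n} {K : ℝ≥0}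
  {φ : Rn (n - 1) → ℝ}

theorem measurePreserving (h : GraphChart Ω U J e K φ) :
    MeasurePreserving fun p : Rn (n - 1) × ℝ => J p.1 + p.2 • e := by
  let T : WithLp 2 (Rn (n - 1) × ℝ) →ₗᵢ[ℝ] Rn n :=
    { toFun := fun p => J p.fst + p.snd • e
      map_add' := by intro p q; simp [add_smul]; abel
      map_smul' := by intro c p; simp [mul_smul]
      norm_map' := by
        intro p
        have h1 := norm_add_smul_sq h.inner_eq h.norm_eq p.fst p.snd
        have h2 := WithLp.prod_norm_sq_eq_of_L2 p
        rw [Real.norm_eq_abs, sq_abs, ← h1] at h2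
        exact (pow_left_inj₀ (norm_nonneg _) (norm_nonneg _) two_ne_zero).1 h2.symm }
  have hsurj : Function.Surjective T := by
    intro y
    obtain ⟨w, hw⟩ := h.decomp y
    exact ⟨WithLp.toLp 2 (w, ⟪e, y⟫), hw.symm⟩
  let T' : WithLp 2 (Rn (n - 1) × ℝ) ≃ₗᵢ[ℝ] Rn n := LinearIsometryEquiv.ofSurjective T hsurj
  exact T'.measurePreserving.comp (WithLp.volume_preserving_toLp (Rn (n - 1)) ℝ)

theorem exists_projection (h : GraphChart Ω U J e K φ) :
    ∃ P : Rn n →L[ℝ] Rn (n - 1), ∀ (w : Rn (n - 1)) (s : ℝ), P (J w + s • e) = w := by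
  refine ⟨ContinuousLinearMap.adjoint J.toContinuousLinearMap, fun w s => ?_⟩
  refine ext_inner_right ℝ fun u => ?_
  rw [ContinuousLinearMap.adjoint_inner_left]
  simp [inner_add_left, inner_smul_left, h.inner_eq]

/-- The part of U strictly above the graph is open and misses Ω. -/
theorem mem_closure_imp (h : GraphChart Ω U J e K φ) {w : Rn (n - 1)} {s : ℝ}
    (hU : J w + s • e ∈ U) (hc : J w + s • e ∈ closure Ω) : s ≤ φ w := by
  by_contra! hlt
  obtain ⟨P, hP⟩ := h.exists_projection
  have hopen : IsOpen (U ∩ {y | φ (P y) < ⟪e, y⟫}) := by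
    refine h.isOpen.inter (isOpen_lt (h.lipschitz.continuous.comp P.continuous) ?_)
    fun_prop
  obtain ⟨y, ⟨hyU, hy⟩, hyΩ⟩ := mem_closure_iff.1 hc _ hopen
    ⟨hU, by simpa [hP, inner_add_smul_self h.inner_eq h.norm_eq] using hlt⟩
  obtain ⟨w', hw'⟩ := h.decomp y
  rw [hw'] at hyU hyΩ
  have h1 := (h.mem_iff _ _ hyU).1 hyΩ
  simp only [Set.mem_ofPred_eq] at hy
  rw [hw', hP, inner_add_smul_self h.inner_eq h.norm_eq] at hy
  linarith

theorem mem_frontier_iff (h : GraphChart Ω U J e K φ) (hΩ : IsOpen Ω) {w : Rn (n - 1)} {s : ℝ}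
    (hU : J w + s • e ∈ U) : J w + s • e ∈ frontier Ω ↔ s = φ w := by
  rw [hΩ.frontier_eq, Set.mem_sdiff, h.mem_iff _ _ hU, not_lt]
  constructor
  · rintro ⟨h1, h2⟩
    exact le_antisymm (h.mem_closure_imp hU h1) h2
  · rintro rfl
    refine ⟨?_, le_rfl⟩
    rw [mem_closure_iff_frequently]
    have ht : Tendsto (fun t : ℝ => J w + (φ w - t) • e) (𝓝[>] 0) (𝓝 (J w + φ w • e)) := by
      have : Continuous fun t : ℝ => J w + (φ w - t) • e := by fun_prop
      have := this.tendsto 0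
      rw [sub_zero] at this
      exact this.mono_left nhdsWithin_le_nhds
    refine ht.frequently (Eventually.frequently ?_)
    filter_upwards [ht.eventually (h.isOpen.mem_nhds hU), self_mem_nhdsWithin] with t ht1 ht2
    rw [h.mem_iff _ _ ht1]
    simpa using ht2

theorem graphMap_mem_frontier (h : GraphChart Ω U J e K φ) (hΩ : IsOpen Ω) {w : Rn (n - 1)}
    (hU : graphMap J e φ w ∈ U) : graphMap J e φ w ∈ frontier Ω :=
  (h.mem_frontier_iff hΩ hU).2 rfl

theorem exists_eq_graphMap (h : GraphChart Ω U J e K φ) (hΩ : IsOpen Ω) {y : Rn n}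
    (hU : y ∈ U) (hy : y ∈ frontier Ω) : ∃ w, graphMap J e φ w = y := by
  obtain ⟨w, hw⟩ := h.decomp y
  rw [hw] at hU hy
  refine ⟨w, ?_⟩
  rw [graphMap, ← (h.mem_frontier_iff hΩ hU).1 hy, ← hw]

theorem frontier_inter (h : GraphChart Ω U J e K φ) (hΩ : IsOpen Ω) :
    frontier Ω ∩ U = range (graphMap J e φ) ∩ U := by
  ext y
  constructor
  · rintro ⟨h1, h2⟩
    exact ⟨h.exists_eq_graphMap hΩ h2 h1, h2⟩
  · rintro ⟨⟨w, rfl⟩, h2⟩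
    exact ⟨h.graphMap_mem_frontier hΩ h2, h2⟩

/-- The outward normal to the region below the graph of `φ`, not normalized. -/
def graphNormal (J : Rn (n - 1) →ₗᵢ[ℝ] Rn n) (e : Rn n) (φ : Rn (n - 1) → ℝ) (w : Rn (n - 1)) :
    Rn n := e - J ((InnerProductSpace.toDual ℝ (Rn (n - 1))).symm (fderiv ℝ φ w))

theorem inner_graphNormal (h : GraphChart Ω U J e K φ) (w τ : Rn (n - 1)) (a : ℝ) :
    ⟪graphNormal J e φ w, J τ + a • e⟫ = a - fderiv ℝ φ w τ := by
  rw [graphNormal, inner_sub_left, inner_add_smul_self h.inner_eq h.norm_eq, inner_add_right,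
    J.inner_map_map, inner_smul_right, real_inner_comm e, h.inner_eq,
    InnerProductSpace.toDual_symm_apply]
  ring

theorem norm_graphNormal (h : GraphChart Ω U J e K φ) (w : Rn (n - 1)) :
    ‖graphNormal J e φ w‖ = areaDensity φ w := by
  have h1 := norm_add_smul_sq h.inner_eq h.norm_eq
    (-(InnerProductSpace.toDual ℝ (Rn (n - 1))).symm (fderiv ℝ φ w)) 1
  rw [areaDensity, Real.coe_toNNReal _ (Real.sqrt_nonneg _)]
  refine (Real.sqrt_eq_iff_eq_sq (by positivity) (norm_nonneg _)).2 ?_ |>.symm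
  rw [norm_neg, LinearIsometryEquiv.norm_map, one_pow, map_neg, one_smul, neg_add_eq_sub] at h1
  rw [graphNormal, h1]
  ring

/-- In the chart, Ω is the condition s < φ(w'), and differentiability replaces φ(w') by its linear
part up to ε|y − x|. Normalizing divides by an area density of at least 1, which keeps the error
bound. -/
theorem isOutwardUnitNormal (h : GraphChart Ω U J e K φ) {w : Rn (n - 1)}
    (hw : DifferentiableAt ℝ φ w) (hU : graphMap J e φ w ∈ U) :
    IsOutwardUnitNormal Ω (graphMap J e φ w)
      ((areaDensity φ w : ℝ)⁻¹ • graphNormal J e φ w) := by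
  have hA : (1 : ℝ) ≤ areaDensity φ w := by exact_mod_cast one_le_areaDensity φ w
  have hA0 : (0 : ℝ) < areaDensity φ w := by linarith
  constructor
  · rw [norm_smul, h.norm_graphNormal, norm_inv, Real.norm_of_nonneg hA0.le,
      inv_mul_cancel₀ hA0.ne']
  · intro ε hε
    have h1 := (hasFDerivAt_iff_isLittleO.1 hw.hasFDerivAt).def hε
    obtain ⟨δ, hδ, hball⟩ := Metric.eventually_nhds_iff.1 h1
    filter_upwards [h.isOpen.mem_nhds hU, Metric.ball_mem_nhds _ hδ] with y hyU hyδ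
    obtain ⟨w', hw'⟩ := h.decomp y
    set s := ⟪e, y⟫
    have hsub : y - graphMap J e φ w = J (w' - w) + (s - φ w) • e := by
      rw [hw', graphMap, map_sub, sub_smul]; abel
    have hle : ‖w' - w‖ ≤ ‖y - graphMap J e φ w‖ := by
      rw [hsub]; exact norm_le_norm_add_smul h.inner_eq h.norm_eq _ _
    have h2 : ‖φ w' - φ w - fderiv ℝ φ w (w' - w)‖ ≤ ε * ‖w' - w‖ := by
      refine hball ?_
      rw [Metric.mem_ball, dist_eq_norm] at hyδ
      rw [dist_eq_norm]
      linarith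
    rw [Real.norm_eq_abs, abs_le] at h2
    have h3 : ⟪(areaDensity φ w : ℝ)⁻¹ • graphNormal J e φ w, y - graphMap J e φ w⟫ =
        (areaDensity φ w : ℝ)⁻¹ * (s - φ w - fderiv ℝ φ w (w' - w)) := by
      rw [hsub, inner_smul_left, h.inner_graphNormal]
      rfl
    have h4 : ε * ‖w' - w‖ ≤ ε * ‖y - graphMap J e φ w‖ := by gcongr
    have h5 : 0 ≤ ε * ‖y - graphMap J e φ w‖ := by positivity
    have hyU' := hyU
    rw [hw'] at hyU'
    have hmem := h.mem_iff _ _ hyU'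
    rw [← hw'] at hmem
    rw [h3, inv_mul_eq_div]
    constructor
    · intro hy
      have := hmem.1 hy
      rw [div_le_iff₀ hA0]
      nlinarith
    · intro hy
      have := not_lt.1 (fun hlt => hy (hmem.2 hlt))
      rw [le_div_iff₀ hA0]
      nlinarith

theorem comap_surfaceMeasure (h : GraphChart Ω U J e K φ) :
    (surfaceMeasure n).comap (graphMap J e φ) =
      volume.withDensity fun w => (areaDensity φ w : ℝ≥0∞) := by
  have := comap_graphMap_euclideanHausdorffMeasure h.inner_eq h.norm_eq h.lipschitz
  rwa [finrank_euclideanSpace_fin] at this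

theorem measurableEmbedding (h : GraphChart Ω U J e K φ) :
    MeasurableEmbedding (graphMap J e φ) :=
  measurableEmbedding_graphMap h.inner_eq h.norm_eq h.lipschitz

theorem restrict_range_surfaceMeasure (h : GraphChart Ω U J e K φ) :
    (surfaceMeasure n).restrict (range (graphMap J e φ)) =
      (volume.withDensity fun w => (areaDensity φ w : ℝ≥0∞)).map (graphMap J e φ) := by
  rw [← h.comap_surfaceMeasure, h.measurableEmbedding.map_comap]

theorem restrict_frontier_inter_surfaceMeasure (h : GraphChart Ω U J e K φ) (hΩ : IsOpen Ω) :
    (surfaceMeasure n).restrict (frontier Ω ∩ U) =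
      ((volume.withDensity fun w => (areaDensity φ w : ℝ≥0∞)).restrict
        (graphMap J e φ ⁻¹' U)).map (graphMap J e φ) := by
  rw [h.frontier_inter hΩ, inter_comm, ← Measure.restrict_restrict h.isOpen.measurableSet,
    h.restrict_range_surfaceMeasure,
    Measure.restrict_map h.measurableEmbedding.measurable h.isOpen.measurableSet]

theorem setIntegral_frontier (h : GraphChart Ω U J e K φ) (hΩ : IsOpen Ω) {f : Rn n → ℝ}
    (hf : ∀ y ∉ U, f y = 0) :
    ∫ y in frontier Ω, f y ∂surfaceMeasure n =
      ∫ w, (areaDensity φ w : ℝ) * f (graphMap J e φ w) := by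
  have h1 : ∫ y in frontier Ω, f y ∂surfaceMeasure n =
      ∫ y in range (graphMap J e φ), f y ∂surfaceMeasure n := by
    have hfm : MeasurableSet (frontier Ω) := isClosed_frontier.measurableSet
    rw [← integral_indicator hfm, ← integral_indicator h.measurableEmbedding.measurableSet_range]
    congr 1
    ext y
    by_cases hy : y ∈ U
    · have : y ∈ frontier Ω ↔ y ∈ range (graphMap J e φ) := by
        have := Set.ext_iff.1 (h.frontier_inter hΩ) y
        simpa [hy] using this
      by_cases h' : y ∈ frontier Ω
      · rw [indicator_of_mem h', indicator_of_mem (this.1 h')]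
      · rw [indicator_of_notMem h', indicator_of_notMem (fun hh => h' (this.2 hh))]
    · have := hf y hy
      simp [indicator, this]
  rw [h1, h.restrict_range_surfaceMeasure, h.measurableEmbedding.integral_map,
    integral_withDensity_eq_integral_smul (measurable_areaDensity φ)]
  rfl

theorem ae_isOutwardUnitNormal_graphMap (h : GraphChart Ω U J e K φ) :
    ∀ᵐ w, graphMap J e φ w ∈ U → IsOutwardUnitNormal Ω (graphMap J e φ w)
      ((areaDensity φ w : ℝ)⁻¹ • graphNormal J e φ w) := by
  filter_upwards [h.lipschitz.ae_differentiableAt] with w hw hU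
  exact h.isOutwardUnitNormal hw hU

theorem ae_isOutwardUnitNormal (h : GraphChart Ω U J e K φ) (hΩ : IsOpen Ω) :
    ∀ᵐ x ∂(surfaceMeasure n).restrict (frontier Ω ∩ U), ∃ v, IsOutwardUnitNormal Ω x v := by
  rw [h.restrict_frontier_inter_surfaceMeasure hΩ, h.measurableEmbedding.ae_map_iff,
    ae_restrict_iff' (h.measurableEmbedding.measurable h.isOpen.measurableSet)]
  refine (withDensity_absolutelyContinuous _ _).ae_le ?_
  filter_upwards [h.ae_isOutwardUnitNormal_graphMap] with w hw hU
  exact ⟨_, hw hU⟩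

/-- `outwardUnitNormal` is a pointwise choice, so its measurability is read off from the explicit
formula for the normal in the chart. -/
theorem aestronglyMeasurable_normal (h : GraphChart Ω U J e K φ) (hΩ : IsOpen Ω) :
    AEStronglyMeasurable (outwardUnitNormal Ω)
      ((surfaceMeasure n).restrict (frontier Ω ∩ U)) := by
  rw [h.restrict_frontier_inter_surfaceMeasure hΩ,
    h.measurableEmbedding.aestronglyMeasurable_map_iff]
  have hm : Measurable fun w => (areaDensity φ w : ℝ)⁻¹ • graphNormal J e φ w := by
    refine (measurable_areaDensity φ).coe_nnreal_real.inv.smul ?_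
    refine measurable_const.sub (J.continuous.measurable.comp ?_)
    exact (LinearIsometryEquiv.continuous _).measurable.comp (measurable_fderiv ℝ φ)
  refine ⟨_, hm.stronglyMeasurable, ?_⟩
  rw [Filter.EventuallyEq, ae_restrict_iff' (h.measurableEmbedding.measurable h.isOpen.measurableSet)]
  refine (withDensity_absolutelyContinuous _ _).ae_le ?_
  filter_upwards [h.ae_isOutwardUnitNormal_graphMap] with w hw hU
  exact (hw hU).eq

theorem surfaceMeasure_ball_lt_top (h : GraphChart Ω U J e K φ) (hΩ : IsOpen Ω) (x : Rn n)
    (hx : x ∈ U) (hxf : x ∈ frontier Ω) :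
    surfaceMeasure n (frontier Ω ∩ U ∩ Metric.ball x 1) < ∞ := by
  obtain ⟨w, rfl⟩ := h.exists_eq_graphMap hΩ hx hxf
  have hsub : frontier Ω ∩ U ∩ Metric.ball (graphMap J e φ w) 1 ⊆
      graphMap J e φ '' Metric.ball w 1 := by
    rintro y ⟨⟨h1, h2⟩, h3⟩
    obtain ⟨w', rfl⟩ := h.exists_eq_graphMap hΩ h2 h1
    exact ⟨w', (dist_le_dist_graphMap h.inner_eq h.norm_eq φ w' w).trans_lt h3, rfl⟩
  refine (measure_mono hsub).trans_lt ?_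
  have := euclideanHausdorffMeasure_image_le_of_dist_le id (graphMap J e φ) (Metric.ball w 1)
    (1 + K) (n - 1) (fun x _ y _ => (h.lipschitz.graphMap h.norm_eq).dist_le_mul x y)
  rw [image_id, EuclideanSpace.euclideanHausdorffMeasure_eq_volume] at this
  refine this.trans_lt (ENNReal.mul_lt_top ?_ measure_ball_lt_top)
  exact ENNReal.pow_lt_top ENNReal.coe_lt_top

/-- Over an open set of parameters the graph has at least the Lebesgue measure of its base. The
surface measure thus charges every relatively open part of ∂Ω, which later turns almost everywhere
conditions into pointwise ones. -/
theorem surfaceMeasure_pos (h : GraphChart Ω U J e K φ) (hΩ : IsOpen Ω) {x : Rn n}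
    (hx : x ∈ U) (hxf : x ∈ frontier Ω) {A : Set (Rn n)} (hA : IsOpen A) (hxA : x ∈ A) :
    0 < surfaceMeasure n (frontier Ω ∩ A) := by
  obtain ⟨w, rfl⟩ := h.exists_eq_graphMap hΩ hx hxf
  set B := graphMap J e φ ⁻¹' (A ∩ U)
  have hB : IsOpen B := (hA.inter h.isOpen).preimage (h.lipschitz.graphMap h.norm_eq).continuous
  have hsub : graphMap J e φ '' B ⊆ frontier Ω ∩ A := by
    rintro _ ⟨w', ⟨h1, h2⟩, rfl⟩
    exact ⟨h.graphMap_mem_frontier hΩ h2, h1⟩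
  refine lt_of_lt_of_le ?_ (measure_mono hsub)
  rw [← h.measurableEmbedding.comap_apply, h.comap_surfaceMeasure,
    withDensity_apply _ hB.measurableSet]
  have hpos : 0 < volume B := hB.measure_pos volume ⟨w, hxA, hx⟩
  refine hpos.trans_le ?_
  rw [← setLIntegral_one]
  exact setLIntegral_mono' hB.measurableSet fun w _ => by
    exact_mod_cast one_le_areaDensity φ w

end GraphChart

/-- Local form of the divergence theorem, for fields supported in `U`, together with a direction
`e` such that the parts of the closure of `Ω` in `U` can be pushed into `Ω` along `-e`. -/
structure LocalDivergence (Ω U : Set (Rn n)) (e : Rn n) : Prop where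
  isOpen : IsOpen U
  divergence : ∀ F : Rn n → ℝ, ContDiff ℝ 1 F → HasCompactSupport F → tsupport F ⊆ U → ∀ v,
    ∫ y in Ω, fderiv ℝ F y v =
      ∫ y in frontier Ω, F y * ⟪outwardUnitNormal Ω y, v⟫ ∂surfaceMeasure n
  shift : ∀ C : Set (Rn n), IsCompact C → C ⊆ U → ∃ δ : ℝ, 0 < δ ∧ ∀ t ∈ Ioo 0 δ,
    ∀ y ∈ closure Ω ∩ C, y - t • e ∈ Ω

theorem GraphChart.localDivergence {Ω U : Set (Rn n)} {J : Rn (n - 1) →ₗᵢ[ℝ] Rn n} {e : Rn n}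
    {K : ℝ≥0} {φ : Rn (n - 1) → ℝ} (h : GraphChart Ω U J e K φ) (hΩ : IsOpen Ω) :
    LocalDivergence Ω U e := by
  refine ⟨h.isOpen, ?_, ?_⟩
  · intro F hF hFc hFU v
    obtain ⟨P, hP⟩ := h.exists_projection
    -- The full region below the graph agrees with Ω inside U, and F vanishes outside U.
    set H : Set (Rn n) := {y | ⟪e, y⟫ < φ (P y)}
    have hHo : IsOpen H := by
      refine isOpen_lt ?_ (h.lipschitz.continuous.comp P.continuous)
      fun_prop
    have hH : ∀ w s, J w + s • e ∈ H ↔ s < φ w := by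
      intro w s
      simp only [H, Set.mem_ofPred_eq, hP, inner_add_smul_self h.inner_eq h.norm_eq]
    have h1 : ∫ y in Ω, fderiv ℝ F y v = ∫ y in H, fderiv ℝ F y v := by
      rw [← integral_indicator hΩ.measurableSet, ← integral_indicator hHo.measurableSet]
      congr 1
      ext y
      by_cases hy : y ∈ U
      · have : y ∈ Ω ↔ y ∈ H := by
          obtain ⟨w, hw⟩ := h.decomp y
          rw [hw] at hy ⊢
          rw [hH, h.mem_iff _ _ hy]
        by_cases h' : y ∈ Ω
        · rw [indicator_of_mem h', indicator_of_mem (this.1 h')]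
        · rw [indicator_of_notMem h', indicator_of_notMem (fun hh => h' (this.2 hh))]
      · have : fderiv ℝ F y = 0 := fderiv_of_notMem_tsupport ℝ fun hh => hy (hFU hh)
        simp [indicator, this]
    obtain ⟨τ, hτ⟩ := h.decomp v
    set a := ⟪e, v⟫
    rw [h1, hτ, setIntegral_fderiv_subgraph h.inner_eq h.norm_eq h.lipschitz h.measurePreserving hH
      hF hFc, h.setIntegral_frontier hΩ]
    · refine integral_congr_ae ?_
      filter_upwards [h.ae_isOutwardUnitNormal_graphMap] with w hw
      by_cases hU : graphMap J e φ w ∈ U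
      · rw [(hw hU).eq, inner_smul_left, h.inner_graphNormal]
        have hA : (1 : ℝ) ≤ areaDensity φ w := by exact_mod_cast one_le_areaDensity φ w
        simp only [conj_trivial]
        field_simp
      · rw [image_eq_zero_of_notMem_tsupport fun hh => hU (hFU hh)]
        ring
    · intro y hy
      rw [image_eq_zero_of_notMem_tsupport fun hh => hy (hFU hh), zero_mul]
  · intro C hC hCU
    obtain ⟨δ, hδ, hsub⟩ := hC.exists_thickening_subset_open h.isOpen hCU
    refine ⟨δ, hδ, ?_⟩
    rintro t ⟨ht0, htδ⟩ y ⟨hy, hyC⟩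
    have hyt : y - t • e ∈ U := by
      refine hsub (Metric.mem_thickening_iff.2 ⟨y, hyC, ?_⟩)
      rw [dist_eq_norm, sub_sub_cancel_left, norm_neg, norm_smul, h.norm_eq, mul_one,
        Real.norm_of_nonneg ht0.le]
      exact htδ
    obtain ⟨w, hw⟩ := h.decomp y
    set s := ⟪e, y⟫
    have hyU := hCU hyC
    rw [hw] at hyU hy
    have := h.mem_closure_imp hyU hy
    have heq : y - t • e = J w + (s - t) • e := by rw [hw, sub_smul]; abel
    rw [heq] at hyt ⊢
    rw [h.mem_iff _ _ hyt]
    linarith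

/-- The interior patch: both sides vanish for fields supported in Ω, and no push is needed, so the
direction is 0. -/
theorem localDivergence_self {Ω : Set (Rn n)} (hΩ : IsOpen Ω) : LocalDivergence Ω Ω 0 := by
  refine ⟨hΩ, ?_, ?_⟩
  · intro F hF hFc hFU v
    have h1 : ∫ y in Ω, fderiv ℝ F y v = ∫ y, fderiv ℝ F y v := by
      refine setIntegral_eq_integral_of_forall_compl_eq_zero fun y hy => ?_
      rw [fderiv_of_notMem_tsupport ℝ fun hh => hy (hFU hh)]
      rfl
    obtain ⟨C, hC⟩ := hF.lipschitzWith_of_hasCompactSupport hFc one_ne_zero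
    have h2 : ∫ y, fderiv ℝ F y v = 0 := by
      have := (LipschitzWith.const (1 : ℝ)).integral_lineDeriv_mul_eq
        (μ := (volume : Measure (Rn n))) hC hFc (-v)
      have h3 : ∫ y, lineDeriv ℝ F y v = 0 := by simpa [lineDeriv] using this.symm
      rw [← h3]
      refine integral_congr_ae (Eventually.of_forall fun y => ?_)
      exact ((hF.differentiable one_ne_zero y).lineDeriv_eq_fderiv).symm
    rw [h1, h2]
    symm
    refine setIntegral_eq_zero_of_forall_eq_zero fun y hy => ?_
    rw [hΩ.frontier_eq] at hy
    rw [image_eq_zero_of_notMem_tsupport fun hh => hy.2 (hFU hh), zero_mul]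
  · intro C _ hCU
    refine ⟨1, one_pos, fun t _ y hy => ?_⟩
    simpa using hCU hy.2

section Lipschitz

variable {Ω : Set (Rn n)}

theorem IsLipschitzOpenSet.exists_localDivergence (hLip : IsLipschitzOpenSet Ω) {x : Rn n}
    (hx : x ∈ closure Ω) : ∃ U e, x ∈ U ∧ LocalDivergence Ω U e := by
  by_cases hxΩ : x ∈ Ω
  · exact ⟨Ω, 0, hxΩ, localDivergence_self hLip.1⟩
  · obtain ⟨U, J, e, K, φ, hxU, h⟩ := hLip.exists_graphChart (x := x)
      (by rw [hLip.1.frontier_eq]; exact ⟨hx, hxΩ⟩)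
    exact ⟨U, e, hxU, h.localDivergence hLip.1⟩

theorem isCompact_frontier_of_isBounded (hbdd : Bornology.IsBounded Ω) :
    IsCompact (frontier Ω) :=
  Metric.isCompact_of_isClosed_isBounded isClosed_frontier
    (hbdd.closure.subset frontier_subset_closure)

theorem IsLipschitzOpenSet.surfaceMeasure_frontier_lt_top (hLip : IsLipschitzOpenSet Ω)
    (hbdd : Bornology.IsBounded Ω) : surfaceMeasure n (frontier Ω) < ∞ := by
  refine (isCompact_frontier_of_isBounded hbdd).measure_lt_top_of_nhdsWithin fun x hx => ?_
  obtain ⟨U, J, e, K, φ, hxU, h⟩ := hLip.exists_graphChart hx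
  refine ⟨_, ?_, h.surfaceMeasure_ball_lt_top hLip.1 x hxU hx⟩
  rw [inter_assoc]
  exact inter_mem self_mem_nhdsWithin (mem_nhdsWithin_of_mem_nhds
    (inter_mem (h.isOpen.mem_nhds hxU) (Metric.ball_mem_nhds x one_pos)))

theorem IsLipschitzOpenSet.integrableOn_normal (hLip : IsLipschitzOpenSet Ω)
    (hbdd : Bornology.IsBounded Ω) :
    IntegrableOn (outwardUnitNormal Ω) (frontier Ω) (surfaceMeasure n) := by
  refine LocallyIntegrableOn.integrableOn_isCompact (fun x hx => ?_)
    (isCompact_frontier_of_isBounded hbdd)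
  obtain ⟨U, J, e, K, φ, hxU, h⟩ := hLip.exists_graphChart hx
  refine ⟨frontier Ω ∩ U, inter_mem self_mem_nhdsWithin
    (mem_nhdsWithin_of_mem_nhds (h.isOpen.mem_nhds hxU)), ?_⟩
  have : IsFiniteMeasure ((surfaceMeasure n).restrict (frontier Ω ∩ U)) := ⟨by
    rw [Measure.restrict_apply_univ]
    exact (measure_mono inter_subset_left).trans_lt (hLip.surfaceMeasure_frontier_lt_top hbdd)⟩
  exact Integrable.of_bound (h.aestronglyMeasurable_normal hLip.1) 1
    (Eventually.of_forall fun y => norm_outwardUnitNormal_le Ω y)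

theorem IsLipschitzOpenSet.ae_isOutwardUnitNormal (hLip : IsLipschitzOpenSet Ω)
    (hbdd : Bornology.IsBounded Ω) :
    ∀ᵐ x ∂(surfaceMeasure n).restrict (frontier Ω), ∃ v, IsOutwardUnitNormal Ω x v := by
  rw [ae_iff]
  set B := {x | ¬ ∃ v, IsOutwardUnitNormal Ω x v}
  rw [Measure.restrict_apply_eq_zero' isClosed_frontier.measurableSet]
  suffices ∀ x ∈ frontier Ω, ∃ u ∈ 𝓝[frontier Ω] x, surfaceMeasure n (B ∩ u) = 0 by
    refine (isCompact_frontier_of_isBounded hbdd).induction_on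
      (p := fun s => surfaceMeasure n (B ∩ s) = 0) (by simp)
      (fun s t hst ht => measure_mono_null (inter_subset_inter_right _ hst) ht)
      (fun s t hs ht => by rw [inter_union_distrib_left]; exact measure_union_null hs ht) ?_
    intro x hx
    obtain ⟨u, hu, h⟩ := this x hx
    exact ⟨u, hu, h⟩
  intro x hx
  obtain ⟨U, J, e, K, φ, hxU, h⟩ := hLip.exists_graphChart hx
  refine ⟨frontier Ω ∩ U, inter_mem self_mem_nhdsWithin
    (mem_nhdsWithin_of_mem_nhds (h.isOpen.mem_nhds hxU)), ?_⟩
  have := h.ae_isOutwardUnitNormal hLip.1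
  rwa [ae_iff, Measure.restrict_apply_eq_zero'
    (isClosed_frontier.measurableSet.inter h.isOpen.measurableSet)] at this

theorem IsLipschitzOpenSet.surfaceMeasure_pos (hLip : IsLipschitzOpenSet Ω) {x : Rn n}
    (hx : x ∈ frontier Ω) {A : Set (Rn n)} (hA : IsOpen A) (hxA : x ∈ A) :
    0 < surfaceMeasure n (frontier Ω ∩ A) := by
  obtain ⟨U, J, e, K, φ, hxU, h⟩ := hLip.exists_graphChart hx
  exact h.surfaceMeasure_pos hLip.1 hxU hx hA hxA

end Lipschitz

end Chart

/-! ### Integrals of null Lagrangians as boundary integrals. -/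

section NullLagrangian

open Module Filter
open scoped ENNReal NNReal ContDiff Manifold

variable {n : ℕ}

/-- A compactly supported `C¹` function has smooth approximations whose derivatives converge
uniformly. -/
theorem exists_contDiff_norm_fderiv_sub_le {g : Rn n → ℝ} (hg : ContDiff ℝ 1 g)
    (hgc : HasCompactSupport g) {ε : ℝ} (hε : 0 < ε) :
    ∃ h : Rn n → ℝ, ContDiff ℝ ∞ h ∧ ∀ x, ‖fderiv ℝ h x - fderiv ℝ g x‖ ≤ ε := by
  have huc : UniformContinuous (fderiv ℝ g) :=
    (hgc.fderiv ℝ).uniformContinuous_of_continuous (hg.continuous_fderiv one_ne_zero)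
  obtain ⟨δ, hδ, hδ'⟩ := Metric.uniformContinuous_iff.1 huc ε hε
  set φ : ContDiffBump (0 : Rn n) := ⟨δ / 2, δ, half_pos hδ, half_lt_self hδ⟩
  have hloc : LocallyIntegrable (φ.normed volume) volume :=
    φ.continuous_normed.locallyIntegrable
  refine ⟨convolution (φ.normed volume) g (ContinuousLinearMap.lsmul ℝ ℝ) volume,
    φ.hasCompactSupport_normed.contDiff_convolution_left _ φ.contDiff_normed
      hg.continuous.locallyIntegrable, fun x => ?_⟩
  have hd := hgc.hasFDerivAt_convolution_right (ContinuousLinearMap.lsmul ℝ ℝ) hloc hg x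
  rw [hd.fderiv, ← dist_eq_norm]
  have he : (ContinuousLinearMap.lsmul ℝ ℝ : ℝ →L[ℝ] ℝ →L[ℝ] ℝ).precompR (Rn n) =
      ContinuousLinearMap.lsmul ℝ ℝ := by
    ext; rfl
  rw [he]
  exact φ.dist_normed_convolution_le (hg.continuous_fderiv one_ne_zero).aestronglyMeasurable
    fun y hy => (hδ' (Metric.mem_ball.1 hy)).le

/-- By symmetry of second derivatives, ∂ᵤf ∂ᵥg − ∂ᵥf ∂ᵤg = ∂ᵤ(f ∂ᵥg) − ∂ᵥ(f ∂ᵤg). The smoothness of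
g serves only to write this divergence. -/
theorem LocalDivergence.null_lagrangian_of_contDiff {Ω U : Set (Rn n)} {e : Rn n}
    (hU : LocalDivergence Ω U e) (hcf : IsCompact (frontier Ω))
    (hν : IntegrableOn (outwardUnitNormal Ω) (frontier Ω) (surfaceMeasure n))
    {f g : Rn n → ℝ} (hf : ContDiff ℝ 1 f)
    (hfc : HasCompactSupport f) (hfU : tsupport f ⊆ U) (hg : ContDiff ℝ ∞ g) (u v : Rn n) :
    ∫ y in Ω, (fderiv ℝ f y u * fderiv ℝ g y v - fderiv ℝ f y v * fderiv ℝ g y u) =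
      ∫ y in frontier Ω, f y * (⟪outwardUnitNormal Ω y, u⟫ * fderiv ℝ g y v -
        ⟪outwardUnitNormal Ω y, v⟫ * fderiv ℝ g y u) ∂surfaceMeasure n := by
  have hg2 : ContDiff ℝ 1 (fderiv ℝ g) := hg.fderiv_right (by norm_cast)
  set F : Rn n → Rn n → ℝ := fun w y => f y * fderiv ℝ g y w
  have hFd : ∀ w, ContDiff ℝ 1 (F w) := fun w => hf.mul (hg2.clm_apply contDiff_const)
  have hFc : ∀ w, HasCompactSupport (F w) := fun w => hfc.mul_right
  have hFU : ∀ w, tsupport (F w) ⊆ U := fun w => (tsupport_mul_subset_left).trans hfU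
  have hFder : ∀ w z y, fderiv ℝ (F w) y z =
      fderiv ℝ f y z * fderiv ℝ g y w + f y * fderiv ℝ (fderiv ℝ g) y z w := by
    intro w z y
    have h1 : HasFDerivAt (fun y => fderiv ℝ g y w)
        ((fderiv ℝ (fderiv ℝ g) y).flip w) y := by
      have := (hg2.differentiable one_ne_zero y).hasFDerivAt.clm_apply (hasFDerivAt_const w y)
      simpa using this
    have h2 := (hf.differentiable one_ne_zero y).hasFDerivAt.fun_mul h1
    rw [show fderiv ℝ (F w) y = _ from h2.fderiv]
    simp
    ring
  have hsymm : ∀ y, fderiv ℝ (fderiv ℝ g) y u v = fderiv ℝ (fderiv ℝ g) y v u := fun y =>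
    second_derivative_symmetric (fun z => (hg.differentiable (by simp) z).hasFDerivAt)
      (hg2.differentiable one_ne_zero y).hasFDerivAt u v
  have hint : ∀ w z, IntegrableOn (fun y => fderiv ℝ (F w) y z) Ω := by
    intro w z
    refine Integrable.integrableOn ?_
    exact (((hFd w).continuous_fderiv one_ne_zero).clm_apply
      continuous_const).integrable_of_hasCompactSupport ((hFc w).fderiv_apply ℝ z)
  have hint2 : ∀ w z, IntegrableOn (fun y => F w y * ⟪outwardUnitNormal Ω y, z⟫) (frontier Ω)
      (surfaceMeasure n) := fun w z =>
    IntegrableOn.continuousOn_mul (hFd w).continuous.continuousOn (hν.inner_const z) hcf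
  have h1 := hU.divergence _ (hFd v) (hFc v) (hFU v) u
  have h2 := hU.divergence _ (hFd u) (hFc u) (hFU u) v
  have h3 := congrArg₂ (· - ·) h1 h2
  beta_reduce at h3
  rw [← integral_sub (hint _ _) (hint _ _), ← integral_sub (hint2 _ _) (hint2 _ _)] at h3
  refine (integral_congr_ae (.of_forall fun y => ?_)).trans
    (h3.trans (integral_congr_ae (.of_forall fun y => ?_)))
  · beta_reduce
    rw [hFder, hFder, hsymm]
    ring
  · simp only [F]
    ring

/-- Here a, α and β stand for f, f' and g'. As no second derivative occurs, bounded pointwise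
convergence on the closure suffices. It serves both the mollification of g and the translation into
Ω. -/
theorem null_lagrangian_limit {Ω : Set (Rn n)} (hΩ : IsOpen Ω) (hb : Bornology.IsBounded Ω)
    (hν : IntegrableOn (outwardUnitNormal Ω) (frontier Ω) (surfaceMeasure n)) (u v : Rn n)
    {a : ℕ → Rn n → ℝ} {α β : ℕ → Rn n → Rn n →L[ℝ] ℝ} {a₀ : Rn n → ℝ}
    {α₀ β₀ : Rn n → Rn n →L[ℝ] ℝ} {C : ℝ} (ha : ∀ m, Continuous (a m))
    (hα : ∀ m, Continuous (α m)) (hβ : ∀ m, Continuous (β m))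
    (haC : ∀ m, ∀ x ∈ closure Ω, |a m x| ≤ C) (hαC : ∀ m, ∀ x ∈ closure Ω, ‖α m x‖ ≤ C)
    (hβC : ∀ m, ∀ x ∈ closure Ω, ‖β m x‖ ≤ C)
    (ha₀ : ∀ x ∈ closure Ω, Tendsto (fun m => a m x) atTop (𝓝 (a₀ x)))
    (hα₀ : ∀ x ∈ closure Ω, Tendsto (fun m => α m x) atTop (𝓝 (α₀ x)))
    (hβ₀ : ∀ x ∈ closure Ω, Tendsto (fun m => β m x) atTop (𝓝 (β₀ x)))
    (h : ∀ m, ∫ y in Ω, (α m y u * β m y v - α m y v * β m y u) =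
      ∫ y in frontier Ω, a m y * (⟪outwardUnitNormal Ω y, u⟫ * β m y v -
        ⟪outwardUnitNormal Ω y, v⟫ * β m y u) ∂surfaceMeasure n) :
    ∫ y in Ω, (α₀ y u * β₀ y v - α₀ y v * β₀ y u) =
      ∫ y in frontier Ω, a₀ y * (⟪outwardUnitNormal Ω y, u⟫ * β₀ y v -
        ⟪outwardUnitNormal Ω y, v⟫ * β₀ y u) ∂surfaceMeasure n := by
  have happ : ∀ (ℓ : Rn n →L[ℝ] ℝ) z, ‖ℓ‖ ≤ C → |ℓ z| ≤ C * ‖z‖ := fun ℓ z hℓ =>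
    (ℓ.le_opNorm z).trans (mul_le_mul_of_nonneg_right hℓ (norm_nonneg _))
  have htapp : ∀ {γ : ℕ → Rn n →L[ℝ] ℝ} {γ₀ : Rn n →L[ℝ] ℝ} (z : Rn n),
      Tendsto γ atTop (𝓝 γ₀) → Tendsto (fun m => γ m z) atTop (𝓝 (γ₀ z)) := fun z hγ =>
    ((ContinuousLinearMap.apply ℝ ℝ z).continuous.tendsto _).comp hγ
  have hνi : ∀ z, IntegrableOn (fun y => ⟪outwardUnitNormal Ω y, z⟫) (frontier Ω)
      (surfaceMeasure n) := fun z => Integrable.inner_const (𝕜 := ℝ) hν z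
  have hcΩ : IsCompact (closure Ω) :=
    Metric.isCompact_of_isClosed_isBounded isClosed_closure hb.closure
  have hL : Tendsto (fun m => ∫ y in Ω, (α m y u * β m y v - α m y v * β m y u)) atTop
      (𝓝 (∫ y in Ω, (α₀ y u * β₀ y v - α₀ y v * β₀ y u))) := by
    refine tendsto_integral_of_dominated_convergence
      (fun _ => (C * ‖u‖) * (C * ‖v‖) + (C * ‖v‖) * (C * ‖u‖)) ?_ ?_ ?_ ?_
    · intro m
      have h1 := hα m
      have h2 := hβ m
      exact (by fun_prop : Continuous fun y => α m y u * β m y v - α m y v * β m y u).aestronglyMeasurable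
    · refine integrableOn_const ?_
      exact ((measure_mono subset_closure).trans_lt hcΩ.measure_lt_top).ne
    · intro m
      filter_upwards [ae_restrict_mem hΩ.measurableSet] with y hy
      have hy' := subset_closure hy
      refine (norm_sub_le _ _).trans (add_le_add ?_ ?_)
      · rw [norm_mul]
        exact mul_le_mul (happ _ _ (hαC m y hy')) (happ _ _ (hβC m y hy')) (norm_nonneg _)
          ((abs_nonneg _).trans (happ _ _ (hαC m y hy')))
      · rw [norm_mul]
        exact mul_le_mul (happ _ _ (hαC m y hy')) (happ _ _ (hβC m y hy')) (norm_nonneg _)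
          ((abs_nonneg _).trans (happ _ _ (hαC m y hy')))
    · filter_upwards [ae_restrict_mem hΩ.measurableSet] with y hy
      have hy' := subset_closure hy
      exact ((htapp u (hα₀ y hy')).mul (htapp v (hβ₀ y hy'))).sub
        ((htapp v (hα₀ y hy')).mul (htapp u (hβ₀ y hy')))
  have hR : Tendsto (fun m => ∫ y in frontier Ω, a m y * (⟪outwardUnitNormal Ω y, u⟫ * β m y v -
        ⟪outwardUnitNormal Ω y, v⟫ * β m y u) ∂surfaceMeasure n) atTop
      (𝓝 (∫ y in frontier Ω, a₀ y * (⟪outwardUnitNormal Ω y, u⟫ * β₀ y v -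
        ⟪outwardUnitNormal Ω y, v⟫ * β₀ y u) ∂surfaceMeasure n)) := by
    refine tendsto_integral_of_dominated_convergence
      (fun y => C * (‖⟪outwardUnitNormal Ω y, u⟫‖ * (C * ‖v‖) +
        ‖⟪outwardUnitNormal Ω y, v⟫‖ * (C * ‖u‖))) ?_ ?_ ?_ ?_
    · intro m
      have h1 := (hνi u).aestronglyMeasurable
      have h2 := (hνi v).aestronglyMeasurable
      have h3 : ∀ z, AEStronglyMeasurable (fun y => β m y z)
          ((surfaceMeasure n).restrict (frontier Ω)) := fun z =>
        ((hβ m).clm_apply continuous_const).aestronglyMeasurable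
      exact (ha m).aestronglyMeasurable.mul ((h1.mul (h3 v)).sub (h2.mul (h3 u)))
    · exact (((hνi u).norm.mul_const _).add
        ((hνi v).norm.mul_const _)).const_mul _
    · intro m
      filter_upwards [ae_restrict_mem isClosed_frontier.measurableSet] with y hy
      have hy' := frontier_subset_closure hy
      have hC : 0 ≤ C := (abs_nonneg _).trans (haC m y hy')
      rw [norm_mul]
      refine mul_le_mul (haC m y hy') ((norm_sub_le _ _).trans (add_le_add ?_ ?_))
        (norm_nonneg _) hC
      · rw [norm_mul]
        exact mul_le_mul_of_nonneg_left (happ _ _ (hβC m y hy')) (norm_nonneg _)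
      · rw [norm_mul]
        exact mul_le_mul_of_nonneg_left (happ _ _ (hβC m y hy')) (norm_nonneg _)
    · filter_upwards [ae_restrict_mem isClosed_frontier.measurableSet] with y hy
      have hy' := frontier_subset_closure hy
      exact (ha₀ y hy').mul ((tendsto_const_nhds.mul (htapp v (hβ₀ y hy'))).sub
        (tendsto_const_nhds.mul (htapp u (hβ₀ y hy'))))
  simp only [h] at hL
  exact tendsto_nhds_unique hL hR

theorem LocalDivergence.null_lagrangian_of_contDiff_one {Ω U : Set (Rn n)} {e : Rn n}
    (hU : LocalDivergence Ω U e) (hΩ : IsOpen Ω) (hb : Bornology.IsBounded Ω)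
    (hν : IntegrableOn (outwardUnitNormal Ω) (frontier Ω) (surfaceMeasure n))
    {f g : Rn n → ℝ} (hf : ContDiff ℝ 1 f)
    (hfc : HasCompactSupport f) (hfU : tsupport f ⊆ U) (hg : ContDiff ℝ 1 g)
    (hgc : HasCompactSupport g) (u v : Rn n) :
    ∫ y in Ω, (fderiv ℝ f y u * fderiv ℝ g y v - fderiv ℝ f y v * fderiv ℝ g y u) =
      ∫ y in frontier Ω, f y * (⟪outwardUnitNormal Ω y, u⟫ * fderiv ℝ g y v -
        ⟪outwardUnitNormal Ω y, v⟫ * fderiv ℝ g y u) ∂surfaceMeasure n := by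
  have hcf := isCompact_frontier_of_isBounded hb
  choose h hh hhg using fun m : ℕ =>
    exists_contDiff_norm_fderiv_sub_le hg hgc (Nat.one_div_pos_of_nat (α := ℝ) (n := m))
  obtain ⟨C₁, hC₁⟩ := hfc.exists_bound_of_continuous hf.continuous
  obtain ⟨C₂, hC₂⟩ := (hfc.fderiv ℝ).exists_bound_of_continuous (hf.continuous_fderiv one_ne_zero)
  obtain ⟨C₃, hC₃⟩ := (hgc.fderiv ℝ).exists_bound_of_continuous (hg.continuous_fderiv one_ne_zero)
  refine null_lagrangian_limit hΩ hb hν u v (a := fun _ => f) (α := fun _ => fderiv ℝ f)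
    (β := fun m => fderiv ℝ (h m)) (C := max C₁ (max C₂ (C₃ + 1))) (fun _ => hf.continuous)
    (fun _ => hf.continuous_fderiv one_ne_zero)
    (fun m => (hh m).continuous_fderiv (by simp))
    (fun _ x _ => (hC₁ x).trans (le_max_left _ _))
    (fun _ x _ => (hC₂ x).trans ((le_max_left _ _).trans (le_max_right _ _)))
    (fun m x _ => ?_) (fun _ _ => tendsto_const_nhds) (fun _ _ => tendsto_const_nhds)
    (fun x _ => ?_) (fun m => hU.null_lagrangian_of_contDiff hcf hν hf hfc hfU (hh m) u v)
  · refine le_trans ?_ ((le_max_right _ _).trans (le_max_right _ _))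
    have h1 := norm_le_norm_add_norm_sub (fderiv ℝ g x) (fderiv ℝ (h m) x)
    have h2 : (1 : ℝ) / (m + 1) ≤ 1 := by
      rw [div_le_one (by positivity)]; linarith [(Nat.cast_nonneg m : (0 : ℝ) ≤ m)]
    rw [norm_sub_rev] at h1
    linarith [hhg m x, hC₃ x]
  · rw [tendsto_iff_norm_sub_tendsto_zero]
    exact squeeze_zero (fun _ => norm_nonneg _) (fun m => hhg m x)
      tendsto_one_div_add_atTop_nhds_zero_nat

/-- `f` is continuous with derivative `f'` in `Ω`, where `f'` is continuous up to the boundary. -/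
structure HasContDerivOn (Ω : Set (Rn n)) (f : Rn n → ℝ) (f' : Rn n → Rn n →L[ℝ] ℝ) : Prop where
  cont : Continuous f
  cont_deriv : Continuous f'
  hasFDerivAt : ∀ x ∈ Ω, HasFDerivAt f (f' x) x

theorem exists_smooth_cutoff {A B : Set (Rn n)} (hA : IsCompact A) (hB : IsOpen B) (hAB : A ⊆ B) :
    ∃ θ : Rn n → ℝ, ContDiff ℝ ∞ θ ∧ HasCompactSupport θ ∧ tsupport θ ⊆ B ∧
      ∀ x ∈ A, θ =ᶠ[𝓝 x] 1 := by
  obtain ⟨K, hK, hAK, hKB⟩ := exists_compact_between hA hB hAB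
  obtain ⟨θ, h1, h2, -⟩ := exists_contMDiffMap_one_nhds_of_subset_interior (n := (⊤ : ℕ∞)) 𝓘(ℝ, Rn n)
    hA.isClosed hAK
  have hsub : tsupport θ ⊆ K := by
    refine closure_minimal (fun x hx => ?_) hK.isClosed
    by_contra hxK
    exact hx (h2 x hxK)
  refine ⟨θ, θ.contMDiff.contDiff, hK.of_isClosed_subset isClosed_closure hsub,
    hsub.trans hKB, fun x hx => ?_⟩
  exact (eventually_nhdsSet_iff_forall.1 h1) x hx

theorem HasContDerivOn.contDiff_cutoff_shift {Ω : Set (Rn n)} (hΩ : IsOpen Ω) {f : Rn n → ℝ}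
    {f' : Rn n → Rn n →L[ℝ] ℝ} (hf : HasContDerivOn Ω f f') {θ : Rn n → ℝ} (hθ : ContDiff ℝ ∞ θ)
    {w : Rn n} (hθs : tsupport θ ⊆ {x | x - w ∈ Ω}) :
    ContDiff ℝ 1 fun x => θ x * f (x - w) := by
  rw [contDiff_iff_contDiffAt]
  intro x
  by_cases hx : x ∈ tsupport θ
  · refine (hθ.of_le (by norm_cast)).contDiffAt.mul ?_
    have : ContDiffAt ℝ 1 f (x - w) := by
      rw [contDiffAt_one_iff]
      exact ⟨f', Ω, hΩ.mem_nhds (hθs hx), hf.cont_deriv.continuousOn, hf.hasFDerivAt⟩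
    exact this.comp x (contDiffAt_id.sub contDiffAt_const)
  · have : (fun x => θ x * f (x - w)) =ᶠ[𝓝 x] fun _ => 0 := by
      filter_upwards [notMem_tsupport_iff_eventuallyEq.1 hx] with y hy
      rw [hy]
      simp
    exact contDiffAt_const.congr_of_eventuallyEq this

theorem HasContDerivOn.hasFDerivAt_cutoff_shift {Ω : Set (Rn n)} {f : Rn n → ℝ}
    {f' : Rn n → Rn n →L[ℝ] ℝ} (hf : HasContDerivOn Ω f f') {θ : Rn n → ℝ}
    {w x : Rn n} (hx : x - w ∈ Ω) (hθ1 : θ =ᶠ[𝓝 x] 1) :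
    HasFDerivAt (fun x => θ x * f (x - w)) (f' (x - w)) x := by
  have h1 : HasFDerivAt (fun x => f (x - w)) (f' (x - w)) x := by
    have := (hf.hasFDerivAt _ hx).comp x ((hasFDerivAt_id x).sub_const w)
    rwa [ContinuousLinearMap.comp_id] at this
  refine h1.congr_of_eventuallyEq ?_
  filter_upwards [hθ1] with y hy
  rw [hy]
  simp

theorem exists_bound_shift {F : Type*} [NormedAddCommGroup F] {f : Rn n → F} (hf : Continuous f)
    {S : Set (Rn n)} (hS : IsCompact S) (e : Rn n) :
    ∃ C, ∀ t ∈ Icc (0 : ℝ) 1, ∀ x ∈ S, ‖f (x - t • e)‖ ≤ C := by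
  have hc : Continuous fun p : ℝ × Rn n => f (p.2 - p.1 • e) := by fun_prop
  obtain ⟨C, hC⟩ := ((isCompact_Icc (a := (0 : ℝ)) (b := 1)).prod hS).exists_bound_of_continuousOn
    hc.continuousOn
  exact ⟨C, fun t ht x hx => hC (t, x) ⟨ht, hx⟩⟩

/-- f and g need not be differentiable across ∂Ω. Replacing them by their translates y ↦ f(y − te),
y ↦ g(y − te) makes them C¹ near the part of the closure met by the support of χ; then t tends to 0.
-/
theorem LocalDivergence.null_lagrangian_cutoff {Ω U : Set (Rn n)} {e : Rn n}
    (hU : LocalDivergence Ω U e) (hΩ : IsOpen Ω) (hb : Bornology.IsBounded Ω)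
    (hν : IntegrableOn (outwardUnitNormal Ω) (frontier Ω) (surfaceMeasure n))
    {f g χ : Rn n → ℝ} {f' g' : Rn n → Rn n →L[ℝ] ℝ} (hf : HasContDerivOn Ω f f')
    (hg : HasContDerivOn Ω g g') (hχ : ContDiff ℝ ∞ χ) (hχc : HasCompactSupport χ)
    (hχU : tsupport χ ⊆ U) (u v : Rn n) :
    ∫ y in Ω, ((χ y • f' y + f y • fderiv ℝ χ y) u * g' y v -
        (χ y • f' y + f y • fderiv ℝ χ y) v * g' y u) =
      ∫ y in frontier Ω, χ y * f y * (⟪outwardUnitNormal Ω y, u⟫ * g' y v -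
        ⟪outwardUnitNormal Ω y, v⟫ * g' y u) ∂surfaceMeasure n := by
  obtain ⟨δ, hδ, hshift⟩ := hU.shift _ hχc hχU
  have hcΩ : IsCompact (closure Ω) :=
    Metric.isCompact_of_isClosed_isBounded isClosed_closure hb.closure
  have hcf := isCompact_frontier_of_isBounded hb
  have hχ' : Continuous (fderiv ℝ χ) := hχ.continuous_fderiv (by simp)
  -- the identity for the shifted functions
  have key : ∀ t ∈ Ioo 0 δ,
      ∫ y in Ω, ((χ y • f' (y - t • e) + f (y - t • e) • fderiv ℝ χ y) u * g' (y - t • e) v -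
        (χ y • f' (y - t • e) + f (y - t • e) • fderiv ℝ χ y) v * g' (y - t • e) u) =
      ∫ y in frontier Ω, χ y * f (y - t • e) * (⟪outwardUnitNormal Ω y, u⟫ * g' (y - t • e) v -
        ⟪outwardUnitNormal Ω y, v⟫ * g' (y - t • e) u) ∂surfaceMeasure n := by
    intro t ht
    have hopen : IsOpen {x | x - t • e ∈ Ω} := hΩ.preimage (by fun_prop)
    -- θ makes the translates globally C¹ with compact support and changes nothing where χ is
    -- nonzero, being 1 near closure Ω ∩ tsupport χ.
    obtain ⟨θ, hθ, hθc, hθs, hθ1⟩ := exists_smooth_cutoff (hcΩ.inter hχc) hopen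
      (fun y hy => hshift t ht y hy)
    have hft := hf.contDiff_cutoff_shift hΩ hθ hθs
    have hgt := hg.contDiff_cutoff_shift hΩ hθ hθs
    have hid := hU.null_lagrangian_of_contDiff_one hΩ hb hν
      ((hχ.of_le (by norm_cast) : ContDiff ℝ 1 χ).mul hft) hχc.mul_right
      ((tsupport_mul_subset_left).trans hχU) hgt hθc.mul_right u v
    have hchi : ∀ y ∉ tsupport χ, χ y = 0 ∧ fderiv ℝ χ y = 0 := fun y hy =>
      ⟨image_eq_zero_of_notMem_tsupport hy, fderiv_of_notMem_tsupport ℝ hy⟩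
    have hder : ∀ y ∈ closure Ω, y ∈ tsupport χ →
        fderiv ℝ (fun x => χ x * (θ x * f (x - t • e))) y =
          χ y • f' (y - t • e) + f (y - t • e) • fderiv ℝ χ y := by
      intro y hy hyχ
      have hθy := hθ1 y ⟨hy, hyχ⟩
      have h1 := hf.hasFDerivAt_cutoff_shift (hshift t ht y ⟨hy, hyχ⟩) hθy
      have h2 := (hχ.differentiable (by simp) y).hasFDerivAt.fun_mul h1
      rw [h2.fderiv, hθy.self_of_nhds, Pi.one_apply, one_mul]
    have hder0 : ∀ y ∉ tsupport χ, fderiv ℝ (fun x => χ x * (θ x * f (x - t • e))) y = 0 := by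
      intro y hy
      exact fderiv_of_notMem_tsupport ℝ fun h => hy (tsupport_mul_subset_left h)
    have hderg : ∀ y ∈ closure Ω, y ∈ tsupport χ →
        fderiv ℝ (fun x => θ x * g (x - t • e)) y = g' (y - t • e) := fun y hy hyχ =>
      (hg.hasFDerivAt_cutoff_shift (hshift t ht y ⟨hy, hyχ⟩) (hθ1 y ⟨hy, hyχ⟩)).fderiv
    refine (setIntegral_congr_fun hΩ.measurableSet fun y hy => ?_).trans
      (hid.trans (setIntegral_congr_fun isClosed_frontier.measurableSet fun y hy => ?_))
    · have hy' := subset_closure hy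
      beta_reduce
      by_cases hyχ : y ∈ tsupport χ
      · rw [hder y hy' hyχ, hderg y hy' hyχ]
      · rw [hder0 y hyχ, (hchi y hyχ).1, (hchi y hyχ).2]
        simp
    · have hy' := frontier_subset_closure hy
      beta_reduce
      by_cases hyχ : y ∈ tsupport χ
      · rw [hderg y hy' hyχ, (hθ1 y ⟨hy', hyχ⟩).self_of_nhds, Pi.one_apply, one_mul]
      · rw [(hchi y hyχ).1]
        simp
  -- A sequence of shifts tending to 0 that stays below δ, where the shifted identity holds, and
  -- below 1, where the uniform bounds hold.
  set τ : ℕ → ℝ := fun m => min 1 (δ / 2) * (1 / (m + 1))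
  have hτ0 : Tendsto τ atTop (𝓝 0) := by
    have := tendsto_one_div_add_atTop_nhds_zero_nat (𝕜 := ℝ) |>.const_mul (min 1 (δ / 2))
    rwa [mul_zero] at this
  have hmin : 0 < min 1 (δ / 2) := lt_min one_pos (half_pos hδ)
  have hτle : ∀ m, τ m ≤ min 1 (δ / 2) := fun m => by
    refine mul_le_of_le_one_right hmin.le ?_
    rw [div_le_one (by positivity)]; linarith [(Nat.cast_nonneg m : (0 : ℝ) ≤ m)]
  have hτpos : ∀ m, 0 < τ m := fun m => mul_pos hmin (by positivity)
  have hτ1 : ∀ m, τ m ∈ Icc (0 : ℝ) 1 := fun m =>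
    ⟨(hτpos m).le, (hτle m).trans (min_le_left _ _)⟩
  have hτδ : ∀ m, τ m ∈ Ioo 0 δ := fun m =>
    ⟨hτpos m, ((hτle m).trans (min_le_right _ _)).trans_lt (half_lt_self hδ)⟩
  have htend : ∀ {F : Type} [NormedAddCommGroup F] {q : Rn n → F}, Continuous q → ∀ x,
      Tendsto (fun m => q (x - τ m • e)) atTop (𝓝 (q x)) := by
    intro F _ q hq x
    have h1 : Tendsto (fun m => x - τ m • e) atTop (𝓝 (x - (0 : ℝ) • e)) :=
      tendsto_const_nhds.sub (hτ0.smul_const e)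
    rw [zero_smul, sub_zero] at h1
    exact (hq.tendsto x).comp h1
  obtain ⟨B₁, hB₁⟩ := exists_bound_shift hf.cont hcΩ e
  obtain ⟨B₂, hB₂⟩ := exists_bound_shift hf.cont_deriv hcΩ e
  obtain ⟨B₃, hB₃⟩ := exists_bound_shift hg.cont_deriv hcΩ e
  obtain ⟨B₄, hB₄⟩ := hχc.exists_bound_of_continuous hχ.continuous
  obtain ⟨B₅, hB₅⟩ := (hχc.fderiv ℝ).exists_bound_of_continuous hχ'
  have hnn₄ : 0 ≤ B₄ := (norm_nonneg _).trans (hB₄ 0)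
  have hfc := hf.cont
  have hfc' := hf.cont_deriv
  have hgc' := hg.cont_deriv
  have hχc' := hχ.continuous
  refine null_lagrangian_limit hΩ hb hν u v
    (a := fun m y => χ y * f (y - τ m • e))
    (α := fun m y => χ y • f' (y - τ m • e) + f (y - τ m • e) • fderiv ℝ χ y)
    (β := fun m y => g' (y - τ m • e))
    (C := max (B₄ * B₁) (max (B₄ * B₂ + B₁ * B₅) B₃))
    (fun m => by fun_prop) (fun m => by fun_prop) (fun m => by fun_prop) ?_ ?_ ?_ ?_ ?_ ?_
    (fun m => key _ (hτδ m))
  · intro m x hx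
    refine le_trans ?_ (le_max_left _ _)
    rw [abs_mul]
    exact mul_le_mul (hB₄ x) (hB₁ _ (hτ1 m) x hx) (abs_nonneg _) hnn₄
  · intro m x hx
    refine le_trans ?_ ((le_max_left _ _).trans (le_max_right _ _))
    refine (norm_add_le _ _).trans (add_le_add ?_ ?_)
    · rw [norm_smul]
      exact mul_le_mul (hB₄ x) (hB₂ _ (hτ1 m) x hx) (norm_nonneg _) hnn₄
    · rw [norm_smul]
      exact mul_le_mul (hB₁ _ (hτ1 m) x hx) (hB₅ x) (norm_nonneg _)
        ((norm_nonneg _).trans (hB₁ _ (hτ1 m) x hx))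
  · intro m x hx
    exact (hB₃ _ (hτ1 m) x hx).trans ((le_max_right _ _).trans (le_max_right _ _))
  · intro x _
    exact tendsto_const_nhds.mul (htend hfc x)
  · intro x _
    exact (tendsto_const_nhds.smul (htend hfc' x)).add ((htend hfc x).smul tendsto_const_nhds)
  · intro x _
    exact htend hgc' x

theorem IsLipschitzOpenSet.exists_partition {Ω : Set (Rn n)} (hLip : IsLipschitzOpenSet Ω)
    (hb : Bornology.IsBounded Ω) :
    ∃ (ι : Type) (_ : Fintype ι) (χ : ι → Rn n → ℝ) (U : ι → Set (Rn n)) (e : ι → Rn n),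
      (∀ i, LocalDivergence Ω (U i) (e i) ∧ ContDiff ℝ ∞ (χ i) ∧ HasCompactSupport (χ i) ∧
        tsupport (χ i) ⊆ U i) ∧ ∀ x ∈ closure Ω, ∑ i, χ i x = 1 := by
  have hcΩ : IsCompact (closure Ω) :=
    Metric.isCompact_of_isClosed_isBounded isClosed_closure hb.closure
  choose! U e hxU hU using fun x (hx : x ∈ closure Ω) => hLip.exists_localDivergence hx
  obtain ⟨t, htΩ, ht⟩ := hcΩ.elim_nhds_subcover U fun x hx => (hU x hx).isOpen.mem_nhds (hxU x hx)
  -- Intersecting the cover with a ball gives the partition functions compact support.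
  obtain ⟨R, hR⟩ := hb.closure.subset_ball (0 : Rn n)
  obtain ⟨χ, hχ⟩ := SmoothPartitionOfUnity.exists_isSubordinate 𝓘(ℝ, Rn n)
    isClosed_closure (fun i : Fin t.card => U (t.equivFin.symm i) ∩ Metric.ball 0 R)
    (fun i => (hU _ (htΩ _ (t.equivFin.symm i).2)).isOpen.inter Metric.isOpen_ball) (by
      intro x hx
      obtain ⟨i, hi, hxi⟩ := mem_iUnion₂.1 (ht hx)
      refine mem_iUnion.2 ⟨t.equivFin ⟨i, hi⟩, ?_, hR hx⟩
      simpa using hxi)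
  refine ⟨Fin t.card, inferInstance, fun i => χ i, fun i => U (t.equivFin.symm i),
    fun i => e (t.equivFin.symm i), fun i => ⟨hU _ (htΩ _ (t.equivFin.symm i).2),
      (χ i).contMDiff.contDiff, ?_, (hχ i).trans inter_subset_left⟩, fun x hx => ?_⟩
  · exact (isCompact_closedBall (0 : Rn n) R).of_isClosed_subset isClosed_closure
      ((hχ i).trans (inter_subset_right.trans Metric.ball_subset_closedBall))
  · rw [← finsum_eq_sum_of_fintype]
    exact χ.sum_eq_one hx

theorem IsLipschitzOpenSet.null_lagrangian {Ω : Set (Rn n)} (hLip : IsLipschitzOpenSet Ω)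
    (hb : Bornology.IsBounded Ω) {f g : Rn n → ℝ} {f' g' : Rn n → Rn n →L[ℝ] ℝ}
    (hf : HasContDerivOn Ω f f') (hg : HasContDerivOn Ω g g') (u v : Rn n) :
    ∫ y in Ω, (f' y u * g' y v - f' y v * g' y u) =
      ∫ y in frontier Ω, f y * (⟪outwardUnitNormal Ω y, u⟫ * g' y v -
        ⟪outwardUnitNormal Ω y, v⟫ * g' y u) ∂surfaceMeasure n := by
  have hν := hLip.integrableOn_normal hb
  have hνi : ∀ z, IntegrableOn (fun y => ⟪outwardUnitNormal Ω y, z⟫) (frontier Ω)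
      (surfaceMeasure n) := fun z => Integrable.inner_const (𝕜 := ℝ) hν z
  have hcΩ : IsCompact (closure Ω) :=
    Metric.isCompact_of_isClosed_isBounded isClosed_closure hb.closure
  have hcf := isCompact_frontier_of_isBounded hb
  obtain ⟨ι, _, χ, U, e, hχ, hsum⟩ := hLip.exists_partition hb
  have hfc := hf.cont
  have hfc' := hf.cont_deriv
  have hgc' := hg.cont_deriv
  have hχc : ∀ i, Continuous (χ i) := fun i => (hχ i).2.1.continuous
  have hχc' : ∀ i, Continuous (fderiv ℝ (χ i)) := fun i => (hχ i).2.1.continuous_fderiv (by simp)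
  have hid := Finset.sum_congr rfl fun i (_ : i ∈ Finset.univ) =>
    (hχ i).1.null_lagrangian_cutoff hLip.1 hb hν hf hg (hχ i).2.1 (hχ i).2.2.1 (hχ i).2.2.2 u v
  rw [← integral_finsetSum, ← integral_finsetSum] at hid
  · refine (setIntegral_congr_fun hLip.1.measurableSet fun y hy => ?_).trans
      (hid.trans (setIntegral_congr_fun isClosed_frontier.measurableSet fun y hy => ?_))
    -- The partition sums to 1 on Ω, so the terms carrying derivatives of the cutoffs cancel after
    -- summation.
    · have h0 : ∑ i, fderiv ℝ (χ i) y = 0 := by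
        rw [← fderiv_fun_sum fun i _ => (hχ i).2.1.differentiable (by simp) y]
        have : (fun y => ∑ i, χ i y) =ᶠ[𝓝 y] fun _ => 1 := by
          filter_upwards [hLip.1.mem_nhds hy] with z hz
          exact hsum z (subset_closure hz)
        rw [this.fderiv_eq, fderiv_const_apply]
      have h1 : ∑ i, (χ i y • f' y + f y • fderiv ℝ (χ i) y) = f' y := by
        rw [Finset.sum_add_distrib, ← Finset.sum_smul, ← Finset.smul_sum, h0,
          hsum y (subset_closure hy), one_smul, smul_zero, add_zero]
      beta_reduce
      rw [Finset.sum_sub_distrib, ← Finset.sum_mul, ← Finset.sum_mul,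
        ← ContinuousLinearMap.sum_apply, ← ContinuousLinearMap.sum_apply, h1]
    · beta_reduce
      rw [← Finset.sum_mul, ← Finset.sum_mul, hsum y (frontier_subset_closure hy), one_mul]
  · intro i _
    have h1 := hχc i
    have h2 : ContinuousOn (fun y => χ i y * f y * g' y v) (frontier Ω) := by fun_prop
    have h3 : ContinuousOn (fun y => χ i y * f y * g' y u) (frontier Ω) := by fun_prop
    refine ((IntegrableOn.continuousOn_mul h2 (hνi u) hcf).sub
      (IntegrableOn.continuousOn_mul h3 (hνi v) hcf)).congr (.of_forall fun y => ?_)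
    simp only [Pi.sub_apply]
    ring
  · intro i _
    have h1 := hχc i
    have h2 := hχc' i
    refine IntegrableOn.mono_set (ContinuousOn.integrableOn_compact hcΩ ?_) subset_closure
    fun_prop

theorem exists_continuous_eqOn {Y : Type*} [TopologicalSpace Y] [TietzeExtension.{0} Y]
    {S : Set (Rn n)} (hS : IsClosed S) {f : Rn n → Y} (hf : ContinuousOn f S) :
    ∃ g : Rn n → Y, Continuous g ∧ EqOn g f S := by
  obtain ⟨g, hg⟩ := ContinuousMap.exists_restrict_eq hS ⟨S.domRestrict f, hf.domRestrict⟩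
  exact ⟨g, g.continuous, fun x hx => congrArg (fun q : C(S, Y) => q ⟨x, hx⟩) hg⟩

/-- The integral of the null Lagrangian `∂ᵤf ∂ᵥg - ∂ᵥf ∂ᵤg` is a boundary integral involving only
first derivatives of `g`. -/
theorem IsLipschitzOpenSet.integral_null_lagrangian {Ω : Set (Rn n)} (hLip : IsLipschitzOpenSet Ω)
    (hb : Bornology.IsBounded Ω) {f g : Rn n → ℝ} {f' g' : Rn n → Rn n →L[ℝ] ℝ}
    (hf : ContinuousOn f (closure Ω)) (hf' : ContinuousOn f' (closure Ω))
    (hff' : ∀ x ∈ Ω, HasFDerivAt f (f' x) x) (hg : ContinuousOn g (closure Ω))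
    (hg' : ContinuousOn g' (closure Ω)) (hgg' : ∀ x ∈ Ω, HasFDerivAt g (g' x) x) (u v : Rn n) :
    ∫ y in Ω, (f' y u * g' y v - f' y v * g' y u) =
      ∫ y in frontier Ω, f y * (⟪outwardUnitNormal Ω y, u⟫ * g' y v -
        ⟪outwardUnitNormal Ω y, v⟫ * g' y u) ∂surfaceMeasure n := by
  -- Function and derivative are extended separately by Tietze's theorem; the extended derivative
  -- has to be a derivative only inside Ω.
  have hext : ∀ {q : Rn n → ℝ} {q' : Rn n → Rn n →L[ℝ] ℝ}, ContinuousOn q (closure Ω) →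
      ContinuousOn q' (closure Ω) → (∀ x ∈ Ω, HasFDerivAt q (q' x) x) →
      ∃ p p', HasContDerivOn Ω p p' ∧ EqOn p q (closure Ω) ∧ EqOn p' q' (closure Ω) := by
    intro q q' hq hq' hqq'
    obtain ⟨p, hp, hpq⟩ := exists_continuous_eqOn isClosed_closure hq
    obtain ⟨p', hp', hpq'⟩ := exists_continuous_eqOn isClosed_closure hq'
    refine ⟨p, p', ⟨hp, hp', fun x hx => ?_⟩, hpq, hpq'⟩
    rw [hpq' (subset_closure hx)]
    refine (hqq' x hx).congr_of_eventuallyEq ?_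
    filter_upwards [hLip.1.mem_nhds hx] with y hy
    exact hpq (subset_closure hy)
  obtain ⟨p, p', hp, hpf, hpf'⟩ := hext hf hf' hff'
  obtain ⟨q, q', hq, -, hqg'⟩ := hext hg hg' hgg'
  refine (setIntegral_congr_fun hLip.1.measurableSet fun y hy => ?_).trans
    ((hLip.null_lagrangian hb hp hq u v).trans
      (setIntegral_congr_fun isClosed_frontier.measurableSet fun y hy => ?_))
  · beta_reduce
    rw [hpf' (subset_closure hy), hqg' (subset_closure hy)]
  · beta_reduce
    rw [hpf (frontier_subset_closure hy), hqg' (frontier_subset_closure hy)]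

end NullLagrangian

/-! ### Differentiation at boundary points, and tangent vectors. -/

section BoundaryDerivative

open Filter
open scoped NNReal

variable {n : ℕ} {F : Type*} [NormedAddCommGroup F] [NormedSpace ℝ F]

/-- Mean value inequality for f − A along a segment that lies in Ω except possibly at its endpoint
b, where continuity suffices. -/
theorem norm_sub_sub_le_of_lineMap_mem {Ω B : Set (Rn n)} {f : Rn n → F} {D : Rn n → Rn n →L[ℝ] F}
    (hf : ContinuousOn f (closure Ω)) (hfD : ∀ x ∈ Ω, HasFDerivAt f (D x) x) {A : Rn n →L[ℝ] F}
    {ε : ℝ} (hB : Convex ℝ B) (hD : ∀ z ∈ Ω ∩ B, ‖D z - A‖ ≤ ε) {a b : Rn n} (ha : a ∈ B)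
    (hb : b ∈ B) (hbΩ : b ∈ closure Ω) (hab : ∀ τ ∈ Ico (0 : ℝ) 1, a + τ • (b - a) ∈ Ω) :
    ‖f b - f a - A (b - a)‖ ≤ ε * ‖b - a‖ := by
  set q : ℝ → Rn n := fun τ => a + τ • (b - a)
  have hq : ∀ τ, HasDerivAt q (b - a) τ := fun τ => by
    simpa [q] using ((hasDerivAt_id τ).smul_const (b - a)).const_add a
  have hqc : ∀ τ ∈ Icc (0 : ℝ) 1, q τ ∈ closure Ω := by
    intro τ hτ
    rcases hτ.2.lt_or_eq with h | h
    · exact subset_closure (hab τ ⟨hτ.1, h⟩)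
    · simpa [q, h] using hbΩ
  have hqB : ∀ τ ∈ Icc (0 : ℝ) 1, q τ ∈ B := fun τ hτ => hB.add_smul_sub_mem ha hb hτ
  have hcont : ContinuousOn (fun τ => f (q τ) - A (q τ)) (Icc 0 1) := by
    have hqcont : Continuous q := by fun_prop
    exact (hf.comp hqcont.continuousOn hqc).sub (A.continuous.comp hqcont).continuousOn
  have hder : ∀ τ ∈ Ico (0 : ℝ) 1, HasDerivWithinAt (fun τ => f (q τ) - A (q τ))
      ((D (q τ) - A) (b - a)) (Ici τ) τ := by
    intro τ hτ
    exact (((hfD _ (hab τ hτ)).comp_hasDerivAt τ (hq τ)).sub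
      (A.hasFDerivAt.comp_hasDerivAt τ (hq τ))).hasDerivWithinAt
  have := norm_image_sub_le_of_norm_deriv_right_le_segment hcont hder (C := ε * ‖b - a‖)
    (fun τ hτ => ((D (q τ) - A).le_opNorm _).trans (mul_le_mul_of_nonneg_right
      (hD _ ⟨hab τ hτ, hqB τ ⟨hτ.1, hτ.2.le⟩⟩) (norm_nonneg _))) 1 (right_mem_Icc.2 zero_le_one)
  simp only [q, one_smul, zero_smul, add_zero, add_sub_cancel, sub_zero, mul_one] at this
  rw [map_sub]
  convert this using 2
  abel

/-- A chord between points on or below the graph exceeds the graph by at most 2τ(1 − τ)K|w' − w|,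
which is no more than K|y − x|. Lowering it by more than that puts it in Ω. -/
theorem GraphChart.add_mem {Ω U : Set (Rn n)} {J : Rn (n - 1) →ₗᵢ[ℝ] Rn n} {e : Rn n} {K : ℝ≥0}
    {φ : Rn (n - 1) → ℝ} (h : GraphChart Ω U J e K φ) {x y : Rn n} (hxU : x ∈ U) (hyU : y ∈ U)
    (hx : x ∈ closure Ω) (hy : y ∈ closure Ω) {τ r : ℝ} (hτ : τ ∈ Icc (0 : ℝ) 1)
    (hr : (K : ℝ) * ‖y - x‖ < r) (hU : x + τ • (y - x) - r • e ∈ U) :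
    x + τ • (y - x) - r • e ∈ Ω := by
  obtain ⟨w, hw⟩ := h.decomp x
  obtain ⟨w', hw'⟩ := h.decomp y
  set s := ⟪e, x⟫
  set s' := ⟪e, y⟫
  have hs : s ≤ φ w := h.mem_closure_imp (hw ▸ hxU) (hw ▸ hx)
  have hs' : s' ≤ φ w' := h.mem_closure_imp (hw' ▸ hyU) (hw' ▸ hy)
  have hww : ‖w' - w‖ ≤ ‖y - x‖ := by
    obtain ⟨P, hP⟩ := h.exists_projection
    have h1 : y - x = J (w' - w) + (s' - s) • e := by
      rw [map_sub, sub_smul]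
      nth_rewrite 1 [hw, hw']
      abel
    have h2 := norm_add_smul_sq h.inner_eq h.norm_eq (w' - w) (s' - s)
    rw [← h1] at h2
    nlinarith [norm_nonneg (w' - w), norm_nonneg (y - x), sq_nonneg (s' - s)]
  have heq : x + τ • (y - x) - r • e = J (w + τ • (w' - w)) + (s + τ * (s' - s) - r) • e := by
    rw [map_add, map_smul, map_sub, sub_smul, add_smul, mul_smul, sub_smul]
    nth_rewrite 1 2 [hw]
    nth_rewrite 1 [hw']
    module
  rw [heq] at hU ⊢
  rw [h.mem_iff _ _ hU]
  have hK : (0 : ℝ) ≤ K := K.2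
  have hl : ∀ p p', φ p - K * ‖p - p'‖ ≤ φ p' := fun p p' => by
    have := h.lipschitz.dist_le_mul p p'
    rw [Real.dist_eq, dist_eq_norm] at this
    linarith [le_abs_self (φ p - φ p')]
  have h1 := hl w (w + τ • (w' - w))
  have h2 := hl w' (w + τ • (w' - w))
  have e1 : ‖w - (w + τ • (w' - w))‖ = τ * ‖w' - w‖ := by
    rw [sub_add_cancel_left, norm_neg, norm_smul, Real.norm_of_nonneg hτ.1]
  have e2 : ‖w' - (w + τ • (w' - w))‖ = (1 - τ) * ‖w' - w‖ := by
    rw [show w' - (w + τ • (w' - w)) = (1 - τ) • (w' - w) by module, norm_smul,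
      Real.norm_of_nonneg (by linarith [hτ.2])]
  rw [e1] at h1
  rw [e2] at h2
  have h3 : (K : ℝ) * ‖w' - w‖ ≤ K * ‖y - x‖ := mul_le_mul_of_nonneg_left hww hK
  have h4 := mul_nonneg hK (norm_nonneg (w' - w))
  obtain ⟨h5, h6⟩ := hτ
  nlinarith [mul_le_mul_of_nonneg_left h2 h5, mul_le_mul_of_nonneg_left h1 (sub_nonneg.2 h6),
    mul_le_mul_of_nonneg_left hs' h5, mul_le_mul_of_nonneg_left hs (sub_nonneg.2 h6),
    mul_nonneg h5 (sub_nonneg.2 h6), mul_nonneg (mul_nonneg h5 (sub_nonneg.2 h6)) h4,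
    mul_nonneg h4 (sq_nonneg (1 - τ)), mul_nonneg h4 (sq_nonneg τ)]

/-- A function that is continuous with its derivative up to a Lipschitz boundary is differentiable
at the boundary points, from the closure. -/
theorem IsLipschitzOpenSet.hasFDerivWithinAt_closure {Ω : Set (Rn n)} (hLip : IsLipschitzOpenSet Ω)
    {f : Rn n → F} {D : Rn n → Rn n →L[ℝ] F} (hf : ContinuousOn f (closure Ω))
    (hD : ContinuousOn D (closure Ω)) (hfD : ∀ x ∈ Ω, HasFDerivAt f (D x) x) {x : Rn n}
    (hx : x ∈ frontier Ω) : HasFDerivWithinAt f (D x) (closure Ω) x := by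
  obtain ⟨U, J, e, K, φ, hxU, h⟩ := hLip.exists_graphChart hx
  have hxc := frontier_subset_closure hx
  -- The segment from x to y may leave Ω. The path used instead descends from x by M|y − x| to p,
  -- runs parallel to y − x to q, and ascends to y; M > K keeps the middle piece inside Ω.
  set M : ℝ := K + 1
  have hK : (0 : ℝ) ≤ K := K.2
  rw [hasFDerivWithinAt_iff_isLittleO, Asymptotics.isLittleO_iff]
  intro ε hε
  -- The three pieces of the path have total length (2M + 1)|y − x|.
  have hε' : 0 < ε / (2 * M + 1) := by positivity
  obtain ⟨ρ, hρ, hρD⟩ := Metric.continuousWithinAt_iff.1 (hD x hxc) _ hε'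
  obtain ⟨ρ', hρ', hρU⟩ := Metric.isOpen_iff.1 h.isOpen x hxU
  set R := min ρ ρ'
  have hR : 0 < R := lt_min hρ hρ'
  have hBU : Metric.ball x R ⊆ U := (Metric.ball_subset_ball (min_le_right _ _)).trans hρU
  have hBD : ∀ z ∈ Ω ∩ Metric.ball x R, ‖D z - D x‖ ≤ ε / (2 * M + 1) := fun z hz => by
    rw [← dist_eq_norm]
    exact (hρD (subset_closure hz.1)
      ((Metric.mem_ball.1 hz.2).trans_le (min_le_left _ _))).le
  have hsmall : 0 < R / (M + 1) := by positivity
  filter_upwards [self_mem_nhdsWithin, mem_nhdsWithin_of_mem_nhds (Metric.ball_mem_nhds x hsmall)]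
    with y hy hyx
  rcases eq_or_ne y x with rfl | hne
  · simp
  set r := ‖y - x‖
  have hr : 0 < r := norm_pos_iff.2 (sub_ne_zero.2 hne)
  have hrR : (M + 1) * r < R := by
    have : r < R / (M + 1) := by rwa [Metric.mem_ball, dist_eq_norm] at hyx
    rwa [lt_div_iff₀ (by positivity), mul_comm] at this
  have hball : ∀ τ ∈ Icc (0 : ℝ) 1, ∀ s ∈ Icc (0 : ℝ) M,
      x + τ • (y - x) - (s * r) • e ∈ Metric.ball x R := by
    intro τ hτ s hs
    rw [Metric.mem_ball, dist_eq_norm, show x + τ • (y - x) - (s * r) • e - x =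
      τ • (y - x) - (s * r) • e by abel]
    refine (norm_sub_le _ _).trans_lt ?_
    rw [norm_smul, norm_smul, h.norm_eq, Real.norm_of_nonneg hτ.1,
      Real.norm_of_nonneg (mul_nonneg hs.1 hr.le)]
    have h1 : τ * r ≤ 1 * r := mul_le_mul_of_nonneg_right hτ.2 hr.le
    have h2 : s * r ≤ M * r := mul_le_mul_of_nonneg_right hs.2 hr.le
    change τ * r + s * r * 1 < R
    linarith
  have hxB : x ∈ Metric.ball x R := Metric.mem_ball_self hR
  have hM : 0 ≤ M := by positivity
  have hyB : y ∈ Metric.ball x R := by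
    simpa using hball 1 ⟨zero_le_one, le_rfl⟩ 0 ⟨le_rfl, hM⟩
  set p := x - (M * r) • e
  set q := y - (M * r) • e
  have hpB : p ∈ Metric.ball x R := by
    simpa [p] using hball 0 ⟨le_rfl, zero_le_one⟩ M ⟨hM, le_rfl⟩
  have hqB : q ∈ Metric.ball x R := by
    simpa [q] using hball 1 ⟨zero_le_one, le_rfl⟩ M ⟨hM, le_rfl⟩
  have hMr : 0 < M * r := by positivity
  have hvert : ∀ z ∈ closure Ω, z ∈ Metric.ball x R → z - (M * r) • e ∈ Metric.ball x R →
      ∀ τ ∈ Ico (0 : ℝ) 1, z - (M * r) • e + τ • (z - (z - (M * r) • e)) ∈ Ω := by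
    intro z hz hzB hzB' τ hτ
    have hmem : z - (M * r) • e + τ • (z - (z - (M * r) • e)) ∈ Metric.ball x R :=
      (convex_ball x R).add_smul_sub_mem hzB' hzB ⟨hτ.1, hτ.2.le⟩
    have heq : z - (M * r) • e + τ • (z - (z - (M * r) • e)) =
      z + (0 : ℝ) • (z - z) - ((1 - τ) * (M * r)) • e := by module
    rw [heq] at hmem ⊢
    refine h.add_mem (hBU hzB) (hBU hzB) hz hz ⟨le_rfl, zero_le_one⟩ ?_ (hBU hmem)
    rw [sub_self, norm_zero, mul_zero]
    exact mul_pos (by linarith [hτ.2]) hMr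
  have h1 := norm_sub_sub_le_of_lineMap_mem hf hfD (convex_ball x R) hBD hpB hxB hxc
    (hvert x hxc hxB hpB)
  have h3 := norm_sub_sub_le_of_lineMap_mem hf hfD (convex_ball x R) hBD hqB hyB hy
    (hvert y hy hyB hqB)
  have hpq : ∀ τ ∈ Icc (0 : ℝ) 1, p + τ • (q - p) ∈ Ω := by
    intro τ hτ
    have heq : p + τ • (q - p) = x + τ • (y - x) - (M * r) • e := by
      simp only [p, q]; module
    rw [heq]
    refine h.add_mem (hBU hxB) (hBU hyB) hxc hy hτ ?_ (hBU (hball τ hτ M ⟨hM, le_rfl⟩))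
    exact mul_lt_mul_of_pos_right (lt_add_one _) hr
  have hqΩ : q ∈ Ω := by simpa using hpq 1 ⟨zero_le_one, le_rfl⟩
  have h2 := norm_sub_sub_le_of_lineMap_mem hf hfD (convex_ball x R) hBD hpB hqB
    (subset_closure hqΩ) (fun τ hτ => hpq τ ⟨hτ.1, hτ.2.le⟩)
  have n1 : ‖x - p‖ = M * r := by
    simp only [p, sub_sub_cancel, norm_smul, h.norm_eq, mul_one, Real.norm_of_nonneg hMr.le]
  have n3 : ‖y - q‖ = M * r := by
    simp only [q, sub_sub_cancel, norm_smul, h.norm_eq, mul_one, Real.norm_of_nonneg hMr.le]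
  have n2 : ‖q - p‖ = r := by simp only [p, q, sub_sub_sub_cancel_right]; rfl
  rw [n1] at h1
  rw [n2] at h2
  rw [n3] at h3
  have htot : f y - f x - D x (y - x) = (f y - f q - D x (y - q)) + (f q - f p - D x (q - p)) -
      (f x - f p - D x (x - p)) := by
    simp only [map_sub]
    abel
  rw [htot]
  refine (norm_sub_le _ _).trans ((add_le_add (norm_add_le _ _) le_rfl).trans ?_)
  have : ε / (2 * M + 1) * (M * r) + ε / (2 * M + 1) * r + ε / (2 * M + 1) * (M * r) = ε * r := by
    field_simp
    ring
  linarith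

theorem exists_mem_frontier_segment {Ω : Set (Rn n)} {a b : Rn n} (ha : a ∈ Ω) (hb : b ∉ Ω) :
    ∃ τ ∈ Icc (0 : ℝ) 1, a + τ • (b - a) ∈ frontier Ω := by
  by_contra! h
  have hsub : segment ℝ a b ⊆ interior Ω ∪ interior Ωᶜ := by
    intro z hz
    rw [← compl_frontier_eq_union_interior]
    intro hzf
    rw [segment_eq_image'] at hz
    obtain ⟨τ, hτ, rfl⟩ := hz
    exact h τ hτ hzf
  have ha' := left_mem_segment ℝ a b
  have hb' := right_mem_segment ℝ a b
  obtain ⟨z, -, h1, h2⟩ := (convex_segment a b).isPreconnected _ _ isOpen_interior isOpen_interior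
    hsub ⟨a, ha', (hsub ha').resolve_right fun h => interior_subset h ha⟩
    ⟨b, hb', (hsub hb').resolve_left fun h => hb (interior_subset h)⟩
  exact interior_subset h2 (interior_subset h1)

/-- Every vector orthogonal to the normal is tangent to the boundary. -/
theorem IsOutwardUnitNormal.mem_tangentConeAt {Ω : Set (Rn n)} {x ν w : Rn n}
    (h : IsOutwardUnitNormal Ω x ν) (hw : ⟪ν, w⟫ = 0) {A : Set (Rn n)} (hA : IsOpen A)
    (hxA : x ∈ A) : w ∈ tangentConeAt ℝ (A ∩ frontier Ω) x := by
  have hνν : ⟪ν, ν⟫ = (1 : ℝ) := by rw [real_inner_self_eq_norm_sq, h.1, one_pow]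
  -- near `x`, the boundary meets each short segment transversal to `w`
  have key : ∀ m : ℕ, ∃ t ∈ Ioo (0 : ℝ) (1 / (m + 1)), ∃ s ∈ Icc (-(1 / (m + 1) : ℝ)) (1 / (m + 1)),
      x + t • (w + s • ν) ∈ A ∩ frontier Ω := by
    intro m
    set ε : ℝ := 1 / (m + 1)
    have hε : 0 < ε := Nat.one_div_pos_of_nat
    have hpos : 0 < 2 * (‖w‖ + ε) := by positivity
    have tend : ∀ c : ℝ, Tendsto (fun t : ℝ => x + t • (w + c • ν)) (𝓝[>] 0) (𝓝 x) := by
      intro c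
      have hc : Continuous (fun t : ℝ => x + t • (w + c • ν)) := by fun_prop
      have := hc.tendsto 0
      simp only [zero_smul, add_zero] at this
      exact this.mono_left nhdsWithin_le_nhds
    obtain ⟨ρ, hρ, hρA⟩ := Metric.isOpen_iff.1 hA x hxA
    -- With this tolerance the error at x + t(w ± εν) is at most tε/2, half of the normal
    -- displacement tε. Hence the point with −ε is in Ω, the one with +ε is not, and the segment
    -- between them meets ∂Ω.
    have hev := h.2 (ε / (2 * (‖w‖ + ε))) (by positivity)
    have hin := (tend (-ε)).eventually (hev.and (Metric.ball_mem_nhds x hρ))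
    have hout := (tend ε).eventually (hev.and (Metric.ball_mem_nhds x hρ))
    obtain ⟨t, ⟨⟨h1, h2⟩, ⟨h3, h4⟩⟩, ht⟩ :=
      ((hin.and hout).and (Ioo_mem_nhdsGT hε)).exists
    have ht0 : 0 < t := ht.1
    have hnorm : ∀ c : ℝ, |c| = ε →
        ε / (2 * (‖w‖ + ε)) * ‖x + t • (w + c • ν) - x‖ ≤ t * (ε / 2) := by
      intro c hc
      rw [add_sub_cancel_left, norm_smul, Real.norm_of_nonneg ht0.le]
      have h5 : ‖w + c • ν‖ ≤ ‖w‖ + ε := by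
        refine (norm_add_le _ _).trans ?_
        rw [norm_smul, h.1, mul_one, Real.norm_eq_abs, hc]
      calc ε / (2 * (‖w‖ + ε)) * (t * ‖w + c • ν‖)
          ≤ ε / (2 * (‖w‖ + ε)) * (t * (‖w‖ + ε)) := by gcongr
        _ = t * (ε / 2) := by field_simp
    have hinner : ∀ c : ℝ, ⟪ν, x + t • (w + c • ν) - x⟫ = t * c := by
      intro c
      rw [add_sub_cancel_left, inner_smul_right, inner_add_right, inner_smul_right, hw, hνν]
      ring
    have hte : 0 < t * ε := mul_pos ht0 hε
    have hinΩ : x + t • (w + (-ε) • ν) ∈ Ω := by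
      by_contra hn
      have h5 := h1.2 hn
      rw [hinner] at h5
      linarith [hnorm (-ε) (by rw [abs_neg, abs_of_pos hε])]
    have houtΩ : x + t • (w + ε • ν) ∉ Ω := by
      intro hn
      have h5 := h3.1 hn
      rw [hinner] at h5
      linarith [hnorm ε (abs_of_pos hε)]
    obtain ⟨τ, hτ, hτf⟩ := exists_mem_frontier_segment hinΩ houtΩ
    refine ⟨t, ht, -ε + τ * (2 * ε), ⟨by nlinarith [hτ.1], by nlinarith [hτ.2]⟩, ?_⟩
    have heq : x + t • (w + (-ε) • ν) + τ • (x + t • (w + ε • ν) - (x + t • (w + (-ε) • ν))) =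
      x + t • (w + (-ε + τ * (2 * ε)) • ν) := by module
    have hb := (convex_ball x ρ).add_smul_sub_mem h2 h4 hτ
    rw [heq] at hτf hb
    exact ⟨hρA hb, hτf⟩
  choose t ht s hs hmem using key
  have hlim := tendsto_one_div_add_atTop_nhds_zero_nat (𝕜 := ℝ)
  have ht0 : Tendsto t atTop (𝓝 0) :=
    squeeze_zero (fun m => (ht m).1.le) (fun m => (ht m).2.le) hlim
  have hs0 : Tendsto s atTop (𝓝 0) :=
    tendsto_of_tendsto_of_tendsto_of_le_of_le (by simpa using hlim.neg) hlim
      (fun m => (hs m).1) (fun m => (hs m).2)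
  have hd : Tendsto (fun m => w + s m • ν) atTop (𝓝 w) := by
    simpa using (tendsto_const_nhds (x := w)).add (hs0.smul_const ν)
  refine mem_tangentConeAt_of_seq atTop (fun m => (t m)⁻¹) (fun m => t m • (w + s m • ν)) ?_
    (Eventually.of_forall hmem) ?_
  · simpa using ht0.smul hd
  · refine hd.congr fun m => ?_
    rw [smul_smul, inv_mul_cancel₀ (ht m).1.ne', one_smul]

/-- If q x were nonzero, q would be nonzero on a relatively open piece of ∂Ω, which has positive
surface measure. -/
theorem IsLipschitzOpenSet.eq_zero_of_ae {Ω : Set (Rn n)} (hLip : IsLipschitzOpenSet Ω)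
    {G : Type*} [NormedAddCommGroup G] {A : Set (Rn n)} (hA : IsOpen A) {q : Rn n → G} {x : Rn n}
    (hx : x ∈ A ∩ frontier Ω) (hq : ContinuousWithinAt q (A ∩ frontier Ω) x)
    (h : ∀ᵐ y ∂(surfaceMeasure n).restrict (frontier Ω), q y = 0) : q x = 0 := by
  by_contra hne
  obtain ⟨B, hB, hxB, hBq⟩ := mem_nhdsWithin.1 (hq.eventually_ne hne)
  refine (hLip.surfaceMeasure_pos hx.2 (hA.inter hB) ⟨hx.1, hxB⟩).ne' ?_
  rw [ae_restrict_iff' isClosed_frontier.measurableSet, ae_iff] at h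
  refine measure_mono_null (fun y hy => ?_) h
  simp only [mem_ofPred_eq, Classical.not_imp]
  exact ⟨hy.1, hBq ⟨hy.2.2, hy.2.1, hy.1⟩⟩

/-- The normal exists wherever it is almost everywhere defined and `outwardUnitNormal` is
continuous along the boundary. -/
theorem IsLipschitzOpenSet.isOutwardUnitNormal {Ω : Set (Rn n)} (hLip : IsLipschitzOpenSet Ω)
    (hbdd : Bornology.IsBounded Ω) {A : Set (Rn n)} (hA : IsOpen A) {x : Rn n}
    (hx : x ∈ A ∩ frontier Ω)
    (hν : ContinuousWithinAt (outwardUnitNormal Ω) (A ∩ frontier Ω) x) :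
    IsOutwardUnitNormal Ω x (outwardUnitNormal Ω x) := by
  -- The norm is 1 almost everywhere, hence at x by continuity, which excludes the default value 0.
  have h1 : ‖outwardUnitNormal Ω x‖ - 1 = 0 := by
    refine hLip.eq_zero_of_ae hA hx (hν.norm.sub continuousWithinAt_const) ?_
    filter_upwards [hLip.ae_isOutwardUnitNormal hbdd] with y ⟨v, hv⟩
    rw [Pi.sub_apply, hv.eq, hv.1, sub_self]
  by_cases h : ∃ v, IsOutwardUnitNormal Ω x v
  · obtain ⟨v, hv⟩ := h
    rwa [hv.eq]
  · rw [outwardUnitNormal, dif_neg h] at h1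
    norm_num at h1

end BoundaryDerivative

/-! ### The boundary density in an adapted orthonormal frame. -/

namespace KForm

variable {n k : ℕ}

/-- The interior product as a continuous bilinear map. -/
def contrCLM : Rn n →L[ℝ] KForm n (k + 1) →L[ℝ] KForm n k :=
  (ContinuousAlternatingMap.curryLeftLI (𝕜 := ℝ) (E := Rn n) (F := ℝ)
    (n := k)).toContinuousLinearMap.flip

/-- The exterior product with a vector as a continuous bilinear map. -/
def wedgeCLM : Rn n →L[ℝ] KForm n k →L[ℝ] KForm n (k + 1) :=
  LinearMap.toContinuousLinearMap
    { toFun := fun v => ContinuousAlternatingMap.alternatizeUncurryFinCLM ℝ (Rn n) ℝ ∘L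
        ContinuousLinearMap.smulRightL ℝ (Rn n) (KForm n k) (innerSL ℝ v)
      map_add' := fun v w => by
        ext1 ω
        exact LinearMap.congr_fun (wedgeL.map_add v w) ω
      map_smul' := fun c v => by
        ext1 ω
        exact LinearMap.congr_fun (wedgeL.map_smul c v) ω }

theorem wedgeCLM_apply (v : Rn n) (ω : KForm n k) : wedgeCLM v ω = wedge v ω := rfl

theorem sum_smul_contr (v : Rn n) (ω : KForm n (k + 1)) :
    ∑ j, v j • contr (stdVec j) ω = contr v ω := by
  conv_rhs => rw [← sum_smul_stdVec v, ← contrL_apply]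
  simp [contrL_apply]

/-- Traces of bilinear forms may be computed in any orthonormal basis. -/
theorem sum_bilin_stdVec {ι : Type*} [Fintype ι] (b : OrthonormalBasis ι ℝ (Rn n))
    (B : Rn n →ₗ[ℝ] Rn n →ₗ[ℝ] ℝ) :
    ∑ j, B (stdVec j) (stdVec j) = ∑ i, B (b i) (b i) := by
  calc ∑ j, B (stdVec j) (stdVec j)
      = ∑ j, ∑ i, (b i) j * B (b i) (stdVec j) := by
        refine Finset.sum_congr rfl fun j _ => ?_
        have : B (stdVec j) = ∑ i, (b i) j • B (b i) := by
          conv_lhs => rw [← b.sum_repr' (stdVec j)]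
          simp [inner_stdVec]
        rw [this]
        simp
    _ = ∑ i, ∑ j, (b i) j * B (b i) (stdVec j) := Finset.sum_comm
    _ = ∑ i, B (b i) (b i) := by
        refine Finset.sum_congr rfl fun i _ => ?_
        conv_rhs => arg 2; rw [← sum_smul_stdVec (b i)]
        simp

theorem exists_orthonormalBasis {ν : Rn n} {E : Fin (n - 1) → Rn n} (hν : ‖ν‖ = 1)
    (hE : Orthonormal ℝ E) (hνE : ∀ l, ⟪ν, E l⟫ = 0) :
    ∃ b : OrthonormalBasis (Option (Fin (n - 1))) ℝ (Rn n),
      b none = ν ∧ ∀ l, b (some l) = E l := by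
  have hn : n ≠ 0 := by
    rintro rfl
    rw [Subsingleton.elim ν 0, norm_zero] at hν
    exact zero_ne_one hν
  have hon : Orthonormal ℝ (fun o : Option (Fin (n - 1)) => o.elim ν E) := by
    constructor
    · rintro (_ | l)
      · exact hν
      · exact hE.1 l
    · rintro (_ | l) (_ | m) h
      · exact absurd rfl h
      · exact hνE m
      · exact (real_inner_comm _ _).trans (hνE l)
      · exact hE.2 (by rintro rfl; exact h rfl)
  have hsp := hon.linearIndependent.span_eq_top_of_card_eq_finrank' (by
    rw [Fintype.card_option, Fintype.card_fin, finrank_euclideanSpace_fin]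
    omega)
  refine ⟨OrthonormalBasis.mk hon hsp.ge, ?_, fun l => ?_⟩
  · rw [OrthonormalBasis.coe_mk]; rfl
  · rw [OrthonormalBasis.coe_mk]; rfl

/-- The boundary density obtained from the Gaffney density by integration by parts. -/
def gaffneyBoundary (ν : Rn n) (ω : KForm n (k + 1)) (A : Rn n →L[ℝ] KForm n (k + 1)) : ℝ :=
  ∑ i, ∑ j, inn (contr (stdVec i) ω) (⟪ν, stdVec i⟫ • contr (stdVec j) (A (stdVec j)) -
    ⟪ν, stdVec j⟫ • contr (stdVec j) (A (stdVec i)))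

/-- Contracting the components of ν with the basis vectors turns the double sum into the trace of
one bilinear form, which no longer depends on the basis. -/
theorem gaffneyBoundary_eq_sum (ν : Rn n) (ω : KForm n (k + 1))
    (A : Rn n →L[ℝ] KForm n (k + 1)) :
    gaffneyBoundary ν ω A = ∑ j, (inn (contr ν ω) (contr (stdVec j) (A (stdVec j))) -
      inn (contr (stdVec j) ω) (contr ν (A (stdVec j)))) := by
  have h1 : ∑ i, ∑ j, inn (contr (stdVec i) ω) (⟪ν, stdVec i⟫ • contr (stdVec j) (A (stdVec j))) =
      ∑ j, inn (contr ν ω) (contr (stdVec j) (A (stdVec j))) := by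
    rw [Finset.sum_comm]
    refine Finset.sum_congr rfl fun j _ => ?_
    conv_rhs => rw [← sum_smul_contr ν ω]
    simp [inner_stdVec]
  have h2 : ∑ i, ∑ j, inn (contr (stdVec i) ω) (⟪ν, stdVec j⟫ • contr (stdVec j) (A (stdVec i))) =
      ∑ i, inn (contr (stdVec i) ω) (contr ν (A (stdVec i))) := by
    refine Finset.sum_congr rfl fun i _ => ?_
    conv_rhs => rw [← sum_smul_contr ν (A (stdVec i))]
    simp [inner_stdVec]
  simp only [gaffneyBoundary, map_sub, Finset.sum_sub_distrib, h1, h2]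

/-- In the basis ν, E₁, …, Eₙ₋₁ the entry at ν is ⟨ν⌟ω, ν⌟Aν⟩ − ⟨ν⌟ω, ν⌟Aν⟩ = 0. No normal
derivative survives, so the boundary condition can be used. -/
theorem gaffneyBoundary_eq_sum_frame {ν : Rn n} {E : Fin (n - 1) → Rn n} (hν : ‖ν‖ = 1)
    (hE : Orthonormal ℝ E) (hνE : ∀ l, ⟪ν, E l⟫ = 0) (ω : KForm n (k + 1))
    (A : Rn n →L[ℝ] KForm n (k + 1)) :
    gaffneyBoundary ν ω A = ∑ l, (inn (contr ν ω) (contr (E l) (A (E l))) -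
      inn (contr (E l) ω) (contr ν (A (E l)))) := by
  obtain ⟨b, hb, hbE⟩ := exists_orthonormalBasis hν hE hνE
  have := sum_bilin_stdVec b (LinearMap.mk₂ ℝ
    (fun u v => inn (contrL ν ω) (contrL u (A v)) - inn (contrL u ω) (contrL ν (A v)))
    (by intros; simp; ring) (by intros; simp; ring) (by intros; simp; ring)
    (by intros; simp; ring))
  simp only [LinearMap.mk₂_apply, contrL_apply, Fintype.sum_option, hb, hbE, sub_self,
    zero_add] at this
  rw [gaffneyBoundary_eq_sum, this]

theorem gaffneyBoundary_of_contr_eq_zero {ν : Rn n} {E : Fin (n - 1) → Rn n} (hν : ‖ν‖ = 1)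
    (hE : Orthonormal ℝ E) (hνE : ∀ l, ⟪ν, E l⟫ = 0) {ω : KForm n (k + 1)}
    {A : Rn n →L[ℝ] KForm n (k + 1)} {γ : Fin (n - 1) → ℝ} (hω : contr ν ω = 0)
    (h : ∀ l, contr ν (A (E l)) + γ l • contr (E l) ω = 0) :
    gaffneyBoundary ν ω A = ∑ l, γ l * normSq (contr (E l) ω) := by
  rw [gaffneyBoundary_eq_sum_frame hν hE hνE]
  refine Finset.sum_congr rfl fun l _ => ?_
  rw [hω, eq_neg_of_add_eq_zero_left (h l), normSq_eq_inn]
  simp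

/-- Contracting ν∧ω = 0 with E_l gives ν∧(E_l⌟ω) = 0, which kills the second term by adjointness.
Moving both contractions of the first term across turns it into −⟨E_l∧ω, ν∧A E_l⟩ = γ_l|E_l∧ω|². -/
theorem gaffneyBoundary_of_wedge_eq_zero {ν : Rn n} {E : Fin (n - 1) → Rn n} (hν : ‖ν‖ = 1)
    (hE : Orthonormal ℝ E) (hνE : ∀ l, ⟪ν, E l⟫ = 0) {ω : KForm n (k + 1)}
    {A : Rn n →L[ℝ] KForm n (k + 1)} {γ : Fin (n - 1) → ℝ} (hω : wedge ν ω = 0)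
    (h : ∀ l, wedge ν (A (E l)) + γ l • wedge (E l) ω = 0) :
    gaffneyBoundary ν ω A = ∑ l, γ l * normSq (wedge (E l) ω) := by
  rw [gaffneyBoundary_eq_sum_frame hν hE hνE]
  refine Finset.sum_congr rfl fun l _ => ?_
  have h1 : wedge (E l) (contr ν ω) = -contr ν (wedge (E l) ω) := by
    rw [contr_wedge, hνE, zero_smul, zero_sub, neg_neg]
  have h2 : wedge ν (contr (E l) ω) = 0 := by
    have := contr_wedge (E l) ν ω
    rw [hω, real_inner_comm, hνE, zero_smul, zero_sub] at this
    rw [← neg_eq_zero, ← this, ← contrL_apply, map_zero]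
  rw [← inn_wedge_left, ← inn_wedge_left, h1, h2, map_neg, LinearMap.neg_apply, inn_comm,
    ← inn_wedge_left, eq_neg_of_add_eq_zero_left (h l), normSq_eq_inn]
  simp

end KForm

/-! ### Tangential differentiation of the boundary condition. -/

section BoundaryCondition

open KForm

variable {n k : ℕ}

/-- Differentiating a bilinear boundary condition `B(ν, ω) = 0` along the boundary. -/
theorem HasFDerivWithinAt.bilinear_boundary_condition {V W : Type*} [NormedAddCommGroup V]
    [NormedSpace ℝ V] [NormedAddCommGroup W] [NormedSpace ℝ W] (B : Rn n →L[ℝ] V →L[ℝ] W)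
    {S : Set (Rn n)} {ν : Rn n → Rn n} {ω : Rn n → V} {x w : Rn n} {L : Rn n →L[ℝ] Rn n}
    {A : Rn n →L[ℝ] V} (hν : HasFDerivWithinAt ν L S x) (hω : HasFDerivWithinAt ω A S x)
    (h0 : ∀ y ∈ S, B (ν y) (ω y) = 0) (hx : x ∈ S) (hw : w ∈ tangentConeAt ℝ S x) :
    B (ν x) (A w) + B (L w) (ω x) = 0 := by
  have h1 := B.hasFDerivWithinAt_of_bilinear hν hω
  have h2 : HasFDerivWithinAt (fun y => B (ν y) (ω y)) (0 : Rn n →L[ℝ] W) S x :=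
    (hasFDerivWithinAt_const (0 : W) x S).congr h0 (h0 x hx)
  simpa using h1.unique_on h2 hw

end BoundaryCondition

/-! ### The defect as a boundary integral, and its localization on the smooth pieces. -/

section Gaffney

open KForm

variable {n k : ℕ} {Ω : Set (Rn n)}

namespace KForm

/-- A component of a form, as a continuous linear functional. -/
def compCLM (I : Fin k → Fin n) : KForm n k →L[ℝ] ℝ where
  toFun ω := comp ω I
  map_add' _ _ := rfl
  map_smul' _ _ := rfl
  cont := by unfold comp; fun_prop

theorem continuous_interior_apply (v : Rn n) :
    Continuous fun A : Rn n →L[ℝ] KForm n k => interior v (A v) := by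
  cases k with
  | zero => exact continuous_const
  | succ k =>
    exact (contrCLM v).continuous.comp (ContinuousLinearMap.apply ℝ (KForm n (k + 1)) v).continuous

end KForm

theorem ContinuousOn.integrableOn_of_isBounded (hb : Bornology.IsBounded Ω) {q : Rn n → ℝ}
    (hq : ContinuousOn q (closure Ω)) : IntegrableOn q Ω :=
  (hq.integrableOn_compact (Metric.isCompact_of_isClosed_isBounded isClosed_closure
    hb.closure)).mono_set subset_closure

theorem gaffneyDefect_eq_integral (hΩ : IsOpen Ω) (hb : Bornology.IsBounded Ω)
    {ω : Rn n → KForm n k} {D : Rn n → Rn n →L[ℝ] KForm n k} (hD : ContinuousOn D (closure Ω))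
    (hωD : ∀ x ∈ Ω, fderiv ℝ ω x = D x) :
    gaffneyDefect Ω ω = ∫ x in Ω, (normSq (ContinuousAlternatingMap.alternatizeUncurryFin (D x)) +
      normSq (∑ j, interior (stdVec j) (D x (stdVec j))) - ∑ j, normSq (D x (stdVec j))) := by
  have h1 : ContinuousOn
      (fun x => normSq (ContinuousAlternatingMap.alternatizeUncurryFin (D x))) (closure Ω) :=
    (continuous_normSq.comp (ContinuousAlternatingMap.alternatizeUncurryFinCLM ℝ (Rn n)
      ℝ).continuous).comp_continuousOn hD
  have h2 : ContinuousOn (fun x => normSq (∑ j, interior (stdVec j) (D x (stdVec j))))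
      (closure Ω) :=
    (continuous_normSq.comp (continuous_finsetSum _ fun j _ =>
      continuous_interior_apply (stdVec j))).comp_continuousOn hD
  have h3 : ContinuousOn (fun x => ∑ j, normSq (D x (stdVec j))) (closure Ω) :=
    continuousOn_finsetSum _ fun j _ => continuous_normSq.comp_continuousOn
      (hD.clm_apply continuousOn_const)
  have h12 : IntegrableOn (fun x =>
      normSq (ContinuousAlternatingMap.alternatizeUncurryFin (D x)) +
        normSq (∑ j, interior (stdVec j) (D x (stdVec j)))) Ω :=
    (h1.integrableOn_of_isBounded hb).add (h2.integrableOn_of_isBounded hb)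
  rw [integral_sub h12 (h3.integrableOn_of_isBounded hb), integral_add (h1.integrableOn_of_isBounded hb)
    (h2.integrableOn_of_isBounded hb), gaffneyDefect]
  congr 1
  · congr 1
    · exact setIntegral_congr_fun hΩ.measurableSet fun x hx => by
        simp only [extDeriv, hωD x hx]
    · exact setIntegral_congr_fun hΩ.measurableSet fun x hx => by
        simp only [codiff, hωD x hx]
  · exact setIntegral_congr_fun hΩ.measurableSet fun x hx => by
      simp only [gradNormSq, hωD x hx]

theorem gaffneyDefect_zero_form (hΩ : IsOpen Ω) (hb : Bornology.IsBounded Ω)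
    {ω : Rn n → KForm n 0} {D : Rn n → Rn n →L[ℝ] KForm n 0} (hD : ContinuousOn D (closure Ω))
    (hωD : ∀ x ∈ Ω, fderiv ℝ ω x = D x) : gaffneyDefect Ω ω = 0 := by
  rw [gaffneyDefect_eq_integral hΩ hb hD hωD]
  simp only [normSq_alternatize_zero_form, interior_zero_form, Finset.sum_const_zero,
    normSq_eq_inn (0 : KForm n (0 - 1)), map_zero, add_zero, sub_self, integral_zero]

/-- Integration by parts for a pair of components of the Gaffney density. -/
theorem IsLipschitzOpenSet.integral_inn_contr (hLip : IsLipschitzOpenSet Ω)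
    (hb : Bornology.IsBounded Ω) {ω : Rn n → KForm n (k + 1)}
    {D : Rn n → Rn n →L[ℝ] KForm n (k + 1)} (hω : ContinuousOn ω (closure Ω))
    (hD : ContinuousOn D (closure Ω)) (hωD : ∀ x ∈ Ω, HasFDerivAt ω (D x) x) (u v : Rn n) :
    IntegrableOn (fun x => inn (contr u (ω x)) (⟪outwardUnitNormal Ω x, u⟫ • contr v (D x v) -
        ⟪outwardUnitNormal Ω x, v⟫ • contr v (D x u))) (frontier Ω) (surfaceMeasure n) ∧
      IntegrableOn (fun x => inn (contr u (D x u)) (contr v (D x v)) -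
        inn (contr u (D x v)) (contr v (D x u))) Ω ∧
      ∫ x in Ω, (inn (contr u (D x u)) (contr v (D x v)) -
        inn (contr u (D x v)) (contr v (D x u))) =
      ∫ x in frontier Ω, inn (contr u (ω x)) (⟪outwardUnitNormal Ω x, u⟫ • contr v (D x v) -
        ⟪outwardUnitNormal Ω x, v⟫ • contr v (D x u)) ∂surfaceMeasure n := by
  have hνi : ∀ z, IntegrableOn (fun y => ⟪outwardUnitNormal Ω y, z⟫) (frontier Ω)
      (surfaceMeasure n) := fun z => Integrable.inner_const (𝕜 := ℝ) (hLip.integrableOn_normal hb) z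
  have hcf := isCompact_frontier_of_isBounded hb
  -- Componentwise, the integrand is the null Lagrangian of the scalar functions f = (u⌟ω)^K and g =
  -- (v⌟ω)^K in the directions u and v.
  let ℓ : Rn n → (Fin k → Fin n) → KForm n (k + 1) →L[ℝ] ℝ := fun z K => compCLM K ∘L contrCLM z
  have hℓD : ∀ z w K, ContinuousOn (fun x => ℓ z K (D x w)) (closure Ω) := fun z w K =>
    (ℓ z K).continuous.comp_continuousOn (hD.clm_apply continuousOn_const)
  have hℓω : ∀ z K, ContinuousOn (fun x => ℓ z K (ω x)) (closure Ω) := fun z K =>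
    (ℓ z K).continuous.comp_continuousOn hω
  have hin : ∀ x, inn (contr u (D x u)) (contr v (D x v)) -
      inn (contr u (D x v)) (contr v (D x u)) = (k.factorial : ℝ)⁻¹ * ∑ K,
        (ℓ u K (D x u) * ℓ v K (D x v) - ℓ u K (D x v) * ℓ v K (D x u)) := fun x => by
    rw [inn_apply, inn_apply, ← mul_sub, ← Finset.sum_sub_distrib]
    rfl
  have hbd : ∀ x, inn (contr u (ω x)) (⟪outwardUnitNormal Ω x, u⟫ • contr v (D x v) -
      ⟪outwardUnitNormal Ω x, v⟫ • contr v (D x u)) = (k.factorial : ℝ)⁻¹ * ∑ K,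
        ℓ u K (ω x) * (⟪outwardUnitNormal Ω x, u⟫ * ℓ v K (D x v) -
          ⟪outwardUnitNormal Ω x, v⟫ * ℓ v K (D x u)) := fun x => rfl
  have hIin : ∀ K, IntegrableOn (fun x => ℓ u K (D x u) * ℓ v K (D x v) -
      ℓ u K (D x v) * ℓ v K (D x u)) Ω := fun K =>
    (((hℓD u u K).mul (hℓD v v K)).sub ((hℓD u v K).mul (hℓD v u K))).integrableOn_of_isBounded hb
  have hIbd : ∀ K, IntegrableOn (fun x => ℓ u K (ω x) *
      (⟪outwardUnitNormal Ω x, u⟫ * ℓ v K (D x v) -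
        ⟪outwardUnitNormal Ω x, v⟫ * ℓ v K (D x u))) (frontier Ω) (surfaceMeasure n) := by
    intro K
    have h1 := ((hℓω u K).mul (hℓD v v K)).mono frontier_subset_closure
    have h2 := ((hℓω u K).mul (hℓD v u K)).mono frontier_subset_closure
    refine ((IntegrableOn.continuousOn_mul h1 (hνi u) hcf).sub
      (IntegrableOn.continuousOn_mul h2 (hνi v) hcf)).congr (.of_forall fun y => ?_)
    simp only [Pi.sub_apply, Pi.mul_apply]
    ring
  simp only [hin, hbd]
  refine ⟨(integrable_finsetSum _ fun K _ => hIbd K).const_mul _,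
    (integrable_finsetSum _ fun K _ => hIin K).const_mul _, ?_⟩
  rw [integral_const_mul, integral_const_mul, integral_finsetSum _ fun K _ => hIin K,
    integral_finsetSum _ fun K _ => hIbd K]
  congr 1
  refine Finset.sum_congr rfl fun K _ => ?_
  have hd : ∀ z x, x ∈ Ω → HasFDerivAt (fun x => ℓ z K (ω x)) (ℓ z K ∘L D x) x := fun z x hx =>
    (ℓ z K).hasFDerivAt.comp x (hωD x hx)
  exact hLip.integral_null_lagrangian hb (hℓω u K)
    (f' := fun x => ℓ u K ∘L D x) (g' := fun x => ℓ v K ∘L D x) (continuousOn_const.clm_comp hD)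
    (hd u) (hℓω v K) (continuousOn_const.clm_comp hD) (hd v) u v

theorem IsLipschitzOpenSet.gaffneyDefect_eq (hLip : IsLipschitzOpenSet Ω)
    (hb : Bornology.IsBounded Ω) {ω : Rn n → KForm n (k + 1)}
    {D : Rn n → Rn n →L[ℝ] KForm n (k + 1)} (hω : ContinuousOn ω (closure Ω))
    (hD : ContinuousOn D (closure Ω)) (hωD : ∀ x ∈ Ω, HasFDerivAt ω (D x) x) :
    IntegrableOn (fun x => gaffneyBoundary (outwardUnitNormal Ω x) (ω x) (D x)) (frontier Ω)
      (surfaceMeasure n) ∧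
    gaffneyDefect Ω ω = ∫ x in frontier Ω,
      gaffneyBoundary (outwardUnitNormal Ω x) (ω x) (D x) ∂surfaceMeasure n := by
  have h := fun i j : Fin n =>
    hLip.integral_inn_contr hb hω hD hωD (stdVec i) (stdVec j)
  rw [gaffneyDefect_eq_integral hLip.1 hb hD fun x hx => (hωD x hx).fderiv]
  simp only [interior_succ, gaffney_density, gaffneyBoundary]
  refine ⟨integrable_finsetSum _ fun i _ => integrable_finsetSum _ fun j _ => (h i j).1, ?_⟩
  rw [integral_finsetSum _ fun i _ => integrable_finsetSum _ fun j _ => (h i j).2.1,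
    integral_finsetSum _ fun i _ => integrable_finsetSum _ fun j _ => (h i j).1]
  refine Finset.sum_congr rfl fun i _ => ?_
  rw [integral_finsetSum _ fun j _ => (h i j).2.1, integral_finsetSum _ fun j _ => (h i j).1]
  exact Finset.sum_congr rfl fun j _ => (h i j).2.2

theorem HasPiecewiseC2Boundary.measurableSet {N : ℕ} {Γ : Fin N → Set (Rn n)}
    (hΓ : HasPiecewiseC2Boundary Ω Γ) (s : Fin N) : MeasurableSet (Γ s) := by
  obtain ⟨U, hU, h⟩ := hΓ.relOpen s
  rw [h]
  exact hU.measurableSet.inter isClosed_frontier.measurableSet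

theorem HasPiecewiseC2Boundary.exists_isOpen_inter {N : ℕ} {Γ : Fin N → Set (Rn n)}
    (hΓ : HasPiecewiseC2Boundary Ω Γ) : ∃ A, IsOpen A ∧ ⋃ s, Γ s = A ∩ frontier Ω := by
  choose U hU h using hΓ.relOpen
  refine ⟨⋃ s, U s, isOpen_iUnion hU, ?_⟩
  rw [iUnion_inter]
  exact iUnion_congr h

theorem HasPiecewiseC2Boundary.setIntegral_frontier {N : ℕ} {Γ : Fin N → Set (Rn n)}
    (hΓ : HasPiecewiseC2Boundary Ω Γ) {q h : Rn n → ℝ}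
    (hq : IntegrableOn q (frontier Ω) (surfaceMeasure n)) (hqh : ∀ x ∈ ⋃ s, Γ s, q x = h x) :
    (∀ s, IntegrableOn h (Γ s) (surfaceMeasure n)) ∧
      ∫ x in frontier Ω, q x ∂surfaceMeasure n = ∑ s, ∫ x in Γ s, h x ∂surfaceMeasure n := by
  have hsub : ⋃ s, Γ s ⊆ frontier Ω := by
    obtain ⟨A, -, hA⟩ := hΓ.exists_isOpen_inter
    rw [hA]
    exact inter_subset_right
  have hqs : ∀ s, IntegrableOn q (Γ s) (surfaceMeasure n) := fun s =>
    hq.mono_set ((subset_iUnion Γ s).trans hsub)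
  have hcongr : ∀ s, EqOn q h (Γ s) := fun s x hx => hqh x (mem_iUnion_of_mem s hx)
  refine ⟨fun s => (hqs s).congr_fun (hcongr s) (hΓ.measurableSet s), ?_⟩
  have hae : frontier Ω =ᵐ[surfaceMeasure n] ⋃ s, Γ s :=
    Filter.EventuallyLE.antisymm (ae_le_set.2 hΓ.null) hsub.eventuallyLE
  rw [setIntegral_congr_set hae, integral_iUnion_fintype hΓ.measurableSet hΓ.disjoint hqs]
  exact Finset.sum_congr rfl fun s _ => setIntegral_congr_fun (hΓ.measurableSet s) (hcongr s)

theorem IsC1UpToBoundary.exists_hasFDerivAt (hΩ : IsOpen Ω) {ω : Rn n → KForm n k}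
    (h : IsC1UpToBoundary Ω ω) : ∃ D : Rn n → Rn n →L[ℝ] KForm n k,
      ContinuousOn D (closure Ω) ∧ ∀ x ∈ Ω, HasFDerivAt ω (D x) x := by
  obtain ⟨D, hD, hωD⟩ := h.fderiv_extends
  refine ⟨D, hD, fun x hx => ?_⟩
  rw [← hωD x hx]
  exact ((h.contDiffOn.differentiableOn one_ne_zero).differentiableAt (hΩ.mem_nhds hx)).hasFDerivAt

theorem IsPrincipalFrame.isOutwardUnitNormal (hLip : IsLipschitzOpenSet Ω) (hb : Bornology.IsBounded Ω)
    {S : Set (Rn n)} {E : Fin (n - 1) → Rn n → Rn n} {γ : Fin (n - 1) → Rn n → ℝ}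
    (hE : IsPrincipalFrame Ω S E γ) (hS : ∃ A, IsOpen A ∧ S = A ∩ frontier Ω) {x : Rn n}
    (hx : x ∈ S) : IsOutwardUnitNormal Ω x (outwardUnitNormal Ω x) := by
  obtain ⟨A, hA, rfl⟩ := hS
  obtain ⟨-, -, L, hL, -⟩ := hE x hx
  exact hLip.isOutwardUnitNormal hb hA hx hL.continuousWithinAt

/-- A bilinear boundary condition valid almost everywhere holds at every regular boundary point, and
may be differentiated in the principal directions. -/
theorem IsPrincipalFrame.boundary_condition (hLip : IsLipschitzOpenSet Ω)
    (hb : Bornology.IsBounded Ω) {S : Set (Rn n)} {E : Fin (n - 1) → Rn n → Rn n}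
    {γ : Fin (n - 1) → Rn n → ℝ} (hE : IsPrincipalFrame Ω S E γ)
    (hS : ∃ A, IsOpen A ∧ S = A ∩ frontier Ω) {W : Type*} [NormedAddCommGroup W]
    [NormedSpace ℝ W] (B : Rn n →L[ℝ] KForm n k →L[ℝ] W) {ω : Rn n → KForm n k}
    {D : Rn n → Rn n →L[ℝ] KForm n k} (hω : ContinuousOn ω (closure Ω))
    (hD : ContinuousOn D (closure Ω)) (hωD : ∀ x ∈ Ω, HasFDerivAt ω (D x) x)
    (h : ∀ᵐ x ∂(surfaceMeasure n).restrict (frontier Ω), B (outwardUnitNormal Ω x) (ω x) = 0)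
    {x : Rn n} (hx : x ∈ S) :
    B (outwardUnitNormal Ω x) (ω x) = 0 ∧ ∀ l, B (outwardUnitNormal Ω x) (D x (E l x)) +
      γ l x • B (E l x) (ω x) = 0 := by
  have hν := hE.isOutwardUnitNormal hLip hb hS hx
  obtain ⟨A, hA, rfl⟩ := hS
  have hsub : A ∩ frontier Ω ⊆ closure Ω := inter_subset_right.trans frontier_subset_closure
  -- The principal frame makes ν differentiable, hence continuous, along S, so the condition holds
  -- at every point of S.
  have h0 : ∀ y ∈ A ∩ frontier Ω, B (outwardUnitNormal Ω y) (ω y) = 0 := by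
    intro y hy
    obtain ⟨-, -, L, hL, -⟩ := hE y hy
    refine hLip.eq_zero_of_ae (q := fun y => B (outwardUnitNormal Ω y) (ω y)) hA hy ?_ h
    exact (B.continuous.continuousAt.comp_continuousWithinAt hL.continuousWithinAt).clm_apply
      ((hω y (hsub hy)).mono hsub)
  refine ⟨h0 x hx, fun l => ?_⟩
  obtain ⟨-, hνE, L, hL, hLE⟩ := hE x hx
  -- E_l is orthogonal to ν, hence tangent to S, and derivatives relative to S are determined on
  -- tangent vectors.
  have := hL.bilinear_boundary_condition B
    ((hLip.hasFDerivWithinAt_closure hω hD hωD hx.2).mono hsub) h0 hx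
    (hν.mem_tangentConeAt (hνE l) hA hx.1)
  rwa [hLE, map_smul, ContinuousLinearMap.smul_apply] at this

end Gaffney

end

/-! ### The Gaffney identity under either boundary condition. -/

theorem theorem6p8 {n k N : ℕ} (Ω : Set (Rn n)) (hbdd : Bornology.IsBounded Ω)
    (hLip : IsLipschitzOpenSet Ω) (Γ : Fin N → Set (Rn n)) (hΓ : HasPiecewiseC2Boundary Ω Γ)
    (E : Fin (n - 1) → Rn n → Rn n) (γ : Fin (n - 1) → Rn n → ℝ)
    (hE : IsPrincipalFrame Ω (⋃ s, Γ s) E γ) :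
    (∀ ω : Rn n → KForm n k, IsC1T Ω ω →
      (∀ s, IntegrableOn (fun x => ∑ l, γ l x * KForm.normSq (KForm.wedge (E l x) (ω x)))
        (Γ s) (surfaceMeasure n)) ∧
      gaffneyDefect Ω ω = ∑ s, ∫ x in Γ s,
        ∑ l, γ l x * KForm.normSq (KForm.wedge (E l x) (ω x)) ∂surfaceMeasure n) ∧
    (∀ ω : Rn n → KForm n k, IsC1N Ω ω →
      (∀ s, IntegrableOn (fun x => ∑ l, γ l x * KForm.normSq (KForm.interior (E l x) (ω x)))
        (Γ s) (surfaceMeasure n)) ∧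
      gaffneyDefect Ω ω = ∑ s, ∫ x in Γ s,
        ∑ l, γ l x * KForm.normSq (KForm.interior (E l x) (ω x)) ∂surfaceMeasure n) := by
  have hS := hΓ.exists_isOpen_inter
  cases k with
  -- In degree 0 the codifferential vanishes and |dω|² = |∇ω|², so the defect is 0 and the boundary
  -- densities have to vanish as well.
  | zero =>
    have hdefect : ∀ ω : Rn n → KForm n 0, IsC1UpToBoundary Ω ω → gaffneyDefect Ω ω = 0 := by
      intro ω hω
      obtain ⟨D, hD, hωD⟩ := hω.fderiv_extends
      exact gaffneyDefect_zero_form hLip.1 hbdd hD hωD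
    have hzero : ∀ h : Rn n → ℝ, (∀ x ∈ ⋃ s, Γ s, 0 = h x) →
        (∀ s, IntegrableOn h (Γ s) (surfaceMeasure n)) ∧
          0 = ∑ s, ∫ x in Γ s, h x ∂surfaceMeasure n := by
      intro h hh
      simpa using hΓ.setIntegral_frontier (q := fun _ => 0) integrableOn_zero hh
    have hnz : ∀ m, KForm.normSq (0 : KForm n m) = 0 := fun m => by
      rw [KForm.normSq_eq_inn, map_zero]
    refine ⟨fun ω hω => ?_, fun ω hω => ?_⟩
    · rw [hdefect ω hω.1]
      refine hzero _ fun x hx => ?_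
      obtain ⟨D, hD, hωD⟩ := hω.1.exists_hasFDerivAt hLip.1
      have h0 := (hE.boundary_condition hLip hbdd hS KForm.wedgeCLM hω.1.continuousOn hD hωD
        hω.2 hx).1
      have hν := (hE.isOutwardUnitNormal hLip hbdd hS hx).1
      -- For a 0-form, ν⌟(ν∧ω) = |ν|²ω, so the condition ν∧ω = 0 forces ω = 0 on the smooth pieces.
      have h1 := KForm.contr_wedge_zero_form (outwardUnitNormal Ω x) (outwardUnitNormal Ω x) (ω x)
      rw [real_inner_self_eq_norm_sq, hν, one_pow, one_smul, ← KForm.wedgeCLM_apply, h0,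
        ← KForm.contrL_apply, map_zero] at h1
      refine (Finset.sum_eq_zero fun l _ => ?_).symm
      rw [← h1, ← KForm.wedgeL_apply, map_zero, hnz, mul_zero]
    · rw [hdefect ω hω.1]
      refine hzero _ fun x _ => ?_
      simp only [KForm.interior_zero_form, hnz, mul_zero, Finset.sum_const_zero]
  | succ k =>
    refine ⟨fun ω hω => ?_, fun ω hω => ?_⟩
    · obtain ⟨D, hD, hωD⟩ := hω.1.exists_hasFDerivAt hLip.1
      obtain ⟨hint, heq⟩ := hLip.gaffneyDefect_eq hbdd hω.1.continuousOn hD hωD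
      rw [heq]
      refine hΓ.setIntegral_frontier hint fun x hx => ?_
      obtain ⟨h0, h1⟩ := hE.boundary_condition hLip hbdd hS KForm.wedgeCLM hω.1.continuousOn hD
        hωD hω.2 hx
      exact KForm.gaffneyBoundary_of_wedge_eq_zero (hE.isOutwardUnitNormal hLip hbdd hS hx).1
        (hE x hx).1 (hE x hx).2.1 h0 h1
    · obtain ⟨D, hD, hωD⟩ := hω.1.exists_hasFDerivAt hLip.1
      obtain ⟨hint, heq⟩ := hLip.gaffneyDefect_eq hbdd hω.1.continuousOn hD hωD
      rw [heq]
      refine hΓ.setIntegral_frontier hint fun x hx => ?_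
      obtain ⟨h0, h1⟩ := hE.boundary_condition hLip hbdd hS KForm.contrCLM hω.1.continuousOn hD
        hωD hω.2 hx
      exact KForm.gaffneyBoundary_of_contr_eq_zero (hE.isOutwardUnitNormal hLip hbdd hS hx).1
        (hE x hx).1 (hE x hx).2.1 h0 h1
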